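/- Let $(z,w)=(x+iy,\,u+iv)$ be the coordinates of $\mathbb{C}^2$, and let $M=\{v=F(z,\bar z,u)\}$ be a Levi nondegenerate hypersurface graphed by a real-analytic function $F$ on an open set $\Omega\subset\mathbb{C}_z\times\mathbb{R}_u$. Write $(x_1,y_1)$ and $(x_1,y_1,x_2,y_2)$ for the 1-jets $(\dot x,\dot y)$ and the 2-jets $(\dot x,\dot y,\ddot x,\ddot y)$ of curves $u\mapsto(x(u),y(u))$ in $M$. A 1-jet at $p\in M$ is CR-transversal if the tangent vector with $(\dot u,\dot x,\dot y)=(1,x_1,y_1)$ does not lie in $T^c_pM=T_pM\cap iT_pM$; a 2-jet is CR-transversal if its 1-jet is. For a local biholomorphism $h$ let $h^{(2)}$ be its second prolongation, i.e. the induced map on 2-jets of curves. A normalizing map at $p$ is a local biholomorphism $\varphi$ of $\mathbb{C}^2$ sending $p$ to $0$ and $M$ near $p$ to a real-analytic hypersurface $v=z\bar z+O(6)$ near $0$, where $O(6)$ is a remainder for the weights $[z]=[\bar z]=1$, $[u]=2$. Put $$\Sigma_0=\{x_2=-2x_1^2y_1-2y_1^3,\ \ y_2=2x_1y_1^2+2x_1^3\}\subset\mathbb{R}^4,\qquad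 \Sigma_p=\varphi^{(2)-1}(\Sigma_0),$$ the latter being a set of CR-transversal 2-jets at $p$. Then: 1. At every $p\in M$ there exist normalizing maps, and $\Sigma_p$ does not depend on the normalizing map $\varphi$ at $p$. 2. To each such $M$ are associated two functions $A$, $B$, real-analytic on the open set of all CR-transversal 1-jets $(u,x,y,x_1,y_1)$ of $M$, such that for every $p=(u,x,y)\in M$ the surface $\Sigma_p$ is the graph $$x_2=A(u,x,y,x_1,y_1),\qquad y_2=B(u,x,y,x_1,y_1)$$ over the CR-transversal 1-jets at $p$. 3. The assignment of 2-jets to CR-transversal 1-jets is biholomorphically invariant: if a local biholomorphism $h$ sends $(M,p)$ to another such hypersurface $(M',p')$, with associated functions $A',B'$, and $(x_1,y_1)$ is a CR-transversal 1-jet of $M$ at $p$ whose image direction under $h$ has nonzero $u$-component, then $h^{(2)}$ sends the 2-jet $(x_1,y_1,A,B)$ to $(x_1',y_1',A',B')$, where $(x_1',y_1')$ is the image 1-jet, which is CR-transversal, and $A',B'$ are evaluated at $p'$ and $(x_1',y_1')$. 4. (Moser chains.) For every $p=(u_p,x_p,y_p)\in M$ and every CR-transversal 1-jet $(x_1^p,y_1^p)$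 at $p$, the system $$\ddot x=A(u,x,y,\dot x,\dot y),\qquad \ddot y=B(u,x,y,\dot x,\dot y)$$ has a solution $u\mapsto(x(u),y(u))$ near $u_p$ with $(x,y)(u_p)=(x_p,y_p)$ and $(\dot x,\dot y)(u_p)=(x_1^p,y_1^p)$, and two such solutions on an open interval containing $u_p$ coincide there. -/

import Mathlib

open Set Filter Topology Asymptotics

/-- A real-analytic hypersurface `M³ ⊂ ℂ²` graphed as `v = F(z, z̄, u)` over an open set `Ω` of
`(z, u) ∈ ℂ × ℝ`, in the coordinates `(z, w) = (x + i y, u + i v)` of `ℂ²`. -/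
structure AnalyticGraph where
  Ω : Set (ℂ × ℝ)
  isOpen : IsOpen Ω
  F : ℂ × ℝ → ℝ
  analytic : AnalyticOnNhd ℝ F Ω

namespace AnalyticGraph

noncomputable section

/-- The hypersurface as a subset of `ℂ²`. -/
def carrier (M : AnalyticGraph) : Set (ℂ × ℂ) :=
  {P | (P.1, P.2.re) ∈ M.Ω ∧ P.2.im = M.F (P.1, P.2.re)}

/-- The point of `M` above `(z, u)`. -/
def point (M : AnalyticGraph) (p : ℂ × ℝ) : ℂ × ℂ :=
  (p.1, (p.2 : ℂ) + (M.F p : ℂ) * Complex.I)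

/-- The defining function `ρ = F(z, z̄, u) - v`. -/
def rho (M : AnalyticGraph) (P : ℂ × ℂ) : ℝ :=
  M.F (P.1, P.2.re) - P.2.im

/-- `ξ ∈ T_p^c M = T_p M ∩ i T_p M`. -/
def CRTangent (M : AnalyticGraph) (p : ℂ × ℝ) (ξ : ℂ × ℂ) : Prop :=
  fderiv ℝ M.rho (M.point p) ξ = 0 ∧ fderiv ℝ M.rho (M.point p) (Complex.I • ξ) = 0

/-- Four times the Levi form `∑ ρ_{j k̄} ξ_j ξ̄_k` of `ρ`, written with the real Hessian of `ρ`. -/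
def leviForm (M : AnalyticGraph) (p : ℂ × ℝ) (ξ : ℂ × ℂ) : ℝ :=
  fderiv ℝ (fderiv ℝ M.rho) (M.point p) ξ ξ +
    fderiv ℝ (fderiv ℝ M.rho) (M.point p) (Complex.I • ξ) (Complex.I • ξ)

/-- Levi nondegeneracy at every point: as `T_p^c M` is a complex line, the Levi form is
nondegenerate on it if and only if it does not vanish on nonzero vectors. -/
def LeviNondegenerate (M : AnalyticGraph) : Prop :=
  ∀ p ∈ M.Ω, ∀ ξ : ℂ × ℂ, M.CRTangent p ξ → ξ ≠ 0 → M.leviForm p ξ ≠ 0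

/-- The tangent vector to `M` at the point above `p` with coordinates `(ẋ, ẏ, u̇) = (x₁, y₁, 1)`,
where `z₁ = x₁ + i y₁`. -/
def velocity (M : AnalyticGraph) (p : ℂ × ℝ) (z₁ : ℂ) : ℂ × ℂ :=
  (z₁, 1 + (fderiv ℝ M.F p (z₁, 1) : ℂ) * Complex.I)

/-- The 1-jet `z₁ = x₁ + i y₁` at `p` (of curves `u ↦ (x(u), y(u))`) is CR-transversal. -/
def CRTransversal (M : AnalyticGraph) (p : ℂ × ℝ) (z₁ : ℂ) : Prop :=
  ¬ M.CRTangent p (M.velocity p z₁)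

/-- The set of all CR-transversal 1-jets `(z, u, z₁)` of `M`. -/
def transversalJets (M : AnalyticGraph) : Set ((ℂ × ℝ) × ℂ) :=
  {q | q.1 ∈ M.Ω ∧ M.CRTransversal q.1 q.2}

/-- A curve in `M`, parametrized by `u`, with 2-jet `j = (z₁, z₂)` at `p`. -/
def jetCurve (M : AnalyticGraph) (p : ℂ × ℝ) (j : ℂ × ℂ) (t : ℝ) : ℂ × ℂ :=
  M.point (p.1 + j.1 * ((t - p.2 : ℝ) : ℂ) + j.2 * ((t - p.2 : ℝ) : ℂ) ^ 2 / 2, t)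

/-- Differentiation with respect to `U` along a parametrized curve: `d/dU = (1/U') d/dt`. -/
def derivWrt (U : ℝ → ℝ) (Z : ℝ → ℂ) (t : ℝ) : ℂ :=
  (deriv U t)⁻¹ • deriv Z t

/-- The 2-jet `(dz/du, d²z/du²)` of a parametrized curve `t ↦ (z(t), w(t))` in `ℂ²`,
where `u = Re w`; it is meaningful when `u' ≠ 0`. -/
def curveJet (c : ℝ → ℂ × ℂ) (t : ℝ) : ℂ × ℂ :=
  (derivWrt (fun s => (c s).2.re) (fun s => (c s).1) t,
    derivWrt (fun s => (c s).2.re)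
      (derivWrt (fun s => (c s).2.re) (fun s => (c s).1)) t)

/-- The second prolongation `h⁽²⁾` of a map `h`, on the 2-jets `(z₁, z₂)` of curves in `M` at `p`:
the 2-jet of the image curve. -/
def prolong (M : AnalyticGraph) (h : ℂ × ℂ → ℂ × ℂ) (p : ℂ × ℝ) (j : ℂ × ℂ) : ℂ × ℂ :=
  curveJet (h ∘ M.jetCurve p j) p.2

/-- The image under `h` of the direction of the 1-jet `z₁` at `p` has nonzero `u`-component, so
that the image is again a jet of a curve parametrized by `u`. -/
def ImageParamByU (M : AnalyticGraph) (h : ℂ × ℂ → ℂ × ℂ) (p : ℂ × ℝ) (z₁ : ℂ) : Prop :=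
  (fderiv ℝ h (M.point p) (M.velocity p z₁)).2.re ≠ 0

/-- `e` is a local biholomorphism of `ℂ²` sending `(M, p)` to `(M', p')`. -/
structure IsLocalBiholomorphism (e : OpenPartialHomeomorph (ℂ × ℂ) (ℂ × ℂ))
    (M : AnalyticGraph) (p : ℂ × ℝ) (M' : AnalyticGraph) (p' : ℂ × ℝ) : Prop where
  holo : DifferentiableOn ℂ e e.source
  holo_symm : DifferentiableOn ℂ e.symm e.target
  mem : p ∈ M.Ω
  mem' : p' ∈ M'.Ω
  mem_source : M.point p ∈ e.source
  map_point : e (M.point p) = M'.point p'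
  /-- `e` maps `M ∩ e.source` onto `M' ∩ e.target`. -/
  image : e.IsImage M.carrier M'.carrier

/-- `N` is of the form `v = z z̄ + O(6)` near the origin, with the weights `[z] = [z̄] = 1`,
`[u] = 2` in the remainder. -/
def IsNormalized (N : AnalyticGraph) : Prop :=
  (fun q : ℂ × ℝ => N.F q - ‖q.1‖ ^ 2) =O[𝓝 0] (fun q : ℂ × ℝ => ‖q.1‖ ^ 6 + |q.2| ^ 3)

/-- `φ` is a map (a translation of `p` to the origin followed by a biholomorphism fixing the
origin) normalizing `M` near `p` to some `v = z z̄ + O(6)` near `0`. -/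
def IsNormalizing (M : AnalyticGraph) (p : ℂ × ℝ)
    (φ : OpenPartialHomeomorph (ℂ × ℂ) (ℂ × ℂ)) : Prop :=
  ∃ N : AnalyticGraph, N.IsNormalized ∧ IsLocalBiholomorphism φ M p N 0

/-- The surface `Σ₀` in the 2-jet fiber `ℝ⁴ = {(x₁ + i y₁, x₂ + i y₂)}` above the origin. -/
def sigmaZero : Set (ℂ × ℂ) :=
  {j | j.2.re = -2 * j.1.re ^ 2 * j.1.im - 2 * j.1.im ^ 3 ∧
       j.2.im = 2 * j.1.re * j.1.im ^ 2 + 2 * j.1.re ^ 3}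

/-- The surface `Σ_p = φ⁽²⁾⁻¹(Σ₀)` in the fiber above `p` of 2-jets of CR-transversal curves. -/
def sigma (M : AnalyticGraph) (p : ℂ × ℝ) (φ : ℂ × ℂ → ℂ × ℂ) : Set (ℂ × ℂ) :=
  {j | M.CRTransversal p j.1 ∧ M.prolong φ p j ∈ sigmaZero}

/-- The curve `u ↦ ζ(u) = x(u) + i y(u)` in `M` is a CR-transversal solution on the open set `I`
of the system `ẍ = A(u, x, y, ẋ, ẏ)`, `ÿ = B(u, x, y, ẋ, ẏ)`. -/
def SolvesODE (M : AnalyticGraph) (A B : (ℂ × ℝ) × ℂ → ℝ) (I : Set ℝ) (ζ : ℝ → ℂ) : Prop :=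
  ∀ t ∈ I, ((ζ t, t), deriv ζ t) ∈ M.transversalJets ∧
    DifferentiableAt ℝ ζ t ∧
    HasDerivAt (fun s => (deriv ζ s).re) (A ((ζ t, t), deriv ζ t)) t ∧
    HasDerivAt (fun s => (deriv ζ s).im) (B ((ζ t, t), deriv ζ t)) t

end

end AnalyticGraph

/-!
Along the CR-tangent space, a quadratic change of coordinates brings `M` at `p` to the form
`v = z z̄ + O(3)`; the terms of weight `k = 3, 4, 5` are then removed one weight at a time by maps
`(z + f, w + g)`, where `Im g - 2 Re (z̄ f)` on the hyperquadric is a prescribed polynomial of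
weight `k`. The solution is explicit, so the normalizing map can be chosen to depend analytically
on `p`.

Two normalizing maps at `p` differ by a map between hypersurfaces `v = z z̄ + O(6)`. Comparing the
terms of weight at most five shows that such a map agrees with an automorphism of the hyperquadric
to the order which determines its action on 2-jets, and these automorphisms preserve `Σ₀`. Hence
`Σ_p` is well defined and invariant. In the unknown `z₂` the condition `(z₁, z₂) ∈ Σ_p` is a real
affine equation with invertible linear part, because a biholomorphism sends independent directions
to independent directions, so that `z₂` is an analytic function of the 1-jet. Chains are the
integral curves of the resulting vector field on the space of 1-jets.
-/

section Osgood

open Metric Complex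

theorem exists_continuousOn_slice {X Y Z : Type*} [TopologicalSpace X] [TopologicalSpace Y]
    [TopologicalSpace Z] [Zero Z]
    {s : Set X} {t : Set Y} {f : X × Y → Z} (hf : ContinuousOn f (s ×ˢ t)) :
    ∃ G : X → C(t, Z), ContinuousOn G s ∧ ∀ x ∈ s, ∀ y : t, G x y = f (x, y) := by
  classical
  let f' : C(s × t, Z) := ⟨fun q => f (q.1, q.2),
    hf.comp_continuous (by fun_prop) fun q => ⟨q.1.2, q.2.2⟩⟩
  refine ⟨fun x => if h : x ∈ s then f'.curry ⟨x, h⟩ else 0, ?_, fun x hx y => ?_⟩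
  · rw [continuousOn_iff_continuous_domRestrict]
    convert f'.curry.continuous using 1
    ext x y
    simp only [domRestrict_apply, dif_pos x.2]
  · simp only [dif_pos hx]
    rfl

variable {E : Type*} [NormedAddCommGroup E] [NormedSpace ℂ E]

/-- The contour integral `∮ κ(η) • g(η) dη` over a circle, as a continuous bilinear map in the
kernel `κ` and in the density `g`. -/
noncomputable def contourPairing (E : Type*) [NormedAddCommGroup E] [NormedSpace ℂ E] (b : ℂ)
    {R : ℝ} (hR : 0 ≤ R) : C(sphere b R, ℂ) →L[ℂ] C(sphere b R, E) →L[ℂ] E :=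
  have hintegrable (κ : C(sphere b R, ℂ)) (g : C(sphere b R, E)) : IntervalIntegrable (fun θ : ℝ =>
      deriv (circleMap b R) θ • κ ⟨_, circleMap_mem_sphere b hR θ⟩ •
        g ⟨_, circleMap_mem_sphere b hR θ⟩) MeasureTheory.volume 0 (2 * Real.pi) := by
    simp only [deriv_circleMap]
    exact Continuous.intervalIntegrable (by fun_prop) _ _
  LinearMap.mkContinuous₂
    (LinearMap.mk₂ ℂ (fun κ g => ∫ θ in (0 : ℝ)..2 * Real.pi, deriv (circleMap b R) θ •
        κ ⟨_, circleMap_mem_sphere b hR θ⟩ • g ⟨_, circleMap_mem_sphere b hR θ⟩)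
      (fun κ κ' g => by
        rw [← intervalIntegral.integral_add (hintegrable κ g) (hintegrable κ' g)]
        simp only [ContinuousMap.add_apply, add_smul, smul_add])
      (fun c κ g => by
        rw [← intervalIntegral.integral_smul]
        simp only [ContinuousMap.smul_apply, smul_assoc, smul_comm c])
      (fun κ g g' => by
        rw [← intervalIntegral.integral_add (hintegrable κ g) (hintegrable κ g')]
        simp only [ContinuousMap.add_apply, smul_add])
      (fun c κ g => by
        rw [← intervalIntegral.integral_smul]
        simp only [ContinuousMap.smul_apply, smul_comm c]))
    (R * |2 * Real.pi - 0|) (by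
      intro κ g
      rw [LinearMap.mk₂_apply, mul_assoc, mul_right_comm, ← mul_assoc R]
      refine intervalIntegral.norm_integral_le_of_norm_le_const fun θ _ => ?_
      rw [norm_smul, norm_smul, deriv_circleMap, norm_mul, norm_circleMap_zero, norm_I, mul_one,
        abs_of_nonneg hR, mul_assoc]
      gcongr
      · exact κ.norm_coe_le_norm _
      · exact g.norm_coe_le_norm _)

theorem contourPairing_apply {b : ℂ} {R : ℝ} (hR : 0 ≤ R) {κ : C(sphere b R, ℂ)}
    {g : C(sphere b R, E)} {κ' : ℂ → ℂ} {g' : ℂ → E} (hκ : ∀ η : sphere b R, κ η = κ' η)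
    (hg : ∀ η : sphere b R, g η = g' η) :
    contourPairing E b hR κ g = ∮ η in C(b, R), κ' η • g' η := by
  simp only [contourPairing, LinearMap.mkContinuous₂_apply, LinearMap.mk₂_apply, hκ, hg,
    circleIntegral]

theorem exists_analyticAt_cauchyKernel (b : ℂ) {R : ℝ} (hR : 0 < R) :
    ∃ κ : ℂ → C(sphere b R, ℂ), AnalyticAt ℂ κ b ∧
      ∀ w ∈ ball b R, ∀ η : sphere b R, κ w η = ((η : ℂ) - w)⁻¹ := by
  let ι : C(sphere b R, ℂ) := ⟨(↑), continuous_subtype_val⟩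
  have hne : ∀ w ∈ ball b R, ∀ η : sphere b R, (η : ℂ) - w ≠ 0 := fun w hw η h0 =>
    (mem_ball.1 hw).ne (sub_eq_zero.1 h0 ▸ η.2)
  have hunit : ∀ w ∈ ball b R, ∃ u : C(sphere b R, ℂ)ˣ,
      (u : C(sphere b R, ℂ)) = ι - algebraMap ℂ _ w ∧
      ∀ η, (↑u⁻¹ : C(sphere b R, ℂ)) η = ((η : ℂ) - w)⁻¹ := by
    intro w hw
    refine ⟨⟨ι - algebraMap ℂ _ w, ⟨fun η => ((η : ℂ) - w)⁻¹,
      (continuous_subtype_val.sub continuous_const).inv₀ (hne w hw)⟩, ?_, ?_⟩, rfl, fun η => rfl⟩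
    · exact ContinuousMap.ext fun η => mul_inv_cancel₀ (hne w hw η)
    · exact ContinuousMap.ext fun η => inv_mul_cancel₀ (hne w hw η)
  refine ⟨fun w => Ring.inverse (ι - algebraMap ℂ _ w), ?_, fun w hw η => ?_⟩
  · obtain ⟨u, hu, -⟩ := hunit b (mem_ball_self hR)
    have hinv : AnalyticAt ℂ Ring.inverse (ι - algebraMap ℂ C(sphere b R, ℂ) b) :=
      hu ▸ analyticAt_inverse u
    exact hinv.fun_comp (f := fun w => ι - algebraMap ℂ C(sphere b R, ℂ) w)
      (analyticAt_const.fun_sub ((algebraMapCLM ℂ C(sphere b R, ℂ)).analyticAt b))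
  · obtain ⟨u, hu, hu'⟩ := hunit w hw
    simp only [← hu, Ring.inverse_unit, hu']

variable [CompleteSpace E]

theorem analyticAt_of_differentiableOn_slices {K : Type*} [TopologicalSpace K] [CompactSpace K]
    {a : ℂ} {R : ℝ} (hR : 0 < R) {G : ℂ → C(K, E)} (hG : ContinuousOn G (closedBall a R))
    (hd : ∀ η, DifferentiableOn ℂ (fun z => G z η) (closedBall a R)) : AnalyticAt ℂ G a := by
  have hGs : ContinuousOn G (sphere a R) := hG.mono sphere_subset_closedBall
  have hcirc : CircleIntegrable G a (⟨R, hR.le⟩ : NNReal) := hGs.circleIntegrable hR.le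
  refine (hasFPowerSeriesOn_cauchy_integral hcirc hR).analyticAt.congr ?_
  filter_upwards [ball_mem_nhds a hR] with z hz
  ext η
  have hintegrable : CircleIntegrable (fun ξ => (ξ - z)⁻¹ • G ξ) a R := by
    refine ((continuousOn_id.sub continuousOn_const).inv₀ fun ξ hξ h0 => ?_).fun_smul hGs
      |>.circleIntegrable hR.le
    exact (mem_ball.1 hz).ne ((sub_eq_zero.1 h0 : ξ = z) ▸ hξ)
  rw [← ((hd η).diffContOnCl_ball Subset.rfl).two_pi_i_inv_smul_circleIntegral_sub_inv_smul hz,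
    ContinuousMap.smul_apply]
  exact congrArg _ ((ContinuousMap.evalCLM ℂ η).intervalIntegral_comp_comm hintegrable.out).symm

/-- **Osgood's lemma** in two variables. -/
theorem analyticAt_prod_of_differentiableOn {f : ℂ × ℂ → E} {U : Set (ℂ × ℂ)} (hU : IsOpen U)
    (hf : DifferentiableOn ℂ f U) {x : ℂ × ℂ} (hx : x ∈ U) : AnalyticAt ℂ f x := by
  obtain ⟨a, b⟩ := x
  obtain ⟨R, hR, hRU⟩ : ∃ R > 0, closedBall a R ×ˢ closedBall b R ⊆ U := by
    obtain ⟨R, hR, h⟩ := Metric.nhds_basis_closedBall.mem_iff.1 (hU.mem_nhds hx)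
    exact ⟨R, hR, by rwa [closedBall_prod_same]⟩
  obtain ⟨G, hGc, hGf⟩ := exists_continuousOn_slice (hf.continuousOn.mono
    ((prod_mono_right sphere_subset_closedBall).trans hRU))
  have hG : AnalyticAt ℂ G a := analyticAt_of_differentiableOn_slices hR hGc fun η =>
    (hf.comp (by fun_prop) fun z hz => hRU ⟨hz, sphere_subset_closedBall η.2⟩).congr
      fun z hz => hGf z hz η
  obtain ⟨κ, hκ, hκη⟩ := exists_analyticAt_cauchyKernel b hR
  have hpair : AnalyticAt ℂ (fun q : ℂ × ℂ =>
      (2 * Real.pi * I : ℂ)⁻¹ • contourPairing E b hR.le (κ q.2) (G q.1)) (a, b) :=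
    analyticAt_const.smul <| ((contourPairing E b hR.le).analyticAt_bilinear (κ b, G a)).comp₂
      (hκ.fun_comp (f := Prod.snd) (x := (a, b)) analyticAt_snd)
      (hG.fun_comp (f := Prod.fst) (x := (a, b)) analyticAt_fst)
  refine hpair.congr ?_
  filter_upwards [prod_mem_nhds (ball_mem_nhds a hR) (ball_mem_nhds b hR)] with q hq
  have hq₁ := ball_subset_closedBall hq.1
  have hd : DifferentiableOn ℂ (fun w => f (q.1, w)) (closedBall b R) :=
    hf.comp (by fun_prop) fun w hw => hRU ⟨hq₁, hw⟩
  rw [contourPairing_apply hR.le (κ' := fun η => (η - q.2)⁻¹) (hκη q.2 hq.2)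
    (g' := fun η => f (q.1, η)) (hGf q.1 hq₁)]
  exact (hd.diffContOnCl_ball Subset.rfl).two_pi_i_inv_smul_circleIntegral_sub_inv_smul hq.2

end Osgood

section SecondDerivative

variable {E F : Type*} [NormedAddCommGroup E] [NormedSpace ℝ E] [NormedAddCommGroup F]
  [NormedSpace ℝ F] {c : ℝ → E} {t : ℝ} {X Y : E}

/-- The curve `c` is differentiable near `t` and twice differentiable at `t`, with first and second
derivatives `X` and `Y` at `t`. -/
def HasSecondDerivAt (c : ℝ → E) (X Y : E) (t : ℝ) : Prop :=
  ∃ c' : ℝ → E, (∀ᶠ s in 𝓝 t, HasDerivAt c (c' s) s) ∧ c' t = X ∧ HasDerivAt c' Y t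

namespace HasSecondDerivAt

theorem hasDerivAt (h : HasSecondDerivAt c X Y t) : HasDerivAt c X t := by
  obtain ⟨c', hc, rfl, -⟩ := h
  exact hc.self_of_nhds

theorem congr {d : ℝ → E} (h : HasSecondDerivAt c X Y t) (hcd : d =ᶠ[𝓝 t] c) :
    HasSecondDerivAt d X Y t := by
  obtain ⟨c', hc, hX, hY⟩ := h
  refine ⟨c', ?_, hX, hY⟩
  filter_upwards [hc, hcd.eventuallyEq_nhds] with s hs hds
  exact hs.congr_of_eventuallyEq hds

theorem clm (L : E →L[ℝ] F) (h : HasSecondDerivAt c X Y t) :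
    HasSecondDerivAt (L ∘ c) (L X) (L Y) t := by
  obtain ⟨c', hc, rfl, hY⟩ := h
  exact ⟨L ∘ c', hc.mono fun s hs => L.hasFDerivAt.comp_hasDerivAt s hs, rfl,
    L.hasFDerivAt.comp_hasDerivAt t hY⟩

theorem comp {Ψ : E → F} (hΨ : ContDiffAt ℝ 2 Ψ (c t)) (h : HasSecondDerivAt c X Y t) :
    HasSecondDerivAt (Ψ ∘ c) (fderiv ℝ Ψ (c t) X)
      (fderiv ℝ (fderiv ℝ Ψ) (c t) X X + fderiv ℝ Ψ (c t) Y) t := by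
  obtain ⟨c', hc, rfl, hY⟩ := h
  have hd : ∀ᶠ s in 𝓝 t, DifferentiableAt ℝ Ψ (c s) :=
    (hc.self_of_nhds.continuousAt.eventually (hΨ.eventually (by simp))).mono
      fun s hs => hs.differentiableAt (by simp)
  have hd' : DifferentiableAt ℝ (fderiv ℝ Ψ) (c t) :=
    (hΨ.fderiv_right (m := 1) (by norm_num)).differentiableAt (by simp)
  refine ⟨fun s => fderiv ℝ Ψ (c s) (c' s), ?_, rfl,
    (hd'.hasFDerivAt.comp_hasDerivAt t hc.self_of_nhds).clm_apply hY⟩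
  filter_upwards [hc, hd] with s hs hds
  exact hds.hasFDerivAt.comp_hasDerivAt s hs

end HasSecondDerivAt

end SecondDerivative

namespace AnalyticGraph

/-- The 2-jet `(dz/du, d²z/du²)` of a curve in `ℂ²` with first and second derivatives `X`, `Y`. -/
noncomputable def jetOf (X Y : ℂ × ℂ) : ℂ × ℂ :=
  (X.1 / (X.2.re : ℂ), ((X.2.re : ℂ) * Y.1 - (Y.2.re : ℂ) * X.1) / (X.2.re : ℂ) ^ 3)

theorem jetOf_reparam (X Y : ℂ × ℂ) {a : ℝ} (b : ℝ) (ha : a ≠ 0) :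
    jetOf (a • X) ((a ^ 2) • Y + b • X) = jetOf X Y := by
  have ha' : (a : ℂ) ≠ 0 := mod_cast ha
  by_cases hX : X.2.re = 0
  · ext1 <;> simp [jetOf, hX]
  have hX' : (X.2.re : ℂ) ≠ 0 := mod_cast hX
  ext1
  · simp only [jetOf, Prod.smul_fst, Prod.smul_snd, Complex.real_smul, Complex.re_ofReal_mul,
      Complex.ofReal_mul]
    field_simp
  · simp only [jetOf, Prod.smul_fst, Prod.smul_snd, Complex.real_smul, Complex.re_ofReal_mul,
      Complex.ofReal_mul, Prod.fst_add, Prod.snd_add, Complex.add_re, Complex.ofReal_add]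
    push_cast
    field_simp
    ring

theorem curveJet_eq_jetOf {c : ℝ → ℂ × ℂ} {t : ℝ} {X Y : ℂ × ℂ} (h : HasSecondDerivAt c X Y t)
    (hX : X.2.re ≠ 0) : curveJet c t = jetOf X Y := by
  obtain ⟨c', hc, rfl, hY⟩ := h
  let re₂ : ℂ × ℂ →L[ℝ] ℝ := Complex.reCLM.comp (ContinuousLinearMap.snd ℝ ℂ ℂ)
  let fst : ℂ × ℂ →L[ℝ] ℂ := ContinuousLinearMap.fst ℝ ℂ ℂ
  have hu : ∀ᶠ s in 𝓝 t, HasDerivAt (fun s => (c s).2.re) (c' s).2.re s :=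
    hc.mono fun s hs => re₂.hasFDerivAt.comp_hasDerivAt s hs
  have hz : ∀ᶠ s in 𝓝 t, HasDerivAt (fun s => (c s).1) (c' s).1 s :=
    hc.mono fun s hs => fst.hasFDerivAt.comp_hasDerivAt s hs
  have hu' : HasDerivAt (fun s => (c' s).2.re) Y.2.re t := re₂.hasFDerivAt.comp_hasDerivAt t hY
  have hz' : HasDerivAt (fun s => (c' s).1) Y.1 t := fst.hasFDerivAt.comp_hasDerivAt t hY
  have hdz : derivWrt (fun s => (c s).2.re) (fun s => (c s).1) =ᶠ[𝓝 t]
      fun s => ((c' s).2.re)⁻¹ • (c' s).1 := by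
    filter_upwards [hu, hz] with s hus hzs
    rw [derivWrt, hus.deriv, hzs.deriv]
  have hX' : ((c' t).2.re : ℂ) ≠ 0 := mod_cast hX
  refine Prod.ext ?_ ?_
  · exact hdz.self_of_nhds.trans (by simp only [jetOf, Complex.real_smul, Complex.ofReal_inv,
      div_eq_inv_mul])
  · change derivWrt _ (derivWrt _ _) t = _
    rw [derivWrt, hdz.deriv_eq, hu.self_of_nhds.deriv, ((hu'.fun_inv hX).fun_smul hz').deriv]
    simp only [jetOf, Complex.real_smul, Complex.ofReal_inv, Complex.ofReal_div, Complex.ofReal_neg,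
      Complex.ofReal_pow]
    field_simp
    ring

theorem curveJet_congr {c d : ℝ → ℂ × ℂ} {t : ℝ} (h : c =ᶠ[𝓝 t] d) :
    curveJet c t = curveJet d t := by
  have hu : (fun s => (c s).2.re) =ᶠ[𝓝 t] fun s => (d s).2.re := h.fun_comp fun P => P.2.re
  have hdz : derivWrt (fun s => (c s).2.re) (fun s => (c s).1) =ᶠ[𝓝 t]
      derivWrt (fun s => (d s).2.re) (fun s => (d s).1) := by
    filter_upwards [hu.deriv, (h.fun_comp Prod.fst).deriv] with s hus hzs
    exact congrArg₂ (fun (a : ℝ) (b : ℂ) => a⁻¹ • b) hus hzs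
  refine Prod.ext hdz.self_of_nhds ?_
  exact congrArg₂ (fun (a : ℝ) (b : ℂ) => a⁻¹ • b) hu.deriv_eq hdz.deriv_eq

/-- The base curve `u ↦ (z(u), u)` with 2-jet `j` at `p`, of which `jetCurve` is the lift to `M`. -/
noncomputable def baseCurve (p : ℂ × ℝ) (j : ℂ × ℂ) (t : ℝ) : ℂ × ℝ :=
  (p.1 + j.1 * ((t - p.2 : ℝ) : ℂ) + j.2 * ((t - p.2 : ℝ) : ℂ) ^ 2 / 2, t)

@[simp] theorem baseCurve_self (p : ℂ × ℝ) (j : ℂ × ℂ) : baseCurve p j p.2 = p := by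
  ext1 <;> simp [baseCurve]

theorem hasSecondDerivAt_baseCurve (p : ℂ × ℝ) (j : ℂ × ℂ) :
    HasSecondDerivAt (baseCurve p j) (j.1, 1) (j.2, 0) p.2 := by
  have hsub (t : ℝ) : HasDerivAt (fun t : ℝ => ((t - p.2 : ℝ) : ℂ)) 1 t := by
    simpa using ((hasDerivAt_id t).sub_const p.2).ofReal_comp
  refine ⟨fun t => (j.1 + j.2 * ((t - p.2 : ℝ) : ℂ), 1), Eventually.of_forall fun t => ?_,
    by simp, ?_⟩
  · refine HasDerivAt.prodMk ?_ (hasDerivAt_id t)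
    refine (((hsub t).const_mul j.1).const_add p.1).add
      ((((hsub t).pow 2).const_mul j.2).div_const 2) |>.congr_deriv ?_
    simp only [Nat.add_one_sub_one, pow_one, mul_one]
    push_cast
    ring
  · refine HasDerivAt.prodMk ?_ (hasDerivAt_const _ _)
    simpa using ((hsub p.2).const_mul j.2).const_add j.1

theorem tendsto_baseCurve (p : ℂ × ℝ) (j : ℂ × ℂ) : Tendsto (baseCurve p j) (𝓝 p.2) (𝓝 p) := by
  simpa using (hasSecondDerivAt_baseCurve p j).hasDerivAt.continuousAt.tendsto

/-- The first derivative of the image under `Ψ` of a curve in the base with 1-jet `z₁` at `p`. -/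
noncomputable def firstOrder (Ψ : ℂ × ℝ → ℂ × ℂ) (p : ℂ × ℝ) (z₁ : ℂ) : ℂ × ℂ :=
  fderiv ℝ Ψ p (z₁, 1)

/-- The second derivative of the image under `Ψ` of a curve in the base with 2-jet `j` at `p`. -/
noncomputable def secondOrder (Ψ : ℂ × ℝ → ℂ × ℂ) (p : ℂ × ℝ) (j : ℂ × ℂ) : ℂ × ℂ :=
  fderiv ℝ (fderiv ℝ Ψ) p (j.1, 1) (j.1, 1) + fderiv ℝ Ψ p (j.2, 0)

theorem hasSecondDerivAt_comp_baseCurve {Ψ : ℂ × ℝ → ℂ × ℂ} {p : ℂ × ℝ} (j : ℂ × ℂ)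
    (hΨ : ContDiffAt ℝ 2 Ψ p) :
    HasSecondDerivAt (Ψ ∘ baseCurve p j) (firstOrder Ψ p j.1) (secondOrder Ψ p j) p.2 := by
  simpa [firstOrder, secondOrder] using
    (hasSecondDerivAt_baseCurve p j).comp (Ψ := Ψ) (by simpa using hΨ)

theorem prolong_eq (M : AnalyticGraph) {h : ℂ × ℂ → ℂ × ℂ} {p : ℂ × ℝ} (j : ℂ × ℂ)
    (hΨ : ContDiffAt ℝ 2 (h ∘ M.point) p) (hX : (firstOrder (h ∘ M.point) p j.1).2.re ≠ 0) :
    M.prolong h p j =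
      jetOf (firstOrder (h ∘ M.point) p j.1) (secondOrder (h ∘ M.point) p j) :=
  curveJet_eq_jetOf (hasSecondDerivAt_comp_baseCurve j hΨ) hX

/-- The projection of `ℂ²` to the base coordinates `(z, u)`. -/
noncomputable def base : ℂ × ℂ →L[ℝ] ℂ × ℝ :=
  (ContinuousLinearMap.fst ℝ ℂ ℂ).prod (Complex.reCLM.comp (ContinuousLinearMap.snd ℝ ℂ ℂ))

@[simp] theorem base_apply (P : ℂ × ℂ) : base P = (P.1, P.2.re) := rfl

theorem base_point (M : AnalyticGraph) (p : ℂ × ℝ) : base (M.point p) = p := by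
  simp [point]

theorem point_base {M : AnalyticGraph} {P : ℂ × ℂ} (hP : P ∈ M.carrier) :
    M.point (base P) = P :=
  Prod.ext rfl (Complex.ext (by simp [point]) (by simpa [point] using hP.2.symm))

theorem point_mem_carrier (M : AnalyticGraph) {p : ℂ × ℝ} (hp : p ∈ M.Ω) :
    M.point p ∈ M.carrier := by
  simpa [carrier, point] using hp

theorem base_eq_smul_jetOf {X : ℂ × ℂ} (Y : ℂ × ℂ) (hX : X.2.re ≠ 0) :
    base X = X.2.re • ((jetOf X Y).1, (1 : ℝ)) := by
  have hX' : (X.2.re : ℂ) ≠ 0 := mod_cast hX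
  simp [jetOf, mul_div_cancel₀ _ hX']

theorem base_eq_smul_add_jetOf {X : ℂ × ℂ} (Y : ℂ × ℂ) (hX : X.2.re ≠ 0) :
    base Y = (X.2.re ^ 2) • ((jetOf X Y).2, (0 : ℝ)) + Y.2.re • ((jetOf X Y).1, (1 : ℝ)) := by
  have hX' : (X.2.re : ℂ) ≠ 0 := mod_cast hX
  ext1
  · simp only [base_apply, jetOf, Prod.smul_mk, Prod.mk_add_mk, Complex.real_smul,
      Complex.ofReal_pow]
    field_simp
    ring
  · simp

theorem jetOf_bilinear {L : ℂ × ℝ →L[ℝ] ℂ × ℂ} {B : ℂ × ℝ →L[ℝ] ℂ × ℝ →L[ℝ] ℂ × ℂ}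
    {X : ℂ × ℂ} (Y : ℂ × ℂ) (hX : X.2.re ≠ 0) :
    jetOf (L (base X)) (B (base X) (base X) + L (base Y)) =
      jetOf (L ((jetOf X Y).1, 1))
        (B ((jetOf X Y).1, 1) ((jetOf X Y).1, 1) + L ((jetOf X Y).2, 0)) := by
  rw [← jetOf_reparam (L ((jetOf X Y).1, 1)) _ Y.2.re hX, base_eq_smul_jetOf Y hX,
    base_eq_smul_add_jetOf Y hX]
  congr 1
  · rw [map_smul]
  · simp only [map_smul, map_add, smul_apply, smul_add, smul_smul, add_assoc, pow_two]

/-- The image curve projects to a curve in the base of `M'`, which is not parametrized by `u`;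
`jetOf_bilinear` accounts for its reparametrization. -/
theorem prolong_comp {M M' : AnalyticGraph} {h g : ℂ × ℂ → ℂ × ℂ} {p p' : ℂ × ℝ} (j : ℂ × ℂ)
    (hh : ContDiffAt ℝ 2 (h ∘ M.point) p) (hg : ContDiffAt ℝ 2 (g ∘ M'.point) p')
    (hp : h (M.point p) = M'.point p') (hmem : ∀ᶠ q in 𝓝 p, h (M.point q) ∈ M'.carrier)
    (hX : (firstOrder (h ∘ M.point) p j.1).2.re ≠ 0)
    (hX' : (firstOrder (g ∘ M'.point) p' (M.prolong h p j).1).2.re ≠ 0) :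
    M.prolong (g ∘ h) p j = M'.prolong g p' (M.prolong h p j) := by
  set X := firstOrder (h ∘ M.point) p j.1
  set Y := secondOrder (h ∘ M.point) p j
  set L := fderiv ℝ (g ∘ M'.point) p'
  have hprolong : M.prolong h p j = jetOf X Y := M.prolong_eq j hh hX
  let γ : ℝ → ℂ × ℝ := base ∘ ((h ∘ M.point) ∘ baseCurve p j)
  have hγ : γ p.2 = p' := by
    simp only [γ, Function.comp_apply, baseCurve_self, hp, base_point]
  have hlift : (g ∘ h) ∘ M.jetCurve p j =ᶠ[𝓝 p.2] (g ∘ M'.point) ∘ γ := by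
    filter_upwards [(tendsto_baseCurve p j).eventually hmem] with s hs
    exact congrArg g (point_base hs).symm
  have hcurve : HasSecondDerivAt ((g ∘ h) ∘ M.jetCurve p j) (L (base X))
      (fderiv ℝ (fderiv ℝ (g ∘ M'.point)) p' (base X) (base X) + L (base Y)) p.2 := by
    have hγd : HasSecondDerivAt γ (base X) (base Y) p.2 :=
      (hasSecondDerivAt_comp_baseCurve j hh).clm base
    have hcomp := hγd.comp (Ψ := g ∘ M'.point) (by rwa [hγ])
    rw [hγ] at hcomp
    exact hcomp.congr hlift
  have hLX : (L (base X)).2.re ≠ 0 := by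
    rw [base_eq_smul_jetOf Y hX, map_smul, ← hprolong, Prod.smul_snd, Complex.real_smul,
      Complex.re_ofReal_mul]
    exact mul_ne_zero hX hX'
  rw [M'.prolong_eq _ hg hX', hprolong]
  exact (curveJet_eq_jetOf hcurve hLX).trans (jetOf_bilinear Y hX)

theorem analyticAt_point (M : AnalyticGraph) {p : ℂ × ℝ} (hp : p ∈ M.Ω) :
    AnalyticAt ℝ M.point p := by
  have hu : AnalyticAt ℝ (fun q : ℂ × ℝ => (q.2 : ℂ)) p :=
    (Complex.ofRealCLM.analyticAt _).fun_comp analyticAt_snd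
  have hF : AnalyticAt ℝ (fun q : ℂ × ℝ => (M.F q : ℂ)) p :=
    (Complex.ofRealCLM.analyticAt _).fun_comp (M.analytic p hp)
  exact analyticAt_fst.prod (hu.add (hF.mul analyticAt_const))

theorem prolong_congr {M : AnalyticGraph} {h h' : ℂ × ℂ → ℂ × ℂ} {p : ℂ × ℝ} (hp : p ∈ M.Ω)
    (heq : h =ᶠ[𝓝 (M.point p)] h') (j : ℂ × ℂ) : M.prolong h p j = M.prolong h' p j :=
  curveJet_congr <| ((M.analyticAt_point hp).continuousAt.tendsto.comp
    (tendsto_baseCurve p j)).eventually heq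

/-- The tangent vector to `M` above the base vector `v`. -/
noncomputable def tangentLift (M : AnalyticGraph) (p : ℂ × ℝ) (v : ℂ × ℝ) : ℂ × ℂ :=
  (v.1, (v.2 : ℂ) + (fderiv ℝ M.F p v : ℂ) * Complex.I)

theorem base_tangentLift (M : AnalyticGraph) (p v : ℂ × ℝ) :
    base (M.tangentLift p v) = v := by
  ext1 <;> simp [tangentLift]

theorem velocity_eq_tangentLift (M : AnalyticGraph) (p : ℂ × ℝ) (z₁ : ℂ) :
    M.velocity p z₁ = M.tangentLift p (z₁, 1) := by
  simp [velocity, tangentLift]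

theorem tangentLift_smul (M : AnalyticGraph) (p v : ℂ × ℝ) (a : ℝ) :
    M.tangentLift p (a • v) = a • M.tangentLift p v := by
  ext1
  · rfl
  · simp [tangentLift, mul_assoc]

theorem fderiv_point (M : AnalyticGraph) {p : ℂ × ℝ} (hp : p ∈ M.Ω) (v : ℂ × ℝ) :
    fderiv ℝ M.point p v = M.tangentLift p v := by
  have hF : HasFDerivAt M.F (fderiv ℝ M.F p) p := (M.analytic p hp).differentiableAt.hasFDerivAt
  have hu : HasFDerivAt (fun q : ℂ × ℝ => (q.2 : ℂ))
      (Complex.ofRealCLM.comp (ContinuousLinearMap.snd ℝ ℂ ℝ)) p :=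
    (Complex.ofRealCLM.comp (ContinuousLinearMap.snd ℝ ℂ ℝ)).hasFDerivAt
  have hFc : HasFDerivAt (fun q : ℂ × ℝ => (M.F q : ℂ))
      (Complex.ofRealCLM.comp (fderiv ℝ M.F p)) p := Complex.ofRealCLM.hasFDerivAt.comp p hF
  have hpoint : HasFDerivAt M.point _ p :=
    (hasFDerivAt_fst (𝕜 := ℝ) (p := p)).prodMk (hu.add (hFc.mul_const Complex.I))
  rw [hpoint.fderiv]
  ext1
  · rfl
  · simp [tangentLift, mul_comm]

theorem hasFDerivAt_rho (M : AnalyticGraph) {P : ℂ × ℂ} (hP : base P ∈ M.Ω) :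
    HasFDerivAt M.rho ((fderiv ℝ M.F (base P)).comp base -
      Complex.imCLM.comp (ContinuousLinearMap.snd ℝ ℂ ℂ)) P := by
  have hF : HasFDerivAt M.F (fderiv ℝ M.F (base P)) (base P) :=
    (M.analytic _ hP).differentiableAt.hasFDerivAt
  exact (hF.comp P base.hasFDerivAt).sub
    (Complex.imCLM.comp (ContinuousLinearMap.snd ℝ ℂ ℂ)).hasFDerivAt

theorem fderiv_rho_point (M : AnalyticGraph) {p : ℂ × ℝ} (hp : p ∈ M.Ω) (ξ : ℂ × ℂ) :
    fderiv ℝ M.rho (M.point p) ξ = fderiv ℝ M.F p (base ξ) - ξ.2.im := by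
  rw [(M.hasFDerivAt_rho (by rwa [base_point])).fderiv, base_point]
  rfl

theorem fderiv_rho_eq_zero_iff (M : AnalyticGraph) {p : ℂ × ℝ} (hp : p ∈ M.Ω) (ξ : ℂ × ℂ) :
    fderiv ℝ M.rho (M.point p) ξ = 0 ↔ M.tangentLift p (base ξ) = ξ := by
  rw [M.fderiv_rho_point hp, sub_eq_zero]
  constructor
  · intro h
    exact Prod.ext rfl (Complex.ext (by simp [tangentLift]) (by simpa [tangentLift] using h))
  · intro h
    simpa [tangentLift] using congrArg (fun x : ℂ × ℂ => x.2.im) h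

theorem fderiv_rho_tangentLift (M : AnalyticGraph) {p : ℂ × ℝ} (hp : p ∈ M.Ω) (v : ℂ × ℝ) :
    fderiv ℝ M.rho (M.point p) (M.tangentLift p v) = 0 := by
  rw [M.fderiv_rho_eq_zero_iff hp, base_tangentLift]

theorem CRTangent.smul {M : AnalyticGraph} {p : ℂ × ℝ} {ξ : ℂ × ℂ} (a : ℝ)
    (h : M.CRTangent p ξ) : M.CRTangent p (a • ξ) := by
  refine ⟨by rw [map_smul, h.1, smul_zero], ?_⟩
  rw [smul_comm, map_smul, h.2, smul_zero]

theorem crTransversal_iff (M : AnalyticGraph) {p : ℂ × ℝ} (hp : p ∈ M.Ω) (z₁ : ℂ) :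
    M.CRTransversal p z₁ ↔
      fderiv ℝ M.F p (Complex.I * z₁, -fderiv ℝ M.F p (z₁, 1)) ≠ 1 := by
  have htangent : fderiv ℝ M.rho (M.point p) (M.velocity p z₁) = 0 := by
    rw [velocity_eq_tangentLift, M.fderiv_rho_tangentLift hp]
  rw [CRTransversal, CRTangent, M.fderiv_rho_point hp (Complex.I • _)]
  simp only [htangent, true_and]
  simp [velocity, sub_eq_zero]

theorem isOpen_transversalJets (M : AnalyticGraph) : IsOpen M.transversalJets := by
  have hjets : M.transversalJets = {q : (ℂ × ℝ) × ℂ | q.1 ∈ M.Ω} ∩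
      (fun q : (ℂ × ℝ) × ℂ => fderiv ℝ M.F q.1 (Complex.I * q.2, -fderiv ℝ M.F q.1 (q.2, 1))) ⁻¹'
        {x | x ≠ 1} := by
    ext q
    exact and_congr_right fun hq => M.crTransversal_iff hq _
  have hD : ContinuousOn (fun q : (ℂ × ℝ) × ℂ => fderiv ℝ M.F q.1) {q | q.1 ∈ M.Ω} :=
    M.analytic.fderiv.continuousOn.comp continuousOn_fst fun q hq => hq
  rw [hjets]
  refine ContinuousOn.isOpen_inter_preimage ?_ (M.isOpen.preimage continuous_fst) isOpen_ne
  exact hD.clm_apply (ContinuousOn.prodMk (by fun_prop) (hD.clm_apply (by fun_prop)).neg)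

namespace IsLocalBiholomorphism

variable {e : OpenPartialHomeomorph (ℂ × ℂ) (ℂ × ℂ)} {M M' M'' : AnalyticGraph}
  {p p' p'' : ℂ × ℝ}

theorem symm (h : IsLocalBiholomorphism e M p M' p') :
    IsLocalBiholomorphism e.symm M' p' M p where
  holo := h.holo_symm
  holo_symm := by simpa using h.holo
  mem := h.mem'
  mem' := h.mem
  mem_source := by
    rw [← h.map_point]
    exact e.map_source h.mem_source
  map_point := by rw [← h.map_point, e.left_inv h.mem_source]
  image := h.image.symm

theorem trans {e' : OpenPartialHomeomorph (ℂ × ℂ) (ℂ × ℂ)}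
    (h : IsLocalBiholomorphism e M p M' p') (h' : IsLocalBiholomorphism e' M' p' M'' p'') :
    IsLocalBiholomorphism (e.trans e') M p M'' p'' where
  holo := by
    rw [e.coe_trans, e.trans_source]
    exact h'.holo.comp (h.holo.mono inter_subset_left) fun x hx => hx.2
  holo_symm := by
    rw [e.coe_trans_symm, e.trans_target]
    exact h.holo_symm.comp (h'.holo_symm.mono inter_subset_left) fun x hx => hx.2
  mem := h.mem
  mem' := h'.mem'
  mem_source := by
    rw [e.trans_source]
    exact ⟨h.mem_source, by rw [mem_preimage, h.map_point]; exact h'.mem_source⟩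
  map_point := by rw [e.coe_trans, Function.comp, h.map_point, h'.map_point]
  image := by
    intro x hx
    rw [e.trans_source] at hx
    exact (h'.image hx.2).trans (h.image hx.1)

theorem analyticAt (h : IsLocalBiholomorphism e M p M' p') : AnalyticAt ℂ e (M.point p) :=
  analyticAt_prod_of_differentiableOn e.open_source h.holo h.mem_source

theorem analyticAt_comp_point (h : IsLocalBiholomorphism e M p M' p') :
    AnalyticAt ℝ (e ∘ M.point) p :=
  h.analyticAt.restrictScalars.comp (M.analyticAt_point h.mem)

theorem eventually_mem (h : IsLocalBiholomorphism e M p M' p') :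
    ∀ᶠ q in 𝓝 p, e (M.point q) ∈ M'.carrier := by
  filter_upwards [(M.analyticAt_point h.mem).continuousAt.eventually
    (e.open_source.mem_nhds h.mem_source), M.isOpen.mem_nhds h.mem] with q hsource hΩ
  exact (h.image hsource).2 (M.point_mem_carrier hΩ)

theorem hasFDerivAt (h : IsLocalBiholomorphism e M p M' p') :
    HasFDerivAt e (fderiv ℝ e (M.point p)) (M.point p) :=
  (h.analyticAt.differentiableAt.restrictScalars ℝ).hasFDerivAt

theorem hasFDerivAt_comp_point (h : IsLocalBiholomorphism e M p M' p') :
    HasFDerivAt (e ∘ M.point) ((fderiv ℝ e (M.point p)).comp (fderiv ℝ M.point p)) p :=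
  h.hasFDerivAt.comp p (M.analyticAt_point h.mem).differentiableAt.hasFDerivAt

theorem fderiv_smul (h : IsLocalBiholomorphism e M p M' p') (c : ℂ) (ξ : ℂ × ℂ) :
    fderiv ℝ e (M.point p) (c • ξ) = c • fderiv ℝ e (M.point p) ξ := by
  rw [h.analyticAt.differentiableAt.fderiv_restrictScalars ℝ]
  simp

theorem firstOrder_eq (h : IsLocalBiholomorphism e M p M' p') (z₁ : ℂ) :
    firstOrder (e ∘ M.point) p z₁ = fderiv ℝ e (M.point p) (M.velocity p z₁) := by
  rw [firstOrder, h.hasFDerivAt_comp_point.fderiv, velocity_eq_tangentLift,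
    ← M.fderiv_point h.mem]
  rfl

theorem firstOrder_snd_re_ne_zero (h : IsLocalBiholomorphism e M p M' p') {z₁ : ℂ}
    (hz : M.ImageParamByU e p z₁) : (firstOrder (e ∘ M.point) p z₁).2.re ≠ 0 := by
  rw [h.firstOrder_eq]
  exact hz

theorem prolong_eq_jetOf (h : IsLocalBiholomorphism e M p M' p') (j : ℂ × ℂ)
    (hj : M.ImageParamByU e p j.1) :
    M.prolong e p j =
      jetOf (firstOrder (e ∘ M.point) p j.1) (secondOrder (e ∘ M.point) p j) :=
  M.prolong_eq j h.analyticAt_comp_point.contDiffAt (h.firstOrder_snd_re_ne_zero hj)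

theorem prolong_trans {e' : OpenPartialHomeomorph (ℂ × ℂ) (ℂ × ℂ)}
    (h : IsLocalBiholomorphism e M p M' p') (h' : IsLocalBiholomorphism e' M' p' M'' p'')
    (j : ℂ × ℂ) (hj : M.ImageParamByU e p j.1)
    (hj' : M'.ImageParamByU e' p' (M.prolong e p j).1) :
    M.prolong (e.trans e') p j = M'.prolong e' p' (M.prolong e p j) :=
  prolong_comp j h.analyticAt_comp_point.contDiffAt h'.analyticAt_comp_point.contDiffAt
    h.map_point h.eventually_mem (h.firstOrder_snd_re_ne_zero hj)
    (h'.firstOrder_snd_re_ne_zero hj')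

theorem fderiv_symm_fderiv (h : IsLocalBiholomorphism e M p M' p') (ξ : ℂ × ℂ) :
    fderiv ℝ e.symm (M'.point p') (fderiv ℝ e (M.point p) ξ) = ξ := by
  have hsymm := h.symm.hasFDerivAt
  rw [← h.map_point] at hsymm ⊢
  have hid : e.symm ∘ e =ᶠ[𝓝 (M.point p)] id := by
    filter_upwards [e.open_source.mem_nhds h.mem_source] with x hx
    exact e.left_inv hx
  exact DFunLike.congr_fun (((hsymm.comp (M.point p) h.hasFDerivAt).congr_of_eventuallyEq
    hid.symm).unique (hasFDerivAt_id _)) ξ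

theorem fderiv_rho_map (h : IsLocalBiholomorphism e M p M' p') {ξ : ℂ × ℂ}
    (hξ : fderiv ℝ M.rho (M.point p) ξ = 0) :
    fderiv ℝ M'.rho (M'.point p') (fderiv ℝ e (M.point p) ξ) = 0 := by
  rw [M.fderiv_rho_eq_zero_iff h.mem, ← M.fderiv_point h.mem] at hξ
  rw [M'.fderiv_rho_eq_zero_iff h.mem', ← M'.fderiv_point h.mem']
  have hbase : HasFDerivAt (base ∘ (e ∘ M.point)) _ p :=
    base.hasFDerivAt.comp p h.hasFDerivAt_comp_point
  have hpoint : HasFDerivAt M'.point (fderiv ℝ M'.point p') ((base ∘ (e ∘ M.point)) p) := by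
    simp only [Function.comp_apply, h.map_point, base_point]
    exact (M'.analyticAt_point h.mem').differentiableAt.hasFDerivAt
  have hlift : M'.point ∘ (base ∘ (e ∘ M.point)) =ᶠ[𝓝 p] e ∘ M.point := by
    filter_upwards [h.eventually_mem] with q hq
    exact point_base hq
  have hunique := DFunLike.congr_fun (((hpoint.comp p hbase).congr_of_eventuallyEq
    hlift.symm).unique h.hasFDerivAt_comp_point) (base ξ)
  simpa only [ContinuousLinearMap.comp_apply, hξ] using hunique

theorem crTangent_map (h : IsLocalBiholomorphism e M p M' p') {ξ : ℂ × ℂ}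
    (hξ : M.CRTangent p ξ) : M'.CRTangent p' (fderiv ℝ e (M.point p) ξ) := by
  refine ⟨h.fderiv_rho_map hξ.1, ?_⟩
  rw [← h.fderiv_smul]
  exact h.fderiv_rho_map hξ.2

theorem crTangent_of_map (h : IsLocalBiholomorphism e M p M' p') {ξ : ℂ × ℂ}
    (hξ : M'.CRTangent p' (fderiv ℝ e (M.point p) ξ)) : M.CRTangent p ξ :=
  h.fderiv_symm_fderiv ξ ▸ h.symm.crTangent_map hξ

theorem fderiv_rho_velocity (h : IsLocalBiholomorphism e M p M' p') (z₁ : ℂ) :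
    fderiv ℝ M'.rho (M'.point p') (fderiv ℝ e (M.point p) (M.velocity p z₁)) = 0 := by
  apply h.fderiv_rho_map
  rw [velocity_eq_tangentLift, M.fderiv_rho_tangentLift h.mem]

theorem crTransversal_map (h : IsLocalBiholomorphism e M p M' p') {j : ℂ × ℂ}
    (hj : M.CRTransversal p j.1) (hu : M.ImageParamByU e p j.1) :
    M'.CRTransversal p' (M.prolong e p j).1 := by
  set X := firstOrder (e ∘ M.point) p j.1 with hX
  have hlift : M'.tangentLift p' (base X) = X := by
    rw [← M'.fderiv_rho_eq_zero_iff h.mem', hX, h.firstOrder_eq]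
    exact h.fderiv_rho_velocity j.1
  intro htangent
  rw [h.prolong_eq_jetOf j hu, velocity_eq_tangentLift] at htangent
  refine hj (h.crTangent_of_map ?_)
  rw [← h.firstOrder_eq, ← hX, ← hlift,
    base_eq_smul_jetOf (secondOrder (e ∘ M.point) p j) (h.firstOrder_snd_re_ne_zero hu),
    tangentLift_smul]
  exact htangent.smul _

end IsLocalBiholomorphism

namespace IsNormalized

variable {N : AnalyticGraph}

theorem isBigO_norm_sq (hN : N.IsNormalized) : N.F =O[𝓝 0] fun q : ℂ × ℝ => ‖q - 0‖ ^ 2 := by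
  have hrem : (fun q : ℂ × ℝ => ‖q.1‖ ^ 6 + |q.2| ^ 3) =O[𝓝 0]
      fun q : ℂ × ℝ => ‖q - 0‖ ^ 2 := by
    simp only [sub_zero]
    have hnorm {m : ℕ} (hm : 2 ≤ m) :
        (fun q : ℂ × ℝ => ‖q‖ ^ m) =O[𝓝 0] fun q : ℂ × ℝ => ‖q‖ ^ 2 := by
      refine IsBigO.of_norm_eventuallyLE ?_
      filter_upwards [Metric.closedBall_mem_nhds (0 : ℂ × ℝ) one_pos] with q hq
      rw [Real.norm_of_nonneg (by positivity)]
      exact pow_le_pow_of_le_one (norm_nonneg q) (by simpa using hq) hm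
    exact ((isBigO_fst_prod'.norm_norm.pow 6).trans (hnorm (by norm_num))).add
      ((isBigO_snd_prod'.norm_norm.pow 3).trans (hnorm (by norm_num)))
  have hsq : (fun q : ℂ × ℝ => ‖q.1‖ ^ 2) =O[𝓝 0] fun q : ℂ × ℝ => ‖q - 0‖ ^ 2 := by
    simpa using isBigO_fst_prod'.norm_norm.pow 2
  simpa using (IsBigO.trans hN hrem).add hsq

theorem F_zero (hN : N.IsNormalized) : N.F 0 = 0 := by
  obtain ⟨c, hc⟩ := hN.isBigO_norm_sq.bound
  simpa using hc.self_of_nhds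

theorem point_zero (hN : N.IsNormalized) : N.point 0 = 0 := by
  ext1 <;> simp [point, hN.F_zero]

theorem fderiv_zero (hN : N.IsNormalized) : fderiv ℝ N.F 0 = 0 :=
  (hN.isBigO_norm_sq.hasFDerivAt (by norm_num)).fderiv

theorem snd_re_ne_zero (hN : N.IsNormalized) (h0 : (0 : ℂ × ℝ) ∈ N.Ω) {ξ : ℂ × ℂ}
    (hξ : fderiv ℝ N.rho (N.point 0) ξ = 0) (hξ' : ¬ N.CRTangent 0 ξ) : ξ.2.re ≠ 0 := by
  intro hre
  refine hξ' ⟨hξ, ?_⟩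
  rw [N.fderiv_rho_point h0, hN.fderiv_zero]
  simp [hre]

end IsNormalized

theorem IsLocalBiholomorphism.imageParamByU {e : OpenPartialHomeomorph (ℂ × ℂ) (ℂ × ℂ)}
    {M N : AnalyticGraph} {p : ℂ × ℝ} (h : IsLocalBiholomorphism e M p N 0) (hN : N.IsNormalized)
    {z₁ : ℂ} (hz : M.CRTransversal p z₁) : M.ImageParamByU e p z₁ :=
  hN.snd_re_ne_zero h.mem' (h.fderiv_rho_velocity z₁) (mt h.crTangent_of_map hz)

end AnalyticGraph

/-! ### Weighted orders of vanishing -/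

/-- The weighted size of `(z, u)`, with the weights `[z] = 1`, `[u] = 2`. -/
noncomputable def weightedNorm (q : ℂ × ℝ) : ℝ := ‖q.1‖ + √|q.2|

/-- `f = O(k)` at the origin, for the weights `[z] = 1`, `[u] = 2`. -/
def WeightedO {E : Type*} [Norm E] (k : ℕ) (f : ℂ × ℝ → E) : Prop :=
  f =O[𝓝 0] fun q => weightedNorm q ^ k

theorem weightedNorm_nonneg (q : ℂ × ℝ) : 0 ≤ weightedNorm q := by
  unfold weightedNorm
  positivity

theorem tendsto_weightedNorm : Tendsto weightedNorm (𝓝 0) (𝓝 0) := by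
  have hcont : Continuous weightedNorm := by unfold weightedNorm; fun_prop
  simpa [weightedNorm] using hcont.tendsto 0

theorem norm_fst_le_weightedNorm (q : ℂ × ℝ) : ‖q.1‖ ≤ weightedNorm q :=
  le_add_of_nonneg_right (Real.sqrt_nonneg _)

theorem abs_snd_le_weightedNorm_sq (q : ℂ × ℝ) : |q.2| ≤ weightedNorm q ^ 2 := by
  have hsqrt : √|q.2| ≤ weightedNorm q := le_add_of_nonneg_left (norm_nonneg _)
  calc |q.2| = √|q.2| ^ 2 := (Real.sq_sqrt (abs_nonneg _)).symm
    _ ≤ weightedNorm q ^ 2 := by gcongr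

theorem eventually_weightedNorm_le_one : ∀ᶠ q in 𝓝 (0 : ℂ × ℝ), weightedNorm q ≤ 1 :=
  tendsto_weightedNorm.eventually (Iic_mem_nhds one_pos)

theorem eventually_norm_le_weightedNorm : ∀ᶠ q in 𝓝 (0 : ℂ × ℝ), ‖q‖ ≤ weightedNorm q := by
  filter_upwards [eventually_weightedNorm_le_one] with q hq
  exact max_le (norm_fst_le_weightedNorm q) ((abs_snd_le_weightedNorm_sq q).trans
    (pow_le_of_le_one (weightedNorm_nonneg q) hq two_ne_zero))

namespace WeightedO

section Module

variable {E : Type*} [SeminormedAddCommGroup E] {k l : ℕ} {f g : ℂ × ℝ → E}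

theorem mono (h : k ≤ l) (hf : WeightedO l f) : WeightedO k f := by
  refine IsBigO.trans hf (IsBigO.of_norm_eventuallyLE ?_)
  filter_upwards [eventually_weightedNorm_le_one] with q hq
  rw [Real.norm_of_nonneg (pow_nonneg (weightedNorm_nonneg q) l)]
  exact pow_le_pow_of_le_one (weightedNorm_nonneg q) hq h

theorem add (hf : WeightedO k f) (hg : WeightedO k g) : WeightedO k fun q => f q + g q :=
  IsBigO.add hf hg

theorem sub (hf : WeightedO k f) (hg : WeightedO k g) : WeightedO k fun q => f q - g q :=
  IsBigO.sub hf hg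

theorem zero : WeightedO k fun _ => (0 : E) := isBigO_zero _ _

theorem sum {ι : Type*} {s : Finset ι} {f : ι → ℂ × ℝ → E} (h : ∀ i ∈ s, WeightedO k (f i)) :
    WeightedO k fun q => ∑ i ∈ s, f i q := IsBigO.fun_sum h

theorem of_norm_le {F : Type*} [SeminormedAddCommGroup F] {g : ℂ × ℝ → F} (hf : WeightedO k f)
    (h : ∀ q, ‖g q‖ ≤ ‖f q‖) : WeightedO k g := (isBigO_of_le _ h).trans hf

theorem congr (hf : WeightedO k f) (h : ∀ q, f q = g q) : WeightedO k g :=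
  funext h ▸ hf

theorem of_isBigO_norm_pow (h : f =O[𝓝 0] fun q => ‖q‖ ^ k) : WeightedO k f := by
  refine h.trans (IsBigO.of_norm_eventuallyLE ?_)
  filter_upwards [eventually_norm_le_weightedNorm] with q hq
  rw [norm_pow, norm_norm]
  gcongr

end Module

section Ring

variable {E : Type*} [NormedRing E] {k l : ℕ} {f g f' g' : ℂ × ℝ → E}

theorem mul (hf : WeightedO k f) (hg : WeightedO l g) : WeightedO (k + l) fun q => f q * g q := by
  simpa only [WeightedO, pow_add] using IsBigO.mul hf hg

theorem const_mul (c : E) (hf : WeightedO k f) : WeightedO k fun q => c * f q :=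
  IsBigO.const_mul_left hf c

theorem pow (hf : WeightedO k f) (n : ℕ) :
    WeightedO (k * n) fun q => f q ^ n := by
  simpa only [WeightedO, pow_mul] using IsBigO.pow hf n

theorem mul_sub_mul (hf : WeightedO k f) (hf' : WeightedO (k + 1) fun q => f' q - f q)
    (hg : WeightedO l g) (hg' : WeightedO (l + 1) fun q => g' q - g q) :
    WeightedO (k + l + 1) fun q => f' q * g' q - f q * g q := by
  have hdiff : WeightedO (k + l + 1) fun q => (f' q - f q) * (g' q - g q) :=
    (hf'.mul hg').mono (by omega)
  have hleft : WeightedO (k + l + 1) fun q => f q * (g' q - g q) := (hf.mul hg').mono (by omega)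
  have hright : WeightedO (k + l + 1) fun q => (f' q - f q) * g q := (hf'.mul hg).mono (by omega)
  exact ((hdiff.add hleft).add hright).congr fun q => by noncomm_ring

theorem pow_sub_pow (hf : WeightedO k f)
    (hf' : WeightedO (k + 1) fun q => f' q - f q) (n : ℕ) :
    WeightedO (k * n + 1) fun q => f' q ^ n - f q ^ n := by
  induction n with
  | zero => simpa using WeightedO.zero (E := E) (k := 1)
  | succ n ih => simpa only [pow_succ, Nat.mul_succ] using mul_sub_mul (hf.pow n) ih hf hf'

end Ring

section Complex

variable {k : ℕ} {f : ℂ × ℝ → ℂ}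

theorem re (hf : WeightedO k f) : WeightedO k fun q => (f q).re :=
  hf.of_norm_le fun q => Complex.abs_re_le_norm (f q)

theorem im (hf : WeightedO k f) : WeightedO k fun q => (f q).im :=
  hf.of_norm_le fun q => Complex.abs_im_le_norm (f q)

theorem conj (hf : WeightedO k f) : WeightedO k fun q => (starRingEnd ℂ) (f q) :=
  hf.of_norm_le fun q => (RCLike.norm_conj (f q)).le

theorem ofReal {f : ℂ × ℝ → ℝ} (hf : WeightedO k f) : WeightedO k fun q => (f q : ℂ) :=
  hf.of_norm_le fun q => (Complex.norm_real (f q)).le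

end Complex

end WeightedO

theorem weightedO_fst : WeightedO 1 fun q : ℂ × ℝ => q.1 :=
  IsBigO.of_norm_le fun q => by simpa using norm_fst_le_weightedNorm q

theorem weightedO_snd : WeightedO 2 fun q : ℂ × ℝ => q.2 :=
  IsBigO.of_norm_le abs_snd_le_weightedNorm_sq

theorem weightedNorm_dilation (q : ℂ × ℝ) {t : ℝ} (ht : 0 ≤ t) :
    weightedNorm ((t : ℂ) * q.1, t ^ 2 * q.2) = t * weightedNorm q := by
  simp only [weightedNorm, norm_mul, Complex.norm_real, Real.norm_eq_abs, abs_mul,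
    abs_of_nonneg ht, abs_pow]
  rw [Real.sqrt_mul (by positivity), Real.sqrt_sq ht]
  ring

theorem WeightedO.comp_dilation {E : Type*} [SeminormedAddCommGroup E] {k : ℕ} {f : ℂ × ℝ → E}
    (hf : WeightedO k f) (q : ℂ × ℝ) :
    (fun t : ℝ => f ((t : ℂ) * q.1, t ^ 2 * q.2)) =O[𝓝[>] 0] fun t : ℝ => t ^ k := by
  have hcont : Continuous fun t : ℝ => (((t : ℂ) * q.1, t ^ 2 * q.2) : ℂ × ℝ) := by fun_prop
  have htendsto : Tendsto (fun t : ℝ => (((t : ℂ) * q.1, t ^ 2 * q.2) : ℂ × ℝ)) (𝓝[>] 0) (𝓝 0) :=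
    (hcont.tendsto' 0 0 (by simp)).mono_left nhdsWithin_le_nhds
  refine (IsBigO.comp_tendsto hf htendsto).trans (IsBigO.of_bound (weightedNorm q ^ k) ?_)
  filter_upwards [self_mem_nhdsWithin] with t ht
  rw [Function.comp_apply, weightedNorm_dilation q (le_of_lt ht), mul_pow, norm_mul, mul_comm,
    Real.norm_of_nonneg (pow_nonneg (weightedNorm_nonneg q) k)]

section PolynomialCoefficients

variable {n k : ℕ} {c : ℕ → ℝ}

theorem coeff_zero_eq_zero_of_isBigO
    (h : (fun t : ℝ => ∑ m ∈ Finset.range (n + 1), c m * t ^ m) =O[𝓝[>] 0]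
      fun t : ℝ => t ^ (k + 1)) : c 0 = 0 := by
  have hpow : Tendsto (fun t : ℝ => t ^ (k + 1)) (𝓝[>] 0) (𝓝 0) :=
    ((continuous_pow (k + 1)).tendsto' 0 0 (by simp)).mono_left nhdsWithin_le_nhds
  have hpoly : Continuous fun t : ℝ => ∑ m ∈ Finset.range (n + 1), c m * t ^ m := by fun_prop
  have hlim : Tendsto (fun t : ℝ => ∑ m ∈ Finset.range (n + 1), c m * t ^ m) (𝓝[>] 0) (𝓝 (c 0)) :=
    (hpoly.tendsto' 0 (c 0) (by simp [Finset.sum_range_succ'])).mono_left nhdsWithin_le_nhds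
  exact tendsto_nhds_unique hlim (h.trans_tendsto hpow)

theorem coeff_eq_zero_of_isBigO
    (h : (fun t : ℝ => ∑ m ∈ Finset.range n, c m * t ^ m) =O[𝓝[>] 0] fun t : ℝ => t ^ k) :
    ∀ m < k, m < n → c m = 0 := by
  induction k generalizing n c with
  | zero => exact fun m hm => absurd hm m.not_lt_zero
  | succ k ih =>
    rcases n with _ | n
    · exact fun m _ hm => absurd hm m.not_lt_zero
    have h0 : c 0 = 0 := coeff_zero_eq_zero_of_isBigO h
    have hdiv : (fun t : ℝ => ∑ m ∈ Finset.range n, c (m + 1) * t ^ m) =O[𝓝[>] 0]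
        fun t : ℝ => t ^ k := by
      refine ((isBigO_refl (fun t : ℝ => t⁻¹) (𝓝[>] 0)).mul h).congr' ?_ ?_
      · filter_upwards [self_mem_nhdsWithin] with t ht
        rw [Finset.sum_range_succ', h0, zero_mul, add_zero, Finset.mul_sum]
        refine Finset.sum_congr rfl fun m _ => ?_
        rw [pow_succ', mul_left_comm, inv_mul_cancel_left₀ (ne_of_gt ht)]
      · filter_upwards [self_mem_nhdsWithin] with t ht
        rw [pow_succ', inv_mul_cancel_left₀ (ne_of_gt ht)]
    rintro (_ | m) hm hmn
    · exact h0
    · exact ih hdiv m (by omega) (by omega)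

end PolynomialCoefficients

/-! ### Weighted Taylor expansions -/

/-- The number of occurrences of the index `j` in the word `r`. -/
def occurrences {n d : ℕ} (r : Fin n → Fin d) (j : Fin d) : ℕ :=
  (Finset.univ.filter fun i => r i = j).card

theorem occurrences_lt {m n d : ℕ} (hmn : m < n) (r : Fin m → Fin d) (j : Fin d) :
    occurrences r j < n :=
  (Finset.card_le_univ _).trans_lt (by rwa [Fintype.card_fin])

theorem prod_comp_eq_prod_pow_occurrences {R : Type*} [CommMonoid R] {n d : ℕ}
    (r : Fin n → Fin d) (y : Fin d → R) : ∏ i, y (r i) = ∏ j, y j ^ occurrences r j := by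
  rw [← Finset.prod_fiberwise Finset.univ r]
  exact Finset.prod_congr rfl fun j _ =>
    Finset.prod_eq_pow_card fun i hi => by rw [(Finset.mem_filter.1 hi).2]

/-- The exponents `(a, b, c)` of the monomials `x ^ a * y ^ b * u ^ c`. -/
abbrev Exponent := ℕ × ℕ × ℕ

namespace Exponent

/-- The weight of an exponent, for the weights `[x] = [y] = 1`, `[u] = 2`. -/
def weight (i : Exponent) : ℕ := i.1 + i.2.1 + 2 * i.2.2

/-- The exponents with all entries less than `n`; those of weight less than `n` are among them. -/
def box (n : ℕ) : Finset Exponent := Finset.range n ×ˢ Finset.range n ×ˢ Finset.range n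

theorem filter_weight_box {k n : ℕ} (hk : k < n) :
    (box n).filter (fun i => i.weight = k) = (box (k + 1)).filter fun i => i.weight = k := by
  ext ⟨a, b, c⟩
  rw [Finset.mem_filter, Finset.mem_filter]
  simp only [box, Finset.mem_product, Finset.mem_range, weight]
  omega

/-- The exponent of `∏ i, y (r i)` as a monomial in `y 0`, `y 1`, `y 2`. -/
def ofIndices {n : ℕ} (r : Fin n → Fin 3) : Exponent :=
  (occurrences r 0, occurrences r 1, occurrences r 2)

theorem ofIndices_mem_box {m n : ℕ} (hmn : m < n) (r : Fin m → Fin 3) :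
    ofIndices r ∈ box n := by
  simp only [box, ofIndices, Finset.mem_product, Finset.mem_range]
  exact ⟨occurrences_lt hmn r 0, occurrences_lt hmn r 1, occurrences_lt hmn r 2⟩

theorem prod_comp_eq_pow_ofIndices {R : Type*} [CommMonoid R] {n : ℕ} (r : Fin n → Fin 3)
    (y : Fin 3 → R) : ∏ i, y (r i) =
      y 0 ^ (ofIndices r).1 * y 1 ^ (ofIndices r).2.1 * y 2 ^ (ofIndices r).2.2 := by
  rw [prod_comp_eq_prod_pow_occurrences, Fin.prod_univ_three]
  rfl

end Exponent

/-- The monomial `x ^ a * y ^ b * u ^ c`. -/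
def realMonomial (i : Exponent) (q : ℂ × ℝ) : ℝ := q.1.re ^ i.1 * q.1.im ^ i.2.1 * q.2 ^ i.2.2

/-- The weighted homogeneous polynomial of weight `k` in `(x, y, u)` with coefficients `C`. -/
noncomputable def realPoly (k : ℕ) (C : Exponent → ℝ) (q : ℂ × ℝ) : ℝ :=
  ∑ i ∈ (Exponent.box (k + 1)).filter fun i => i.weight = k, C i * realMonomial i q

theorem weightedO_realMonomial (i : Exponent) : WeightedO i.weight (realMonomial i) := by
  have hprod := ((weightedO_fst.re.pow i.1).mul (weightedO_fst.im.pow i.2.1)).mul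
    (weightedO_snd.pow i.2.2)
  simp only [one_mul] at hprod
  exact hprod

theorem weightedO_realPoly (k : ℕ) (C : Exponent → ℝ) : WeightedO k (realPoly k C) := by
  refine WeightedO.sum fun i hi => ?_
  have hmonomial := weightedO_realMonomial i
  rw [(Finset.mem_filter.1 hi).2] at hmonomial
  exact hmonomial.const_mul (C i)

theorem realPoly_dilation (k : ℕ) (C : Exponent → ℝ) (q : ℂ × ℝ) (t : ℝ) :
    realPoly k C ((t : ℂ) * q.1, t ^ 2 * q.2) = realPoly k C q * t ^ k := by
  unfold realPoly
  rw [Finset.sum_mul]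
  refine Finset.sum_congr rfl fun i hi => ?_
  rw [← (Finset.mem_filter.1 hi).2]
  simp only [realMonomial, Exponent.weight, Complex.re_ofReal_mul, Complex.im_ofReal_mul]
  ring

theorem weightedO_sum_box_sub_sum_realPoly (n : ℕ) (C : Exponent → ℝ) :
    WeightedO n fun q => ∑ i ∈ Exponent.box n, C i * realMonomial i q -
      ∑ k ∈ Finset.range n, realPoly k C q := by
  have hhigh : WeightedO n fun q =>
      ∑ i ∈ (Exponent.box n).filter fun i => ¬ i.weight < n, C i * realMonomial i q :=
    WeightedO.sum fun i hi =>
      ((weightedO_realMonomial i).const_mul (C i)).mono (not_lt.1 (Finset.mem_filter.1 hi).2)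
  have hlow (q : ℂ × ℝ) : ∑ i ∈ (Exponent.box n).filter fun i => i.weight < n,
      C i * realMonomial i q = ∑ k ∈ Finset.range n, realPoly k C q := by
    rw [← Finset.sum_fiberwise_of_maps_to (t := Finset.range n) (g := Exponent.weight)
      fun i hi => Finset.mem_range.2 (Finset.mem_filter.1 hi).2]
    refine Finset.sum_congr rfl fun k hk => Finset.sum_congr ?_ fun _ _ => rfl
    rw [← Exponent.filter_weight_box (Finset.mem_range.1 hk), Finset.filter_filter]
    refine Finset.filter_congr fun i _ => and_iff_right_of_imp ?_
    rintro rfl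
    exact Finset.mem_range.1 hk
  refine hhigh.congr fun q => ?_
  rw [← Finset.sum_filter_add_sum_filter_not (Exponent.box n) (fun i => i.weight < n), hlow,
    add_sub_cancel_left]

section TaylorCoefficients

variable {P : Type*} [NormedAddCommGroup P] [NormedSpace ℝ P]

/-- The basis of `ℂ × ℝ`, placed in the second factor of `P × (ℂ × ℝ)`, dual to the coordinates
`x`, `y`, `u`. -/
def coordVector (P : Type*) [Zero P] : Fin 3 → P × (ℂ × ℝ) :=
  ![(0, (1, 0)), (0, (Complex.I, 0)), (0, (0, 1))]

theorem sum_smul_coordVector (q : ℂ × ℝ) :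
    ∑ j, ![q.1.re, q.1.im, q.2] j • coordVector P j = (0, q) := by
  refine Prod.ext (by simp [coordVector, Fin.sum_univ_three]) (Prod.ext (Complex.ext ?_ ?_) ?_) <;>
    simp [coordVector, Fin.sum_univ_three]

/-- The coefficient of the monomial with exponent `i` in the restriction to `0 × (ℂ × ℝ)` of the
partial sum `s.partialSum n`. -/
noncomputable def taylorCoeff (s : FormalMultilinearSeries ℝ (P × (ℂ × ℝ)) ℝ) (n : ℕ)
    (i : Exponent) : ℝ :=
  ∑ m ∈ Finset.range n, ∑ r : Fin m → Fin 3,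
    if Exponent.ofIndices r = i then s m fun l => coordVector P (r l) else 0

theorem partialSum_eq_sum_taylorCoeff (s : FormalMultilinearSeries ℝ (P × (ℂ × ℝ)) ℝ) (n : ℕ)
    (q : ℂ × ℝ) : s.partialSum n (0, q) =
      ∑ i ∈ Exponent.box n, taylorCoeff s n i * realMonomial i q := by
  simp only [taylorCoeff, Finset.sum_mul]
  rw [Finset.sum_comm]
  refine Finset.sum_congr rfl fun m hm => ?_
  rw [Finset.sum_comm, ← sum_smul_coordVector q,
    (s m).map_sum fun _ j => ![q.1.re, q.1.im, q.2] j • coordVector P j]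
  refine Finset.sum_congr rfl fun r _ => ?_
  simp only [ite_mul, zero_mul]
  rw [(s m).map_smul_univ, Exponent.prod_comp_eq_pow_ofIndices, Finset.sum_ite_eq,
    if_pos (Exponent.ofIndices_mem_box (Finset.mem_range.1 hm) r), smul_eq_mul, mul_comm]
  rfl

theorem analyticAt_taylorCoeff_changeOrigin {s : FormalMultilinearSeries ℝ (P × (ℂ × ℝ)) ℝ}
    (hs : 0 < s.radius) (p₀ : P) (n : ℕ) (i : Exponent) :
    AnalyticAt ℝ (fun p => taylorCoeff (s.changeOrigin (p - p₀, 0)) n i) p₀ := by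
  refine Finset.analyticAt_fun_sum _ fun m _ => Finset.analyticAt_fun_sum _ fun r _ => ?_
  split_ifs
  · have horigin : AnalyticAt ℝ (fun p : P => s.changeOrigin (p - p₀, 0) m) p₀ := by
      refine AnalyticAt.fun_comp (g := fun x => s.changeOrigin x m) ?_
        (by fun_prop : AnalyticAt ℝ (fun p : P => ((p - p₀, 0) : P × (ℂ × ℝ))) p₀)
      rw [sub_self]
      exact s.analyticAt_changeOrigin hs m
    exact ((ContinuousMultilinearMap.apply ℝ (fun _ : Fin m => P × (ℂ × ℝ)) ℝ
      fun l => coordVector P (r l)).analyticAt _).fun_comp horigin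
  · exact analyticAt_const

theorem weightedO_sub_partialSum {f : P × (ℂ × ℝ) → ℝ} {p : P}
    {s : FormalMultilinearSeries ℝ (P × (ℂ × ℝ)) ℝ} (hs : HasFPowerSeriesAt f s (p, 0)) (n : ℕ) :
    WeightedO n fun q => f (p, q) - s.partialSum n (0, q) := by
  have hincl : Tendsto (fun q : ℂ × ℝ => ((0, q) : P × (ℂ × ℝ))) (𝓝 0) (𝓝 0) :=
    (by fun_prop : Continuous fun q : ℂ × ℝ => ((0, q) : P × (ℂ × ℝ))).tendsto 0
  refine WeightedO.of_isBigO_norm_pow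
    (((hs.isBigO_sub_partialSum_pow n).comp_tendsto hincl).congr ?_ ?_) <;> simp

/-- The coefficients of the weighted Taylor expansion at `(p, 0)` are analytic in `p`, since the
power series of `E` at `(p, 0)` is a change of origin of the one at `(p₀, 0)`. -/
theorem exists_weighted_taylor {E : P × (ℂ × ℝ) → ℝ} {p₀ : P} (hE : AnalyticAt ℝ E (p₀, 0))
    (n : ℕ) : ∃ C : Exponent → P → ℝ, (∀ i, AnalyticAt ℝ (C i) p₀) ∧ ∀ᶠ p in 𝓝 p₀,
      WeightedO n fun q => E (p, q) - ∑ k ∈ Finset.range n, realPoly k (fun i => C i p) q := by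
  obtain ⟨s, R, hs⟩ := hE
  refine ⟨fun i p => taylorCoeff (s.changeOrigin (p - p₀, 0)) n i,
    analyticAt_taylorCoeff_changeOrigin hs.radius_pos p₀ n, ?_⟩
  have hnear : ∀ᶠ p in 𝓝 p₀, (‖((p - p₀, 0) : P × (ℂ × ℝ))‖₊ : ENNReal) < R :=
    (Continuous.tendsto (by fun_prop) p₀).eventually (gt_mem_nhds (by simpa using hs.r_pos))
  filter_upwards [hnear] with p hp
  have hseries : HasFPowerSeriesAt E (s.changeOrigin (p - p₀, 0)) (p, 0) := by
    simpa using (hs.changeOrigin hp).hasFPowerSeriesAt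
  refine ((weightedO_sub_partialSum hseries n).add
    (weightedO_sum_box_sub_sum_realPoly n
      (taylorCoeff (s.changeOrigin (p - p₀, 0)) n))).congr fun q => ?_
  rw [partialSum_eq_sum_taylorCoeff, sub_add_sub_cancel]

end TaylorCoefficients

theorem WeightedO.sub_realPoly {f : ℂ × ℝ → ℝ} {C : Exponent → ℝ} {k n : ℕ} (hk : k < n)
    (hf : WeightedO n fun q => f q - ∑ m ∈ Finset.range n, realPoly m C q) (hfk : WeightedO k f) :
    WeightedO (k + 1) fun q => f q - realPoly k C q := by
  have hlow : ∀ m < k, ∀ q, realPoly m C q = 0 := by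
    intro m hm q
    have hsum : WeightedO k fun q => ∑ m ∈ Finset.range n, realPoly m C q :=
      (hfk.sub (hf.mono hk.le)).congr fun q => sub_sub_cancel _ _
    have hpoly := hsum.comp_dilation q
    simp only [realPoly_dilation] at hpoly
    exact coeff_eq_zero_of_isBigO hpoly m hm (hm.trans hk)
  have hhigh : WeightedO (k + 1)
      fun q => ∑ m ∈ (Finset.range n).filter (fun m => k < m), realPoly m C q :=
    WeightedO.sum fun m hm => (weightedO_realPoly m C).mono (Finset.mem_filter.1 hm).2
  refine ((hf.mono hk).add hhigh).congr fun q => ?_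
  have hsplit : ∑ m ∈ (Finset.range n).filter (fun m => ¬ k < m), realPoly m C q =
      realPoly k C q :=
    Finset.sum_eq_single_of_mem k (by simp [hk]) fun m hm hmk =>
      hlow m (lt_of_le_of_ne (not_lt.1 (Finset.mem_filter.1 hm).2) hmk) q
  rw [← Finset.sum_filter_add_sum_filter_not (Finset.range n) (fun m => k < m), hsplit]
  ring

section AnalyticComponents

open scoped ComplexConjugate

variable {P : Type*} [NormedAddCommGroup P] [NormedSpace ℝ P] {f : P → ℂ} {p : P}

theorem analyticAt_re_comp (hf : AnalyticAt ℝ f p) : AnalyticAt ℝ (fun q => (f q).re) p :=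
  (Complex.reCLM.analyticAt _).fun_comp hf

theorem analyticAt_im_comp (hf : AnalyticAt ℝ f p) : AnalyticAt ℝ (fun q => (f q).im) p :=
  (Complex.imCLM.analyticAt _).fun_comp hf

theorem analyticAt_conj_comp (hf : AnalyticAt ℝ f p) : AnalyticAt ℝ (fun q => conj (f q)) p :=
  (Complex.conjCLE.toContinuousLinearMap.analyticAt _).fun_comp hf

end AnalyticComponents

/-! ### The homological equation in weights three, four and five -/

section Homological

open scoped ComplexConjugate

theorem realPoly_three (C : Exponent → ℝ) (q : ℂ × ℝ) : realPoly 3 C q =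
    C (3, 0, 0) * q.1.re ^ 3 + C (2, 1, 0) * q.1.re ^ 2 * q.1.im
      + C (1, 2, 0) * q.1.re * q.1.im ^ 2 + C (0, 3, 0) * q.1.im ^ 3
      + C (1, 0, 1) * q.1.re * q.2 + C (0, 1, 1) * q.1.im * q.2 := by
  have hfilter : (Exponent.box 4).filter (fun i => i.weight = 3) =
      {(3, 0, 0), (2, 1, 0), (1, 2, 0), (0, 3, 0), (1, 0, 1), (0, 1, 1)} := by decide
  rw [realPoly, hfilter]
  simp [realMonomial, mul_assoc, add_assoc]

theorem realPoly_four (C : Exponent → ℝ) (q : ℂ × ℝ) : realPoly 4 C q =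
    C (4, 0, 0) * q.1.re ^ 4 + C (3, 1, 0) * q.1.re ^ 3 * q.1.im
      + C (2, 2, 0) * q.1.re ^ 2 * q.1.im ^ 2 + C (1, 3, 0) * q.1.re * q.1.im ^ 3
      + C (0, 4, 0) * q.1.im ^ 4 + C (2, 0, 1) * q.1.re ^ 2 * q.2
      + C (1, 1, 1) * q.1.re * q.1.im * q.2 + C (0, 2, 1) * q.1.im ^ 2 * q.2
      + C (0, 0, 2) * q.2 ^ 2 := by
  have hfilter : (Exponent.box 5).filter (fun i => i.weight = 4) =
      {(4, 0, 0), (3, 1, 0), (2, 2, 0), (1, 3, 0), (0, 4, 0), (2, 0, 1), (1, 1, 1), (0, 2, 1),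
        (0, 0, 2)} := by decide
  rw [realPoly, hfilter]
  simp [realMonomial, mul_assoc, add_assoc]

theorem realPoly_five (C : Exponent → ℝ) (q : ℂ × ℝ) : realPoly 5 C q =
    C (5, 0, 0) * q.1.re ^ 5 + C (4, 1, 0) * q.1.re ^ 4 * q.1.im
      + C (3, 2, 0) * q.1.re ^ 3 * q.1.im ^ 2 + C (2, 3, 0) * q.1.re ^ 2 * q.1.im ^ 3
      + C (1, 4, 0) * q.1.re * q.1.im ^ 4 + C (0, 5, 0) * q.1.im ^ 5
      + C (3, 0, 1) * q.1.re ^ 3 * q.2 + C (2, 1, 1) * q.1.re ^ 2 * q.1.im * q.2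
      + C (1, 2, 1) * q.1.re * q.1.im ^ 2 * q.2 + C (0, 3, 1) * q.1.im ^ 3 * q.2
      + C (1, 0, 2) * q.1.re * q.2 ^ 2 + C (0, 1, 2) * q.1.im * q.2 ^ 2 := by
  have hfilter : (Exponent.box 6).filter (fun i => i.weight = 5) =
      {(5, 0, 0), (4, 1, 0), (3, 2, 0), (2, 3, 0), (1, 4, 0), (0, 5, 0), (3, 0, 1), (2, 1, 1),
        (1, 2, 1), (0, 3, 1), (1, 0, 2), (0, 1, 2)} := by decide
  rw [realPoly, hfilter]
  simp [realMonomial, mul_assoc, add_assoc]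

/-- The weighted homogeneous polynomial of weight `m` in `(z, w)` with coefficients `a`. -/
noncomputable def complexPoly (m : ℕ) (a : ℕ × ℕ → ℂ) (P : ℂ × ℂ) : ℂ :=
  ∑ i ∈ (Finset.range (m + 1) ×ˢ Finset.range (m + 1)).filter fun i => i.1 + 2 * i.2 = m,
    a i * (P.1 ^ i.1 * P.2 ^ i.2)

theorem complexPoly_two (a : ℕ × ℕ → ℂ) (P : ℂ × ℂ) :
    complexPoly 2 a P = a (2, 0) * P.1 ^ 2 + a (0, 1) * P.2 := by
  have hfilter : (Finset.range 3 ×ˢ Finset.range 3).filter (fun i => i.1 + 2 * i.2 = 2) =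
      {(2, 0), (0, 1)} := by decide
  rw [complexPoly, hfilter]
  simp

theorem complexPoly_three (a : ℕ × ℕ → ℂ) (P : ℂ × ℂ) :
    complexPoly 3 a P = a (3, 0) * P.1 ^ 3 + a (1, 1) * (P.1 * P.2) := by
  have hfilter : (Finset.range 4 ×ˢ Finset.range 4).filter (fun i => i.1 + 2 * i.2 = 3) =
      {(3, 0), (1, 1)} := by decide
  rw [complexPoly, hfilter]
  simp

theorem complexPoly_four (a : ℕ × ℕ → ℂ) (P : ℂ × ℂ) :
    complexPoly 4 a P =
      a (4, 0) * P.1 ^ 4 + (a (2, 1) * (P.1 ^ 2 * P.2) + a (0, 2) * P.2 ^ 2) := by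
  have hfilter : (Finset.range 5 ×ˢ Finset.range 5).filter (fun i => i.1 + 2 * i.2 = 4) =
      {(4, 0), (2, 1), (0, 2)} := by decide
  rw [complexPoly, hfilter]
  simp

theorem complexPoly_five (a : ℕ × ℕ → ℂ) (P : ℂ × ℂ) :
    complexPoly 5 a P =
      a (5, 0) * P.1 ^ 5 + (a (3, 1) * (P.1 ^ 3 * P.2) + a (1, 2) * (P.1 * P.2 ^ 2)) := by
  have hfilter : (Finset.range 6 ×ˢ Finset.range 6).filter (fun i => i.1 + 2 * i.2 = 5) =
      {(5, 0), (3, 1), (1, 2)} := by decide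
  rw [complexPoly, hfilter]
  simp

/-- The point of the hyperquadric `v = z z̄` above `(z, u)`. -/
noncomputable def quadricPoint (q : ℂ × ℝ) : ℂ × ℂ := (q.1, q.2 + q.1 * conj q.1 * Complex.I)

/-- The homological equation in weight `k`: the coefficients `a`, `b` of the transformation
`(z + f, w + g)` removing the terms `realPoly k C` from `v = z z̄ + realPoly k C + O(k + 1)`. -/
def SolvesHomological (k : ℕ) (C : Exponent → ℝ) (a b : ℕ × ℕ → ℂ) : Prop :=
  ∀ q : ℂ × ℝ, realPoly k C q + (complexPoly k b (quadricPoint q)).im -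
    2 * (conj q.1 * complexPoly (k - 1) a (quadricPoint q)).re = 0

theorem solvesHomological_three {C : Exponent → ℝ} {A B D : ℂ}
    (hC : ∀ q : ℂ × ℝ, realPoly 3 C q =
      2 * (A * q.1 ^ 3 + B * (q.1 ^ 2 * conj q.1) + D * (q.1 * q.2)).re) :
    SolvesHomological 3 C (fun i => if i = (2, 0) then B - Complex.I * D else 0)
      fun i => if i = (3, 0) then -2 * Complex.I * A else -2 * Complex.I * D := by
  intro q
  rw [hC, complexPoly_three, complexPoly_two]
  simp only [quadricPoint, pow_succ, pow_zero, ↓reduceIte, Prod.mk.injEq, one_ne_zero,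
    OfNat.one_ne_ofNat, OfNat.zero_ne_ofNat, and_self, Complex.add_re, Complex.add_im,
    Complex.sub_re, Complex.sub_im, Complex.neg_re, Complex.neg_im, Complex.mul_re, Complex.mul_im,
    Complex.conj_re, Complex.conj_im, Complex.ofReal_re, Complex.ofReal_im, Complex.I_re,
    Complex.I_im, Complex.re_ofNat, Complex.im_ofNat, Complex.one_re, Complex.one_im,
    Complex.zero_re, Complex.zero_im]
  ring

theorem solvesHomological_four {C : Exponent → ℝ} {A B D : ℂ} {d e m : ℝ}
    (hC : ∀ q : ℂ × ℝ, realPoly 4 C q =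
      2 * (A * q.1 ^ 4 + B * (q.1 ^ 3 * conj q.1) + D * (q.1 ^ 2 * q.2)).re
        + d * Complex.normSq q.1 ^ 2 + e * (Complex.normSq q.1 * q.2) + m * q.2 ^ 2) :
    SolvesHomological 4 C
      (fun i => if i = (3, 0) then B - Complex.I * D else e / 2 - Complex.I * ((d + m) / 2))
      fun i => if i = (4, 0) then -2 * Complex.I * A else
        if i = (2, 1) then -2 * Complex.I * D else -Complex.I * m := by
  intro q
  rw [hC, complexPoly_four, complexPoly_three]
  simp only [quadricPoint, pow_succ, pow_zero, Complex.normSq_apply, ↓reduceIte, Prod.mk.injEq,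
    Nat.reduceEqDiff, one_ne_zero, OfNat.one_ne_ofNat, OfNat.zero_ne_ofNat, OfNat.ofNat_ne_zero,
    OfNat.ofNat_ne_one, and_self, Complex.add_re, Complex.add_im, Complex.sub_re, Complex.sub_im,
    Complex.neg_re, Complex.neg_im, Complex.mul_re, Complex.mul_im, Complex.conj_re,
    Complex.conj_im, Complex.ofReal_re, Complex.ofReal_im, Complex.I_re, Complex.I_im,
    Complex.div_ofNat_re, Complex.div_ofNat_im, Complex.re_ofNat, Complex.im_ofNat, Complex.one_re,
    Complex.one_im]
  ring

/-- In weight five the unknown `F = -i (K + G)` is prescribed by the terms of bidegree `(3, 2)`,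
after which `L = (F - H - 2 i K) / 2` absorbs the remaining terms of bidegree `(2, 1)`. -/
theorem solvesHomological_five {C : Exponent → ℝ} {A B G D H K F L : ℂ}
    (hC : ∀ q : ℂ × ℝ, realPoly 5 C q =
      2 * (A * q.1 ^ 5 + B * (q.1 ^ 4 * conj q.1) + G * (q.1 ^ 3 * conj q.1 ^ 2)
        + D * (q.1 ^ 3 * q.2) + H * (q.1 ^ 2 * conj q.1 * q.2) + K * (q.1 * q.2 ^ 2)).re)
    (hF : F = -Complex.I * (K + G)) (hL : L = (F - H - 2 * Complex.I * K) / 2) :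
    SolvesHomological 5 C
      (fun i => if i = (4, 0) then B - Complex.I * D else
        if i = (2, 1) then F else conj K + Complex.I * conj L / 2)
      fun i => if i = (5, 0) then -2 * Complex.I * A else
        if i = (3, 1) then -2 * Complex.I * D else L := by
  intro q
  have hFre : F.re = K.im + G.im := by simp [hF]
  have hFim : F.im = -(K.re + G.re) := by simp [hF]
  have hLre : L.re = (F.re - H.re + 2 * K.im) / 2 := by simp [hL]
  have hLim : L.im = (F.im - H.im - 2 * K.re) / 2 := by simp [hL]
  rw [hC, complexPoly_five, complexPoly_four]
  simp only [quadricPoint, pow_succ, pow_zero, ↓reduceIte, Prod.mk.injEq, Nat.reduceEqDiff,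
    one_ne_zero, OfNat.one_ne_ofNat, OfNat.zero_ne_ofNat, OfNat.ofNat_ne_zero, OfNat.ofNat_ne_one,
    and_self, Complex.add_re, Complex.add_im, Complex.sub_re, Complex.sub_im, Complex.neg_re,
    Complex.neg_im, Complex.mul_re, Complex.mul_im, Complex.conj_re, Complex.conj_im,
    Complex.ofReal_re, Complex.ofReal_im, Complex.I_re, Complex.I_im, Complex.re_ofNat,
    Complex.im_ofNat, Complex.div_ofNat_re, Complex.div_ofNat_im, Complex.one_re, Complex.one_im]
  rw [hLre, hLim, hFre, hFim]
  ring

section AnalyticSolution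

variable {P : Type*} [NormedAddCommGroup P] [NormedSpace ℝ P] {p₀ : P} {C : Exponent → P → ℝ}

/-- The homological equation in weight `k` is solvable with coefficients depending analytically on
the right-hand side. -/
def AnalyticallySolvable (k : ℕ) (C : Exponent → P → ℝ) (p₀ : P) : Prop :=
  ∃ a b : ℕ × ℕ → P → ℂ, (∀ i, AnalyticAt ℝ (a i) p₀) ∧ (∀ i, AnalyticAt ℝ (b i) p₀) ∧
    ∀ p, SolvesHomological k (fun i => C i p) (fun i => a i p) (fun i => b i p)

theorem analyticallySolvable_three (hC : ∀ i, AnalyticAt ℝ (C i) p₀) :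
    AnalyticallySolvable 3 C p₀ := by
  -- The coefficients in `z`, `z̄`, `u`, read off by substituting `x = (z + z̄) / 2` and
  -- `y = (z - z̄) / (2 i)`; likewise in weights four and five.
  let c (i : Exponent) (p : P) : ℂ := C i p
  have hc (i : Exponent) : AnalyticAt ℝ (c i) p₀ :=
    (Complex.ofRealCLM.analyticAt _).fun_comp (hC i)
  let A (p : P) : ℂ := (c (3, 0, 0) p - c (2, 1, 0) p * Complex.I - c (1, 2, 0) p +
    c (0, 3, 0) p * Complex.I) / 8
  let B (p : P) : ℂ := (3 * c (3, 0, 0) p - c (2, 1, 0) p * Complex.I + c (1, 2, 0) p -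
    3 * c (0, 3, 0) p * Complex.I) / 8
  let D (p : P) : ℂ := (c (1, 0, 1) p - c (0, 1, 1) p * Complex.I) / 2
  have hA : AnalyticAt ℝ A p₀ := by fun_prop (disch := norm_num)
  have hB : AnalyticAt ℝ B p₀ := by fun_prop (disch := norm_num)
  have hD : AnalyticAt ℝ D p₀ := by fun_prop (disch := norm_num)
  refine ⟨_, _, ?_, ?_, fun p => solvesHomological_three (A := A p) (B := B p) (D := D p) ?_⟩
  · intro i
    split_ifs <;> fun_prop
  · intro i
    split_ifs <;> fun_prop
  · intro q
    rw [realPoly_three]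
    simp only [A, B, D, c, pow_succ, pow_zero, Complex.add_re, Complex.add_im, Complex.sub_re,
      Complex.sub_im, Complex.mul_re, Complex.mul_im, Complex.conj_re, Complex.conj_im,
      Complex.ofReal_re, Complex.ofReal_im, Complex.I_re, Complex.I_im, Complex.re_ofNat,
      Complex.im_ofNat, Complex.div_ofNat_re, Complex.div_ofNat_im, Complex.one_re, Complex.one_im]
    ring

theorem analyticallySolvable_four (hC : ∀ i, AnalyticAt ℝ (C i) p₀) :
    AnalyticallySolvable 4 C p₀ := by
  let c (i : Exponent) (p : P) : ℂ := C i p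
  have hc (i : Exponent) : AnalyticAt ℝ (c i) p₀ :=
    (Complex.ofRealCLM.analyticAt _).fun_comp (hC i)
  let A (p : P) : ℂ := (c (4, 0, 0) p - c (3, 1, 0) p * Complex.I - c (2, 2, 0) p +
    c (1, 3, 0) p * Complex.I + c (0, 4, 0) p) / 16
  let B (p : P) : ℂ := (2 * c (4, 0, 0) p - c (3, 1, 0) p * Complex.I -
    c (1, 3, 0) p * Complex.I - 2 * c (0, 4, 0) p) / 8
  let D (p : P) : ℂ := (c (2, 0, 1) p - c (1, 1, 1) p * Complex.I - c (0, 2, 1) p) / 4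
  let d (p : P) : ℝ := (3 * C (4, 0, 0) p + C (2, 2, 0) p + 3 * C (0, 4, 0) p) / 8
  let e (p : P) : ℝ := (C (2, 0, 1) p + C (0, 2, 1) p) / 2
  have hA : AnalyticAt ℝ A p₀ := by fun_prop (disch := norm_num)
  have hB : AnalyticAt ℝ B p₀ := by fun_prop (disch := norm_num)
  have hD : AnalyticAt ℝ D p₀ := by fun_prop (disch := norm_num)
  have hd : AnalyticAt ℝ (fun p => (d p : ℂ)) p₀ :=
    (Complex.ofRealCLM.analyticAt _).fun_comp (by fun_prop (disch := norm_num) : AnalyticAt ℝ d p₀)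
  have he : AnalyticAt ℝ (fun p => (e p : ℂ)) p₀ :=
    (Complex.ofRealCLM.analyticAt _).fun_comp (by fun_prop (disch := norm_num) : AnalyticAt ℝ e p₀)
  have hm : AnalyticAt ℝ (fun p => (C (0, 0, 2) p : ℂ)) p₀ := hc _
  refine ⟨_, _, ?_, ?_, fun p => solvesHomological_four (A := A p) (B := B p) (D := D p)
    (d := d p) (e := e p) (m := C (0, 0, 2) p) ?_⟩
  · intro i
    split_ifs <;> fun_prop (disch := norm_num)
  · intro i
    split_ifs <;> fun_prop
  · intro q
    rw [realPoly_four]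
    simp only [A, B, D, d, e, c, pow_succ, pow_zero, Complex.normSq_apply, Complex.add_re,
      Complex.add_im, Complex.sub_re, Complex.sub_im, Complex.mul_re, Complex.mul_im,
      Complex.conj_re, Complex.conj_im, Complex.ofReal_re, Complex.ofReal_im, Complex.I_re,
      Complex.I_im, Complex.re_ofNat, Complex.im_ofNat, Complex.div_ofNat_re, Complex.div_ofNat_im,
      Complex.one_re, Complex.one_im]
    ring

theorem analyticallySolvable_five (hC : ∀ i, AnalyticAt ℝ (C i) p₀) :
    AnalyticallySolvable 5 C p₀ := by
  let c (i : Exponent) (p : P) : ℂ := C i p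
  have hc (i : Exponent) : AnalyticAt ℝ (c i) p₀ :=
    (Complex.ofRealCLM.analyticAt _).fun_comp (hC i)
  let A (p : P) : ℂ := (c (5, 0, 0) p - c (4, 1, 0) p * Complex.I - c (3, 2, 0) p +
    c (2, 3, 0) p * Complex.I + c (1, 4, 0) p - c (0, 5, 0) p * Complex.I) / 32
  let B (p : P) : ℂ := (5 * c (5, 0, 0) p - 3 * c (4, 1, 0) p * Complex.I - c (3, 2, 0) p -
    c (2, 3, 0) p * Complex.I - 3 * c (1, 4, 0) p + 5 * c (0, 5, 0) p * Complex.I) / 32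
  let G (p : P) : ℂ := (5 * c (5, 0, 0) p - c (4, 1, 0) p * Complex.I + c (3, 2, 0) p -
    c (2, 3, 0) p * Complex.I + c (1, 4, 0) p - 5 * c (0, 5, 0) p * Complex.I) / 16
  let D (p : P) : ℂ := (c (3, 0, 1) p - c (2, 1, 1) p * Complex.I - c (1, 2, 1) p +
    c (0, 3, 1) p * Complex.I) / 8
  let H (p : P) : ℂ := (3 * c (3, 0, 1) p - c (2, 1, 1) p * Complex.I + c (1, 2, 1) p -
    3 * c (0, 3, 1) p * Complex.I) / 8
  let K (p : P) : ℂ := (c (1, 0, 2) p - c (0, 1, 2) p * Complex.I) / 2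
  let F (p : P) : ℂ := -Complex.I * (K p + G p)
  let L (p : P) : ℂ := (F p - H p - 2 * Complex.I * K p) / 2
  have hA : AnalyticAt ℝ A p₀ := by fun_prop (disch := norm_num)
  have hB : AnalyticAt ℝ B p₀ := by fun_prop (disch := norm_num)
  have hD : AnalyticAt ℝ D p₀ := by fun_prop (disch := norm_num)
  have hK : AnalyticAt ℝ K p₀ := by fun_prop (disch := norm_num)
  have hF : AnalyticAt ℝ F p₀ := by fun_prop (disch := norm_num)
  have hL : AnalyticAt ℝ L p₀ := by fun_prop (disch := norm_num)
  have hKconj : AnalyticAt ℝ (fun p => conj (K p)) p₀ := analyticAt_conj_comp hK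
  have hLconj : AnalyticAt ℝ (fun p => conj (L p)) p₀ := analyticAt_conj_comp hL
  refine ⟨_, _, ?_, ?_, fun p => solvesHomological_five (A := A p) (B := B p) (G := G p)
    (D := D p) (H := H p) (K := K p) (F := F p) (L := L p) ?_ rfl rfl⟩
  · intro i
    split_ifs <;> fun_prop (disch := norm_num)
  · intro i
    split_ifs <;> fun_prop
  · intro q
    rw [realPoly_five]
    simp only [A, B, G, D, H, K, c, pow_succ, pow_zero, Complex.add_re, Complex.add_im,
      Complex.sub_re, Complex.sub_im, Complex.mul_re, Complex.mul_im, Complex.conj_re,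
      Complex.conj_im, Complex.ofReal_re, Complex.ofReal_im, Complex.I_re, Complex.I_im,
      Complex.re_ofNat, Complex.im_ofNat, Complex.div_ofNat_re, Complex.div_ofNat_im,
      Complex.one_re, Complex.one_im]
    ring

theorem analyticallySolvable {k : ℕ} (hk : 3 ≤ k) (hk' : k < 6) (hC : ∀ i, AnalyticAt ℝ (C i) p₀) :
    AnalyticallySolvable k C p₀ := by
  interval_cases k
  · exact analyticallySolvable_three hC
  · exact analyticallySolvable_four hC
  · exact analyticallySolvable_five hC

end AnalyticSolution

end Homological

/-! ### Normalization weight by weight -/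

section NearQuadric

open scoped ComplexConjugate

theorem weightedO_quadricPoint_snd : WeightedO 2 fun q => (quadricPoint q).2 := by
  have hconst : WeightedO 0 fun _ => Complex.I := by
    simpa [WeightedO] using isBigO_const_const Complex.I (one_ne_zero (α := ℝ)) (𝓝 (0 : ℂ × ℝ))
  exact weightedO_snd.ofReal.add ((weightedO_fst.mul weightedO_fst.conj).mul hconst)

theorem weightedO_complexPoly_quadricPoint (m : ℕ) (a : ℕ × ℕ → ℂ) :
    WeightedO m fun q => complexPoly m a (quadricPoint q) := by
  refine WeightedO.sum fun i hi => WeightedO.const_mul _ ?_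
  have hmonomial := (weightedO_fst.pow i.1).mul (weightedO_quadricPoint_snd.pow i.2)
  rwa [one_mul, (Finset.mem_filter.1 hi).2] at hmonomial

/-- `X`, a parametrization of a hypersurface of `ℂ²`, agrees to leading order with that of the
hyperquadric, and the hypersurface is `v = z z̄ + O(k)`. -/
structure IsNearQuadric (k : ℕ) (X : ℂ × ℝ → ℂ × ℂ) : Prop where
  fst : WeightedO 2 fun q => (X q).1 - q.1
  snd : WeightedO 3 fun q => (X q).2 - (quadricPoint q).2
  defect : WeightedO k fun q => (X q).2.im - ‖(X q).1‖ ^ 2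

/-- The map `(z, w) ↦ (z + f, w + g)` with `f`, `g` weighted homogeneous of weights `k - 1`, `k`. -/
noncomputable def shear (k : ℕ) (a b : ℕ × ℕ → ℂ) (P : ℂ × ℂ) : ℂ × ℂ :=
  (P.1 + complexPoly (k - 1) a P, P.2 + complexPoly k b P)

theorem differentiable_complexPoly (m : ℕ) (a : ℕ × ℕ → ℂ) :
    Differentiable ℂ (complexPoly m a) := by
  unfold complexPoly
  fun_prop

theorem differentiable_shear (k : ℕ) (a b : ℕ × ℕ → ℂ) : Differentiable ℂ (shear k a b) :=
  (differentiable_fst.add (differentiable_complexPoly _ _)).prodMk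
    (differentiable_snd.add (differentiable_complexPoly _ _))

namespace IsNearQuadric

variable {k : ℕ} {X : ℂ × ℝ → ℂ × ℂ}

theorem weightedO_complexPoly_sub (hX : IsNearQuadric k X) (m : ℕ) (a : ℕ × ℕ → ℂ) :
    WeightedO (m + 1) fun q => complexPoly m a (X q) - complexPoly m a (quadricPoint q) := by
  simp only [complexPoly, ← Finset.sum_sub_distrib, ← mul_sub]
  refine WeightedO.sum fun i hi => WeightedO.const_mul _ ?_
  have hmonomial := WeightedO.mul_sub_mul (weightedO_fst.pow i.1)
    (weightedO_fst.pow_sub_pow hX.fst i.1) (weightedO_quadricPoint_snd.pow i.2)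
    (weightedO_quadricPoint_snd.pow_sub_pow hX.snd i.2)
  rwa [one_mul, (Finset.mem_filter.1 hi).2] at hmonomial

theorem weightedO_complexPoly (hX : IsNearQuadric k X) (m : ℕ) (a : ℕ × ℕ → ℂ) :
    WeightedO m fun q => complexPoly m a (X q) :=
  (((hX.weightedO_complexPoly_sub m a).mono m.le_succ).add
    (weightedO_complexPoly_quadricPoint m a)).congr fun _ => sub_add_cancel _ _

theorem weightedO_conj_mul_complexPoly_sub (hX : IsNearQuadric k X) (m : ℕ) (a : ℕ × ℕ → ℂ) :
    WeightedO (m + 2) fun q => conj (X q).1 * complexPoly m a (X q) -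
      conj q.1 * complexPoly m a (quadricPoint q) := by
  have hconj : WeightedO 2 fun q => conj (X q).1 - conj q.1 :=
    hX.fst.conj.congr fun q => map_sub _ _ _
  exact (WeightedO.mul_sub_mul weightedO_fst.conj hconj (weightedO_complexPoly_quadricPoint m a)
    (hX.weightedO_complexPoly_sub m a)).mono (by omega)

/-- The new defect differs from the old one by `Im g - 2 Re (z̄ f)` up to terms of higher weight. -/
theorem shear_comp (hk : 3 ≤ k) (hX : IsNearQuadric k X) {C : Exponent → ℝ}
    (hC : WeightedO (k + 1) fun q => (X q).2.im - ‖(X q).1‖ ^ 2 - realPoly k C q)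
    {a b : ℕ × ℕ → ℂ} (hab : SolvesHomological k C a b) :
    IsNearQuadric (k + 1) fun q => shear k a b (X q) := by
  obtain ⟨m, rfl⟩ : ∃ m, k = m + 1 := ⟨k - 1, by omega⟩
  have hf := hX.weightedO_complexPoly m a
  have hg := hX.weightedO_complexPoly (m + 1) b
  refine ⟨(hX.fst.add (hf.mono (by omega))).congr fun q => ?_,
    (hX.snd.add (hg.mono hk)).congr fun q => ?_, ?_⟩
  · exact sub_add_eq_add_sub _ _ _
  · exact sub_add_eq_add_sub _ _ _
  · have hcross := (hX.weightedO_conj_mul_complexPoly_sub m a).re.const_mul 2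
    have hsq : WeightedO (m + 2) fun q =>
        complexPoly m a (X q) * conj (complexPoly m a (X q)) :=
      (hf.mul hf.conj).mono (by omega)
    have hdiff := (hX.weightedO_complexPoly_sub (m + 1) b).im
    refine (((hC.add hdiff).sub hcross).sub hsq.re).congr fun q => ?_
    have hsolves := hab q
    simp only [shear, Nat.add_sub_cancel, Complex.sq_norm, Complex.normSq_apply,
      Complex.add_re, Complex.add_im, Complex.sub_re, Complex.sub_im, Complex.mul_re,
      Complex.conj_re, Complex.conj_im] at hsolves ⊢
    linear_combination -hsolves

end IsNearQuadric

section Family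

variable {P : Type*} [NormedAddCommGroup P] [NormedSpace ℝ P] {p₀ : P}

theorem analyticAt_complexPoly (m : ℕ) {a : ℕ × ℕ → P → ℂ} (ha : ∀ i, AnalyticAt ℝ (a i) p₀)
    (Q : ℂ × ℂ) :
    AnalyticAt ℝ (fun x : P × (ℂ × ℂ) => complexPoly m (fun i => a i x.1) x.2) (p₀, Q) := by
  refine Finset.analyticAt_fun_sum _ fun i _ => ?_
  have hcoeff : AnalyticAt ℝ (fun x : P × (ℂ × ℂ) => a i x.1) (p₀, Q) :=
    AnalyticAt.fun_comp (f := Prod.fst) (x := (p₀, Q)) (ha i) analyticAt_fst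
  have hz : AnalyticAt ℝ (fun x : P × (ℂ × ℂ) => x.2.1) (p₀, Q) :=
    analyticAt_fst.fun_comp analyticAt_snd
  have hw : AnalyticAt ℝ (fun x : P × (ℂ × ℂ) => x.2.2) (p₀, Q) :=
    analyticAt_snd.fun_comp analyticAt_snd
  exact hcoeff.mul ((hz.pow _).mul (hw.pow _))

theorem analyticAt_shear (k : ℕ) {a b : ℕ × ℕ → P → ℂ} (ha : ∀ i, AnalyticAt ℝ (a i) p₀)
    (hb : ∀ i, AnalyticAt ℝ (b i) p₀) (Q : ℂ × ℂ) :
    AnalyticAt ℝ (fun x : P × (ℂ × ℂ) => shear k (fun i => a i x.1) (fun i => b i x.1) x.2)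
      (p₀, Q) := by
  have hz : AnalyticAt ℝ (fun x : P × (ℂ × ℂ) => x.2.1) (p₀, Q) :=
    analyticAt_fst.fun_comp analyticAt_snd
  have hw : AnalyticAt ℝ (fun x : P × (ℂ × ℂ) => x.2.2) (p₀, Q) :=
    analyticAt_snd.fun_comp analyticAt_snd
  exact (hz.add (analyticAt_complexPoly _ ha Q)).prod (hw.add (analyticAt_complexPoly _ hb Q))

theorem analyticAt_defect {Y : P → ℂ × ℂ} (hY : AnalyticAt ℝ Y p₀) :
    AnalyticAt ℝ (fun p => (Y p).2.im - ‖(Y p).1‖ ^ 2) p₀ := by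
  have hfst : AnalyticAt ℝ (fun p => (Y p).1) p₀ := analyticAt_fst.fun_comp hY
  have hsnd : AnalyticAt ℝ (fun p => (Y p).2) p₀ := analyticAt_snd.fun_comp hY
  have hre := analyticAt_re_comp hfst
  have him := analyticAt_im_comp hfst
  have hv := analyticAt_im_comp hsnd
  simp only [Complex.sq_norm, Complex.normSq_apply]
  fun_prop

/-- A family of parametrized hypersurfaces `v = z z̄ + O(k)` is transformed to one with
`v = z z̄ + O(l)`, `k ≤ l ≤ 6`. -/
theorem exists_normalizing_family {X : P → ℂ × ℝ → ℂ × ℂ}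
    (hX : AnalyticAt ℝ (fun x : P × (ℂ × ℝ) => X x.1 x.2) (p₀, 0))
    (hnear : ∀ᶠ p in 𝓝 p₀, IsNearQuadric 3 (X p)) {l : ℕ} (hl : 3 ≤ l) (hl' : l ≤ 6) :
    ∃ S : P → ℂ × ℂ → ℂ × ℂ, (∀ p, Differentiable ℂ (S p)) ∧
      (∀ Q, AnalyticAt ℝ (fun x : P × (ℂ × ℂ) => S x.1 x.2) (p₀, Q)) ∧
      ∀ᶠ p in 𝓝 p₀, IsNearQuadric l fun q => S p (X p q) := by
  induction l, hl using Nat.le_induction with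
  | base => exact ⟨fun _ Q => Q, fun _ => differentiable_id, fun Q => analyticAt_snd, hnear⟩
  | succ k hk ih =>
    obtain ⟨S, hSdiff, hSan, hSnear⟩ := ih (by omega)
    have hSX : AnalyticAt ℝ (fun x : P × (ℂ × ℝ) => S x.1 (X x.1 x.2)) (p₀, 0) :=
      AnalyticAt.fun_comp (g := fun x : P × (ℂ × ℂ) => S x.1 x.2)
        (f := fun x : P × (ℂ × ℝ) => (x.1, X x.1 x.2)) (hSan _) (analyticAt_fst.prod hX)
    obtain ⟨C, hC, htaylor⟩ := exists_weighted_taylor (analyticAt_defect hSX) 6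
    obtain ⟨a, b, ha, hb, hab⟩ := analyticallySolvable hk (by omega) hC
    refine ⟨fun p Q => shear k (fun i => a i p) (fun i => b i p) (S p Q),
      fun p => (differentiable_shear _ _ _).comp (hSdiff p), fun Q => ?_, ?_⟩
    · exact AnalyticAt.fun_comp
        (g := fun x : P × (ℂ × ℂ) => shear k (fun i => a i x.1) (fun i => b i x.1) x.2)
        (f := fun x : P × (ℂ × ℂ) => (x.1, S x.1 x.2)) (analyticAt_shear k ha hb _)
        (analyticAt_fst.prod (hSan Q))
    · filter_upwards [hSnear, htaylor] with p hp htaylor_p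
      exact hp.shear_comp hk (htaylor_p.sub_realPoly (by omega) hp.defect) (hab p)

end Family

end NearQuadric

/-! ### Hypersurfaces close to the hyperquadric as graphs -/

theorem weightedNorm_sq_le (q : ℂ × ℝ) : weightedNorm q ^ 2 ≤ 2 * ‖q.1‖ ^ 2 + 2 * |q.2| := by
  have hsqrt := Real.sq_sqrt (abs_nonneg q.2)
  unfold weightedNorm
  nlinarith [sq_nonneg (‖q.1‖ - √|q.2|)]

theorem isBigO_weightedNorm_sq : (fun q => weightedNorm q ^ 2) =O[𝓝 0] fun q : ℂ × ℝ => q := by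
  refine IsBigO.of_bound 4 ?_
  filter_upwards [Metric.closedBall_mem_nhds (0 : ℂ × ℝ) one_pos] with q hq
  rw [mem_closedBall_zero_iff] at hq
  rw [Real.norm_of_nonneg (by positivity)]
  have hfst : ‖q.1‖ ≤ ‖q‖ := norm_fst_le q
  have hsnd : |q.2| ≤ ‖q‖ := norm_snd_le q
  nlinarith [weightedNorm_sq_le q, norm_nonneg q.1, norm_nonneg q]

namespace WeightedO

variable {E : Type*} [NormedAddCommGroup E] {f : ℂ × ℝ → E}

theorem apply_zero {k : ℕ} (hk : k ≠ 0) (hf : WeightedO k f) : f 0 = 0 := by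
  obtain ⟨c, hc⟩ := IsBigO.bound hf
  simpa [weightedNorm, hk] using hc.self_of_nhds

theorem hasFDerivAt [NormedSpace ℝ E] (hf : WeightedO 3 f) :
    HasFDerivAt f (0 : ℂ × ℝ →L[ℝ] E) 0 := by
  have hcube : (fun q => weightedNorm q * weightedNorm q ^ 2) =o[𝓝 0]
      fun q : ℂ × ℝ => 1 * ‖q‖ :=
    ((isLittleO_one_iff ℝ).2 tendsto_weightedNorm).mul_isBigO isBigO_weightedNorm_sq.norm_right
  refine HasFDerivAt.of_isLittleO ?_
  simp only [hf.apply_zero three_ne_zero, sub_zero, zero_apply]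
  refine IsBigO.trans_isLittleO hf ((hcube.congr (fun q => ?_) fun q => one_mul _).of_norm_right)
  exact (pow_succ' _ _).symm

end WeightedO

namespace IsNearQuadric

open AnalyticGraph

variable {k : ℕ} {X : ℂ × ℝ → ℂ × ℂ}

theorem apply_zero (hX : IsNearQuadric k X) : X 0 = 0 := by
  ext1
  · simpa using hX.fst.apply_zero two_ne_zero
  · simpa [quadricPoint] using hX.snd.apply_zero three_ne_zero

theorem fderiv_snd (hX : IsNearQuadric k X) (hd : DifferentiableAt ℝ X 0) (v : ℂ × ℝ) :
    (fderiv ℝ X 0 v).2 = v.2 := by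
  have hmodulus : HasFDerivAt (fun q : ℂ × ℝ => q.1 * (starRingEnd ℂ) q.1 * Complex.I)
      (0 : ℂ × ℝ →L[ℝ] ℂ) 0 := by
    refine IsBigO.hasFDerivAt (n := 2) (IsBigO.of_bound 1 (Eventually.of_forall fun q => ?_))
      one_lt_two
    simp only [norm_mul, RCLike.norm_conj, Complex.norm_I, mul_one, sub_zero, one_mul, norm_pow,
      norm_norm, ← pow_two]
    gcongr
    exact norm_fst_le q
  have hu : HasFDerivAt (fun q : ℂ × ℝ => (q.2 : ℂ))
      (Complex.ofRealCLM.comp (ContinuousLinearMap.snd ℝ ℂ ℝ)) 0 :=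
    (Complex.ofRealCLM.comp (ContinuousLinearMap.snd ℝ ℂ ℝ)).hasFDerivAt
  have hsum : HasFDerivAt (fun q => (X q).2) _ 0 :=
    (hX.snd.hasFDerivAt.add (hu.add hmodulus)).congr_of_eventuallyEq
      (Eventually.of_forall fun q => by simp [quadricPoint])
  have hchain := (ContinuousLinearMap.snd ℝ ℂ ℂ).hasFDerivAt.comp 0 hd.hasFDerivAt
  simpa using DFunLike.congr_fun (hchain.unique hsum) v

theorem fderiv_fst (hX : IsNearQuadric k X) (hd : DifferentiableAt ℝ X 0) (ζ : ℂ) :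
    (fderiv ℝ X 0 (ζ, 0)).1 = ζ := by
  have hinl : Tendsto (fun z : ℂ => ((z, 0) : ℂ × ℝ)) (𝓝 0) (𝓝 0) :=
    (by fun_prop : Continuous fun z : ℂ => ((z, 0) : ℂ × ℝ)).tendsto' _ _ rfl
  have hquadratic : (fun z : ℂ => (X (z, 0)).1 - z) =O[𝓝 0] fun z => ‖z - 0‖ ^ 2 :=
    (IsBigO.comp_tendsto hX.fst hinl).congr_right fun z => by simp [weightedNorm]
  have hzero := hquadratic.hasFDerivAt (𝕜 := ℝ) one_lt_two
  have hchain : HasFDerivAt (fun z : ℂ => (X (z, 0)).1)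
      ((ContinuousLinearMap.fst ℝ ℂ ℂ).comp
        ((fderiv ℝ X 0).comp (ContinuousLinearMap.inl ℝ ℂ ℝ))) 0 :=
    (ContinuousLinearMap.fst ℝ ℂ ℂ).hasFDerivAt.comp 0
      (HasFDerivAt.comp (g := X) (0 : ℂ) hd.hasFDerivAt
        (ContinuousLinearMap.inl ℝ ℂ ℝ).hasFDerivAt)
  exact sub_eq_zero.1 (DFunLike.congr_fun ((hchain.sub (hasFDerivAt_id _)).unique hzero) ζ)

theorem injective_base_comp_fderiv (hX : IsNearQuadric k X) (hd : DifferentiableAt ℝ X 0) :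
    Function.Injective (base.comp (fderiv ℝ X 0)) := by
  rw [injective_iff_map_eq_zero]
  intro v hv
  have hfst : (fderiv ℝ X 0 v).1 = 0 := congrArg Prod.fst hv
  have hsnd : v.2 = 0 := by
    have hre : (fderiv ℝ X 0 v).2.re = 0 := congrArg Prod.snd hv
    rwa [hX.fderiv_snd hd, Complex.ofReal_re] at hre
  have hv' : v = (v.1, 0) := Prod.ext rfl hsnd
  rw [hv', hX.fderiv_fst hd] at hfst
  exact Prod.ext hfst hsnd

theorem surjective_of_comp_eq_fderiv (hX : IsNearQuadric k X) (hd : DifferentiableAt ℝ X 0)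
    {L : ℂ × ℂ →L[ℂ] ℂ × ℂ} {D : ℂ × ℝ → ℂ × ℂ} (hLD : ∀ v, L (D v) = fderiv ℝ X 0 v) :
    Function.Surjective L := by
  intro y
  refine ⟨y.2 • D (0, 1) + D (y.1 - y.2 * (fderiv ℝ X 0 (0, 1)).1, 0), ?_⟩
  rw [map_add, map_smul, hLD, hLD]
  ext1
  · simp [hX.fderiv_fst hd]
  · simp [hX.fderiv_snd hd]

theorem weightedNorm_sq_le_apply (hX : IsNearQuadric k X) : ∀ᶠ v in 𝓝 (0 : ℂ × ℝ),
    weightedNorm v ^ 2 ≤ 8 * ‖(X v).1‖ ^ 2 + 4 * |(X v).2.re| := by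
  obtain ⟨c, -, hfst⟩ := IsBigO.exists_pos hX.fst
  obtain ⟨d, -, hsnd⟩ := IsBigO.exists_pos hX.snd.re
  have hsmall : ∀ᶠ v in 𝓝 (0 : ℂ × ℝ),
      8 * c ^ 2 * weightedNorm v ^ 2 + 4 * d * weightedNorm v ≤ 1 := by
    have hlim := ((tendsto_weightedNorm.pow 2).const_mul (8 * c ^ 2)).add
      (tendsto_weightedNorm.const_mul (4 * d))
    exact hlim.eventually (Iic_mem_nhds (by simp))
  filter_upwards [hfst.bound, hsnd.bound, hsmall] with v hfst_v hsnd_v hsmall_v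
  rw [Real.norm_of_nonneg (pow_nonneg (weightedNorm_nonneg v) _)] at hfst_v hsnd_v
  have hz : ‖v.1‖ ≤ ‖(X v).1‖ + c * weightedNorm v ^ 2 :=
    (norm_le_norm_add_norm_sub _ _).trans (add_le_add_right hfst_v _)
  have hu : |v.2| ≤ |(X v).2.re| + d * weightedNorm v ^ 3 := by
    have hre : ((X v).2 - (quadricPoint v).2).re = (X v).2.re - v.2 := by
      simp [quadricPoint, mul_comm]
    rw [hre] at hsnd_v
    exact (norm_le_norm_add_norm_sub _ _).trans (add_le_add_right hsnd_v _)
  have hz_sq : ‖v.1‖ ^ 2 ≤ 2 * ‖(X v).1‖ ^ 2 + 2 * (c * weightedNorm v ^ 2) ^ 2 :=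
    (pow_le_pow_left₀ (norm_nonneg _) hz 2).trans (add_sq_le.trans_eq (mul_add _ _ _))
  nlinarith [weightedNorm_sq_le v,
    mul_le_mul_of_nonneg_right hsmall_v (sq_nonneg (weightedNorm v))]

theorem isBigO_weightedNorm (hX : IsNearQuadric k X) : (fun v => weightedNorm v ^ 6) =O[𝓝 0]
    fun v => ‖(X v).1‖ ^ 6 + |(X v).2.re| ^ 3 := by
  refine IsBigO.of_bound 2048 ?_
  filter_upwards [hX.weightedNorm_sq_le_apply] with v hv
  rw [Real.norm_of_nonneg (by positivity), Real.norm_of_nonneg (by positivity)]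
  calc weightedNorm v ^ 6 = (weightedNorm v ^ 2) ^ 3 := by ring
    _ ≤ (8 * ‖(X v).1‖ ^ 2 + 4 * |(X v).2.re|) ^ 3 := by gcongr
    _ ≤ 2 ^ 2 * ((8 * ‖(X v).1‖ ^ 2) ^ 3 + (4 * |(X v).2.re|) ^ 3) :=
      add_pow_le (by positivity) (by positivity) 3
    _ ≤ 2048 * (‖(X v).1‖ ^ 6 + |(X v).2.re| ^ 3) := by
      have hnonneg : 0 ≤ |(X v).2.re| ^ 3 := by positivity
      linarith

end IsNearQuadric

section LocalInverse

open scoped ContDiff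

theorem exists_analytic_openPartialHomeomorph {𝕜 E : Type*} [RCLike 𝕜] [NormedAddCommGroup E]
    [NormedSpace 𝕜 E] [FiniteDimensional 𝕜 E] {f : E → E} {a : E} (hf : AnalyticAt 𝕜 f a)
    (hsurj : Function.Surjective (fderiv 𝕜 f a)) :
    ∃ e : OpenPartialHomeomorph E E, ⇑e = f ∧ a ∈ e.source ∧ AnalyticOnNhd 𝕜 f e.source ∧
      AnalyticOnNhd 𝕜 e.symm e.target := by
  have : CompleteSpace E := FiniteDimensional.complete 𝕜 E
  let L : E ≃L[𝕜] E := (LinearEquiv.ofBijective (fderiv 𝕜 f a).toLinearMap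
    ⟨LinearMap.injective_iff_surjective.2 hsurj, hsurj⟩).toContinuousLinearEquiv
  have hL : HasFDerivAt f (L : E →L[𝕜] E) a := hf.differentiableAt.hasFDerivAt
  have hω : ω ≠ (0 : WithTop ℕ∞) := by simp
  let e := hf.contDiffAt.toOpenPartialHomeomorph f hL hω
  have ha : a ∈ e.source := hf.contDiffAt.mem_toOpenPartialHomeomorph_source hL hω
  have hsymm : AnalyticAt 𝕜 e.symm (f a) :=
    (hf.contDiffAt.to_localInverse hL hω : ContDiffAt 𝕜 ω e.symm (f a)).analyticAt
  let s := {x | AnalyticAt 𝕜 f x} ∩ (e.source ∩ e ⁻¹' {y | AnalyticAt 𝕜 e.symm y})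
  have hs : IsOpen s := (isOpen_analyticAt 𝕜 f).inter
    (e.isOpen_inter_preimage (isOpen_analyticAt 𝕜 e.symm))
  refine ⟨e.restrOpen s hs, rfl, ⟨ha, hf, ha, hsymm⟩, fun x hx => hx.2.1, fun y hy => ?_⟩
  have hy' : AnalyticAt 𝕜 e.symm (e (e.symm y)) := hy.2.2.2
  rwa [e.right_inv hy.1] at hy'

end LocalInverse

namespace AnalyticGraph

theorem exists_carrier_eq_image {V : Set (ℂ × ℝ)} (hV : IsOpen V) {Y : ℂ × ℝ → ℂ × ℂ}
    (hY : AnalyticOnNhd ℝ Y V) {e : OpenPartialHomeomorph (ℂ × ℝ) (ℂ × ℝ)}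
    (he : ∀ q, e q = base (Y q)) (hVe : V ⊆ e.source)
    (hsymm : AnalyticOnNhd ℝ e.symm e.target) :
    ∃ N : AnalyticGraph, N.carrier = Y '' V := by
  refine ⟨⟨e '' V, e.isOpen_image_of_subset_source hV hVe, fun y => (Y (e.symm y)).2.im, ?_⟩, ?_⟩
  · rintro _ ⟨v, hv, rfl⟩
    have hYv : AnalyticAt ℝ Y (e.symm (e v)) := by
      rw [e.left_inv (hVe hv)]
      exact hY v hv
    exact ((Complex.imCLM.comp (ContinuousLinearMap.snd ℝ ℂ ℂ)).analyticAt _).fun_comp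
      (hYv.fun_comp (hsymm _ (e.map_source (hVe hv))))
  · ext P
    constructor
    · rintro ⟨⟨v, hv, hvP⟩, him⟩
      refine ⟨v, hv, ?_⟩
      dsimp only at him
      rw [← hvP, e.left_inv (hVe hv)] at him
      rw [he] at hvP
      exact Prod.ext (congrArg (fun q : ℂ × ℝ => q.1) hvP)
        (Complex.ext (congrArg (fun q : ℂ × ℝ => q.2) hvP) him.symm)
    · rintro ⟨v, hv, rfl⟩
      refine ⟨⟨v, hv, he v⟩, ?_⟩
      change (Y v).2.im = (Y (e.symm (base (Y v)))).2.im
      rw [← he, e.left_inv (hVe hv)]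

/-- The image of `M` under a local biholomorphism is again a graph as soon as the projection to
the `(z, u)`-space of its natural parametrization is a submersion. -/
theorem exists_isLocalBiholomorphism (M : AnalyticGraph) {p : ℂ × ℝ} (hp : p ∈ M.Ω)
    {φ : ℂ × ℂ → ℂ × ℂ} (hφ : AnalyticAt ℂ φ (M.point p))
    (hsurj : Function.Surjective (fderiv ℂ φ (M.point p)))
    (hbase : Function.Surjective (fderiv ℝ (fun q => base (φ (M.point q))) p)) :
    ∃ (e : OpenPartialHomeomorph (ℂ × ℂ) (ℂ × ℂ)) (N : AnalyticGraph), ⇑e = φ ∧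
      IsLocalBiholomorphism e M p N (base (φ (M.point p))) := by
  have hpoint := M.analyticAt_point hp
  have hφpoint : AnalyticAt ℝ (fun q => φ (M.point q)) p := hφ.restrictScalars.fun_comp hpoint
  obtain ⟨e, rfl, hpe, he, hesymm⟩ := exists_analytic_openPartialHomeomorph hφ hsurj
  obtain ⟨g, hg, hpg, -, hgsymm⟩ :=
    exists_analytic_openPartialHomeomorph ((base.analyticAt _).fun_comp hφpoint) hbase
  obtain ⟨V, hV, hVopen, hpV⟩ := eventually_nhds_iff.1 <|
    (g.open_source.eventually_mem hpg).and <| (M.isOpen.eventually_mem hp).and <|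
      hpoint.continuousAt.eventually (e.open_source.mem_nhds hpe)
  obtain ⟨N, hN⟩ := exists_carrier_eq_image hVopen (Y := fun q => e (M.point q))
    (fun q hq => (he _ (hV q hq).2.2).restrictScalars.fun_comp (M.analyticAt_point (hV q hq).2.1))
    (fun q => congrFun hg q) (fun q hq => (hV q hq).1) hgsymm
  have hpN : e (M.point p) ∈ N.carrier := hN ▸ mem_image_of_mem _ hpV
  refine ⟨e.restrOpen (base ⁻¹' V) (hVopen.preimage base.continuous), N, rfl, ?_, ?_, hp, hpN.1,
    ⟨hpe, by rwa [mem_preimage, base_point]⟩, (point_base hpN).symm, ?_⟩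
  · exact fun x hx => (he x hx.1).differentiableAt.differentiableWithinAt
  · exact fun y hy => (hesymm y hy.1).differentiableAt.differentiableWithinAt
  · intro x hx
    change e x ∈ N.carrier ↔ x ∈ M.carrier
    rw [hN]
    constructor
    · rintro ⟨v, hv, hvx⟩
      rw [← e.injOn (hV v hv).2.2 hx.1 hvx]
      exact M.point_mem_carrier (hV v hv).2.1
    · exact fun hxM => ⟨base x, hx.2, congrArg e (point_base hxM)⟩

theorem exists_isNormalizing_of_isNearQuadric (M : AnalyticGraph) {par : ℂ × ℝ → ℂ × ℝ}
    (hp : par 0 ∈ M.Ω) (hpar : AnalyticAt ℝ par 0) {φ : ℂ × ℂ → ℂ × ℂ}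
    (hφ : AnalyticAt ℂ φ (M.point (par 0)))
    (hX : IsNearQuadric 6 fun q => φ (M.point (par q))) :
    ∃ e : OpenPartialHomeomorph (ℂ × ℂ) (ℂ × ℂ), ⇑e = φ ∧ M.IsNormalizing (par 0) e := by
  have hpoint := M.analyticAt_point hp
  have hφpoint : AnalyticAt ℝ (fun q => φ (M.point q)) (par 0) :=
    hφ.restrictScalars.fun_comp hpoint
  have hXan : AnalyticAt ℝ (fun q => φ (M.point (par q))) 0 :=
    AnalyticAt.fun_comp (g := fun q => φ (M.point q)) hφpoint hpar
  have hd := hXan.differentiableAt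
  have hbase : Function.Surjective (base.comp (fderiv ℝ (fun q => φ (M.point (par q))) 0)) :=
    LinearMap.injective_iff_surjective.1 (hX.injective_base_comp_fderiv hd)
  have hpd := hpar.differentiableAt.hasFDerivAt
  have hsurj : Function.Surjective (fderiv ℂ φ (M.point (par 0))) := by
    have hchain := HasFDerivAt.comp (g := φ) (0 : ℂ × ℝ)
      (hφ.differentiableAt.hasFDerivAt.restrictScalars ℝ)
      (HasFDerivAt.comp (g := M.point) (0 : ℂ × ℝ) hpoint.differentiableAt.hasFDerivAt hpd)
    exact hX.surjective_of_comp_eq_fderiv hd fun v => (DFunLike.congr_fun hchain.fderiv v).symm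
  have hbase' : Function.Surjective (fderiv ℝ (fun q => base (φ (M.point q))) (par 0)) := by
    have hG := ((base.analyticAt _).fun_comp hφpoint).differentiableAt.hasFDerivAt
    have hchain := (HasFDerivAt.comp (0 : ℂ × ℝ) hG hpd).unique
      (base.hasFDerivAt.comp 0 hd.hasFDerivAt)
    rw [← hchain] at hbase
    exact Function.Surjective.of_comp hbase
  obtain ⟨e, N, rfl, he⟩ := M.exists_isLocalBiholomorphism hp hφ hsurj hbase'
  rw [hX.apply_zero, map_zero] at he
  refine ⟨e, rfl, N, ?_, he⟩
  have hmap : map (fun q => base (e (M.point (par q)))) (𝓝 0) = 𝓝 0 := by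
    have hstrict : HasStrictFDerivAt (fun q => base (e (M.point (par q)))) _ 0 :=
      base.hasStrictFDerivAt.comp 0 hXan.hasStrictFDerivAt
    rw [hstrict.map_nhds_eq_of_surj (LinearMap.range_eq_top.2 hbase), hX.apply_zero, map_zero]
  rw [IsNormalized, ← hmap, isBigO_map]
  refine (hX.defect.trans hX.isBigO_weightedNorm).congr' ?_ EventuallyEq.rfl
  filter_upwards [hpar.continuousAt.eventually he.eventually_mem] with q hq
  exact congrArg (· - _) hq.2

end AnalyticGraph

/-! ### Normalization to leading order, with analytic dependence on the point -/

section Calculus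

open scoped ContDiff

variable {E F G : Type*} [NormedAddCommGroup E] [NormedSpace ℝ E] [NormedAddCommGroup F]
  [NormedSpace ℝ F] [NormedAddCommGroup G] [NormedSpace ℝ G] [CompleteSpace F]

theorem analyticAt_clm_apply [CompleteSpace G] {f : E → F →L[ℝ] G} {v : E → F} {p : E}
    (hf : AnalyticAt ℝ f p) (hv : AnalyticAt ℝ v p) : AnalyticAt ℝ (fun q => f q (v q)) p :=
  (hf.contDiffAt.clm_apply (n := ω) hv.contDiffAt).analyticAt

theorem isBigO_sub_taylor_two {f : E → F} {p : E} (hf : AnalyticAt ℝ f p) :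
    (fun y => f (p + y) - f p - fderiv ℝ f p y - (1 / 2 : ℝ) • fderiv ℝ (fderiv ℝ f) p y y)
      =O[𝓝 0] fun y => ‖y‖ ^ 3 := by
  obtain ⟨ser, r, hser⟩ := hf
  refine (hser.hasFPowerSeriesAt.isBigO_sub_partialSum_pow 3).congr_left fun y => ?_
  have h0 : f p = ser 0 fun _ => y := by
    simpa using (hser.factorial_smul y 0).symm
  have h1 : fderiv ℝ f p y = ser 1 fun _ => y := by
    simpa [iteratedFDeriv_one_apply] using (hser.factorial_smul y 1).symm
  have h2 : fderiv ℝ (fderiv ℝ f) p y y = (2 : ℝ) • ser 2 fun _ => y := by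
    have hfactorial := hser.factorial_smul y 2
    rw [iteratedFDeriv_two_apply] at hfactorial
    rw [← hfactorial, Nat.factorial_two, two_smul, two_smul]
  simp only [FormalMultilinearSeries.partialSum, Finset.sum_range_succ, Finset.sum_range_zero, h0,
    h1, h2]
  module

end Calculus

namespace AnalyticGraph

variable (M : AnalyticGraph)

/-- The partial derivative `F_u`. -/
noncomputable def Fu (p : ℂ × ℝ) : ℝ := fderiv ℝ M.F p (0, 1)

/-- The partial derivative `F_x`. -/
noncomputable def Fx (p : ℂ × ℝ) : ℝ := fderiv ℝ M.F p (1, 0)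

/-- The partial derivative `F_y`. -/
noncomputable def Fy (p : ℂ × ℝ) : ℝ := fderiv ℝ M.F p (Complex.I, 0)

/-- The Wirtinger derivative `F_z = (F_x - i F_y) / 2`. -/
noncomputable def Fz (p : ℂ × ℝ) : ℂ := ((M.Fx p : ℂ) - (M.Fy p : ℂ) * Complex.I) / 2

/-- The projection to the `(z, u)`-space of the CR-tangent vector `X` with `z`-component `1`. -/
noncomputable def crX (p : ℂ × ℝ) : ℂ × ℝ :=
  (1, (M.Fy p - M.Fu p * M.Fx p) / (1 + M.Fu p ^ 2))

/-- The projection to the `(z, u)`-space of the CR-tangent vector `Y = i X`. -/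
noncomputable def crY (p : ℂ × ℝ) : ℂ × ℝ :=
  (Complex.I, -(M.Fx p + M.Fu p * M.Fy p) / (1 + M.Fu p ^ 2))

/-- The Hessian of `F`. -/
noncomputable def hess (p : ℂ × ℝ) : ℂ × ℝ →L[ℝ] ℂ × ℝ →L[ℝ] ℝ := fderiv ℝ (fderiv ℝ M.F) p

/-- The Levi coefficient: the coefficient of `ζ ζ̄` in the quadratic form
`hess (Re ζ • X + Im ζ • Y) / 2` on the CR-tangent space. -/
noncomputable def leviCoeff (p : ℂ × ℝ) : ℝ :=
  (M.hess p (M.crX p) (M.crX p) + M.hess p (M.crY p) (M.crY p)) / 4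

/-- The coefficient of `ζ ^ 2` in the quadratic form `hess (Re ζ • X + Im ζ • Y) / 2` on the
CR-tangent space, symmetrized in `X` and `Y`. -/
noncomputable def harmCoeff (p : ℂ × ℝ) : ℂ :=
  ((M.hess p (M.crX p) (M.crX p) - M.hess p (M.crY p) (M.crY p) : ℝ) : ℂ) / 8 -
    ((M.hess p (M.crX p) (M.crY p) + M.hess p (M.crY p) (M.crX p) : ℝ) : ℂ) * Complex.I / 8

/-- The quadratic part of `F` along the CR-tangent space. -/
noncomputable def quadTerm (p : ℂ × ℝ) (ζ : ℂ) : ℝ :=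
  M.leviCoeff p * (ζ.re ^ 2 + ζ.im ^ 2) + 2 * (M.harmCoeff p * ζ ^ 2).re

/-- The `u`-component, of weight two, of the increment `paramStep`; it is chosen so that `quadMap`
has second component `s + i ζ ζ̄ + O(3)` in the adapted coordinates. -/
noncomputable def paramShift (p q : ℂ × ℝ) : ℝ :=
  (M.leviCoeff p * q.2 - M.Fu p * M.quadTerm p q.1 - 2 * (M.harmCoeff p * q.1 ^ 2).im) /
    (1 + M.Fu p ^ 2)

/-- The increment of the base point for the adapted coordinates `q = (ζ, s)`. -/
noncomputable def paramStep (p q : ℂ × ℝ) : ℂ × ℝ :=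
  (q.1.re • M.crX p + q.1.im • M.crY p) + M.paramShift p q • ((0, 1) : ℂ × ℝ)

/-- The parametrization of the `(z, u)`-space near `p` by adapted coordinates `q = (ζ, s)`, in which
`quadMap` brings `M` into leading order normal form. -/
noncomputable def param (p q : ℂ × ℝ) : ℂ × ℝ := p + M.paramStep p q

/-- The quadratic map which normalizes `M` at `p` to leading order. -/
noncomputable def quadMap (p : ℂ × ℝ) (P : ℂ × ℂ) : ℂ × ℂ :=
  (P.1 - p.1, ((1 - M.Fu p * Complex.I) * (P.2 - (M.point p).2) -
    2 * Complex.I * M.Fz p * (P.1 - p.1) - 2 * Complex.I * M.harmCoeff p * (P.1 - p.1) ^ 2) /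
      M.leviCoeff p)

/-- The remainder of the expansion of `F` at `p` to second order along the CR-tangent space and
first order transversally to it. -/
noncomputable def paramRemainder (p q : ℂ × ℝ) : ℝ :=
  M.F (M.param p q) - M.F p - fderiv ℝ M.F p (M.paramStep p q) - M.quadTerm p q.1

variable {M}

theorem fderiv_F_apply (p v : ℂ × ℝ) :
    fderiv ℝ M.F p v = v.1.re * M.Fx p + v.1.im * M.Fy p + v.2 * M.Fu p := by
  have hv : v = v.1.re • ((1, 0) : ℂ × ℝ) + v.1.im • ((Complex.I, 0) : ℂ × ℝ) +
      v.2 • ((0, 1) : ℂ × ℝ) := by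
    ext1 <;> simp
  conv_lhs => rw [hv]
  simp only [map_add, map_smul, smul_eq_mul, Fx, Fy, Fu]

theorem one_add_Fu_sq_ne_zero (p : ℂ × ℝ) : 1 + M.Fu p ^ 2 ≠ 0 := by positivity

theorem I_smul_tangentLift_crX (p : ℂ × ℝ) :
    Complex.I • M.tangentLift p (M.crX p) = M.tangentLift p (M.crY p) := by
  have hpos := one_add_Fu_sq_ne_zero (M := M) p
  have hre (v : ℂ × ℝ) : (M.tangentLift p v).2.re = v.2 := by simp [tangentLift]
  have him (v : ℂ × ℝ) : (M.tangentLift p v).2.im = fderiv ℝ M.F p v := by simp [tangentLift]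
  refine Prod.ext (by simp [tangentLift, crX, crY]) (Complex.ext ?_ ?_)
  · simp only [Prod.smul_snd, smul_eq_mul, Complex.I_mul_re, hre, him, fderiv_F_apply, crX, crY,
      Complex.one_re, Complex.one_im]
    field_simp
    ring
  · simp only [Prod.smul_snd, smul_eq_mul, Complex.I_mul_im, hre, him, fderiv_F_apply, crX, crY,
      Complex.I_re, Complex.I_im]
    field_simp
    ring

theorem crTangent_tangentLift_crX {p : ℂ × ℝ} (hp : p ∈ M.Ω) :
    M.CRTangent p (M.tangentLift p (M.crX p)) := by
  refine ⟨M.fderiv_rho_tangentLift hp _, ?_⟩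
  rw [I_smul_tangentLift_crX]
  exact M.fderiv_rho_tangentLift hp _

theorem fderiv_fderiv_rho {p : ℂ × ℝ} (hp : p ∈ M.Ω) (ξ η : ℂ × ℂ) :
    fderiv ℝ (fderiv ℝ M.rho) (M.point p) ξ η = M.hess p (base ξ) (base η) := by
  have hmem : ∀ᶠ P in 𝓝 (M.point p), base P ∈ M.Ω :=
    base.continuous.continuousAt.eventually (M.isOpen.mem_nhds (by rwa [base_point]))
  have hrho : fderiv ℝ M.rho =ᶠ[𝓝 (M.point p)] fun P => (fderiv ℝ M.F (base P)).comp base -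
      Complex.imCLM.comp (ContinuousLinearMap.snd ℝ ℂ ℂ) :=
    hmem.mono fun P hP => (M.hasFDerivAt_rho hP).fderiv
  have hF : HasFDerivAt (fderiv ℝ M.F) (M.hess p) (base (M.point p)) := by
    rw [base_point]
    exact (M.analytic p hp).fderiv.differentiableAt.hasFDerivAt
  have hFbase : HasFDerivAt (fun P => fderiv ℝ M.F (base P)) ((M.hess p).comp base) (M.point p) :=
    hF.comp _ base.hasFDerivAt
  rw [hrho.fderiv_eq, ((hFbase.clm_comp (hasFDerivAt_const base (M.point p))).sub_const _).fderiv]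
  simp

theorem leviCoeff_ne_zero (hM : M.LeviNondegenerate) {p : ℂ × ℝ} (hp : p ∈ M.Ω) :
    M.leviCoeff p ≠ 0 := by
  have hne : M.tangentLift p (M.crX p) ≠ 0 := fun h => one_ne_zero (congrArg Prod.fst h)
  have hlevi := hM p hp _ (crTangent_tangentLift_crX hp) hne
  rw [leviForm, I_smul_tangentLift_crX, fderiv_fderiv_rho hp, fderiv_fderiv_rho hp,
    base_tangentLift, base_tangentLift] at hlevi
  exact div_ne_zero hlevi four_ne_zero

section Analytic

variable {p₀ : ℂ × ℝ}

theorem analyticAt_Fu (hp : p₀ ∈ M.Ω) : AnalyticAt ℝ M.Fu p₀ :=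
  analyticAt_clm_apply (M.analytic p₀ hp).fderiv analyticAt_const

theorem analyticAt_Fx (hp : p₀ ∈ M.Ω) : AnalyticAt ℝ M.Fx p₀ :=
  analyticAt_clm_apply (M.analytic p₀ hp).fderiv analyticAt_const

theorem analyticAt_Fy (hp : p₀ ∈ M.Ω) : AnalyticAt ℝ M.Fy p₀ :=
  analyticAt_clm_apply (M.analytic p₀ hp).fderiv analyticAt_const

theorem analyticAt_Fz (hp : p₀ ∈ M.Ω) : AnalyticAt ℝ M.Fz p₀ :=
  (((Complex.ofRealCLM.analyticAt _).fun_comp (analyticAt_Fx hp)).sub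
    (((Complex.ofRealCLM.analyticAt _).fun_comp (analyticAt_Fy hp)).mul analyticAt_const)).div
      analyticAt_const two_ne_zero

theorem analyticAt_crX (hp : p₀ ∈ M.Ω) : AnalyticAt ℝ M.crX p₀ :=
  analyticAt_const.prod (((analyticAt_Fy hp).sub ((analyticAt_Fu hp).mul (analyticAt_Fx hp))).div
    (analyticAt_const.add ((analyticAt_Fu hp).pow 2)) (one_add_Fu_sq_ne_zero p₀))

theorem analyticAt_crY (hp : p₀ ∈ M.Ω) : AnalyticAt ℝ M.crY p₀ :=
  analyticAt_const.prod
    (((analyticAt_Fx hp).add ((analyticAt_Fu hp).mul (analyticAt_Fy hp))).neg.div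
      (analyticAt_const.add ((analyticAt_Fu hp).pow 2)) (one_add_Fu_sq_ne_zero p₀))

theorem analyticAt_hess_apply (hp : p₀ ∈ M.Ω) {v w : ℂ × ℝ → ℂ × ℝ} (hv : AnalyticAt ℝ v p₀)
    (hw : AnalyticAt ℝ w p₀) : AnalyticAt ℝ (fun p => M.hess p (v p) (w p)) p₀ :=
  analyticAt_clm_apply (analyticAt_clm_apply (M.analytic p₀ hp).fderiv.fderiv hv) hw

theorem analyticAt_leviCoeff (hp : p₀ ∈ M.Ω) : AnalyticAt ℝ M.leviCoeff p₀ :=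
  ((analyticAt_hess_apply hp (analyticAt_crX hp) (analyticAt_crX hp)).add
    (analyticAt_hess_apply hp (analyticAt_crY hp) (analyticAt_crY hp))).div analyticAt_const
      four_ne_zero

theorem analyticAt_harmCoeff (hp : p₀ ∈ M.Ω) : AnalyticAt ℝ M.harmCoeff p₀ := by
  have hX := analyticAt_crX hp
  have hY := analyticAt_crY hp
  have hdiag := (Complex.ofRealCLM.analyticAt _).fun_comp
    ((analyticAt_hess_apply hp hX hX).fun_sub (analyticAt_hess_apply hp hY hY))
  have hcross := (Complex.ofRealCLM.analyticAt _).fun_comp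
    ((analyticAt_hess_apply hp hX hY).fun_add (analyticAt_hess_apply hp hY hX))
  exact (hdiag.div analyticAt_const (by norm_num)).sub
    ((hcross.mul analyticAt_const).div analyticAt_const (by norm_num))

theorem analyticAt_comp_prodFst {E F G : Type*} [NormedAddCommGroup E] [NormedSpace ℝ E]
    [NormedAddCommGroup F] [NormedSpace ℝ F] [NormedAddCommGroup G] [NormedSpace ℝ G] {f : E → F}
    {x : E} (hf : AnalyticAt ℝ f x) (y : G) :
    AnalyticAt ℝ (fun q : E × G => f q.1) (x, y) :=
  AnalyticAt.fun_comp (f := Prod.fst) (x := (x, y)) hf analyticAt_fst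

theorem analyticAt_quadMap (hp : p₀ ∈ M.Ω) (hM : M.LeviNondegenerate) (Q : ℂ × ℂ) :
    AnalyticAt ℝ (fun x : (ℂ × ℝ) × (ℂ × ℂ) => M.quadMap x.1 x.2) (p₀, Q) := by
  have hFu := analyticAt_comp_prodFst
    ((Complex.ofRealCLM.analyticAt _).fun_comp (analyticAt_Fu hp)) Q
  have hFz := analyticAt_comp_prodFst (analyticAt_Fz hp) Q
  have hharm := analyticAt_comp_prodFst (analyticAt_harmCoeff hp) Q
  have hlevi := analyticAt_comp_prodFst
    ((Complex.ofRealCLM.analyticAt _).fun_comp (analyticAt_leviCoeff hp)) Q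
  have hw : AnalyticAt ℝ (fun x : (ℂ × ℝ) × (ℂ × ℂ) => x.2.2 - (M.point x.1).2) (p₀, Q) :=
    (analyticAt_snd.fun_comp analyticAt_snd).fun_sub
      (analyticAt_comp_prodFst (analyticAt_snd.fun_comp (M.analyticAt_point hp)) Q)
  have hz : AnalyticAt ℝ (fun x : (ℂ × ℝ) × (ℂ × ℂ) => x.2.1 - x.1.1) (p₀, Q) :=
    (analyticAt_fst.fun_comp analyticAt_snd).fun_sub (analyticAt_fst.fun_comp analyticAt_fst)
  exact hz.prod (((((analyticAt_const.sub (hFu.mul analyticAt_const)).mul hw).sub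
    ((analyticAt_const.mul hFz).mul hz)).sub
      ((analyticAt_const.mul hharm).mul (hz.pow 2))).div hlevi
        (Complex.ofReal_ne_zero.2 (leviCoeff_ne_zero hM hp)))

theorem analyticAt_param (hp : p₀ ∈ M.Ω) (q : ℂ × ℝ) :
    AnalyticAt ℝ (fun x : (ℂ × ℝ) × (ℂ × ℝ) => M.param x.1 x.2) (p₀, q) := by
  have hζ : AnalyticAt ℝ (fun x : (ℂ × ℝ) × (ℂ × ℝ) => x.2.1) (p₀, q) :=
    analyticAt_fst.fun_comp analyticAt_snd
  have hs : AnalyticAt ℝ (fun x : (ℂ × ℝ) × (ℂ × ℝ) => x.2.2) (p₀, q) :=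
    analyticAt_snd.fun_comp analyticAt_snd
  have hFu := analyticAt_comp_prodFst (analyticAt_Fu hp) q
  have hlevi := analyticAt_comp_prodFst (analyticAt_leviCoeff hp) q
  have hharm := (analyticAt_comp_prodFst (analyticAt_harmCoeff hp) q).mul (hζ.pow 2)
  have hquad : AnalyticAt ℝ (fun x : (ℂ × ℝ) × (ℂ × ℝ) => M.quadTerm x.1 x.2.1) (p₀, q) :=
    (hlevi.mul (((analyticAt_re_comp hζ).pow 2).add ((analyticAt_im_comp hζ).pow 2))).add
      (analyticAt_const.mul (analyticAt_re_comp hharm))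
  have hshift : AnalyticAt ℝ (fun x : (ℂ × ℝ) × (ℂ × ℝ) => M.paramShift x.1 x.2) (p₀, q) :=
    (((hlevi.mul hs).sub (hFu.mul hquad)).sub (analyticAt_const.mul (analyticAt_im_comp hharm))).div
      (analyticAt_const.add (hFu.pow 2)) (one_add_Fu_sq_ne_zero p₀)
  exact analyticAt_fst.add
    ((((analyticAt_re_comp hζ).smul (analyticAt_comp_prodFst (analyticAt_crX hp) q)).add
      ((analyticAt_im_comp hζ).smul (analyticAt_comp_prodFst (analyticAt_crY hp) q))).add
        (hshift.smul analyticAt_const))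

end Analytic

theorem param_zero (p : ℂ × ℝ) : M.param p 0 = p := by
  simp [param, paramStep, paramShift, quadTerm]

theorem paramStep_fst (p q : ℂ × ℝ) : (M.paramStep p q).1 = q.1 := by
  simp [paramStep, crX, crY]

theorem param_fst_sub (p q : ℂ × ℝ) : (M.param p q).1 - p.1 = q.1 := by
  rw [param, Prod.fst_add, paramStep_fst, add_sub_cancel_left]

theorem one_add_Fu_sq_mul_paramStep_snd (p q : ℂ × ℝ) :
    (1 + M.Fu p ^ 2) * (M.paramStep p q).2 = q.1.re * (M.Fy p - M.Fu p * M.Fx p) -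
      q.1.im * (M.Fx p + M.Fu p * M.Fy p) + (M.leviCoeff p * q.2 - M.Fu p * M.quadTerm p q.1 -
      2 * (M.harmCoeff p * q.1 ^ 2).im) := by
  have hpos := one_add_Fu_sq_ne_zero (M := M) p
  simp only [paramStep, paramShift, crX, crY, Prod.snd_add, Prod.smul_snd, smul_eq_mul, mul_one]
  field_simp
  ring

theorem weightedO_paramShift (p : ℂ × ℝ) : WeightedO 2 (M.paramShift p) := by
  have hharm : WeightedO 2 fun q : ℂ × ℝ => M.harmCoeff p * q.1 ^ 2 :=
    (weightedO_fst.pow 2).const_mul _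
  have hnorm : WeightedO 2 fun q : ℂ × ℝ => q.1.re ^ 2 + q.1.im ^ 2 :=
    (weightedO_fst.re.pow 2).add (weightedO_fst.im.pow 2)
  have hquad : WeightedO 2 fun q : ℂ × ℝ => M.quadTerm p q.1 :=
    (hnorm.const_mul _).add (hharm.re.const_mul 2)
  exact ((((weightedO_snd.const_mul (M.leviCoeff p)).sub (hquad.const_mul (M.Fu p))).sub
    (hharm.im.const_mul 2)).const_mul (1 + M.Fu p ^ 2)⁻¹).congr fun q =>
      (div_eq_inv_mul _ _).symm

theorem weightedO_paramStep (p : ℂ × ℝ) : WeightedO 1 (M.paramStep p) := by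
  have hsmul {f : ℂ × ℝ → ℝ} (v : ℂ × ℝ) (hf : WeightedO 1 f) : WeightedO 1 fun q => f q • v :=
    (hf.const_mul ‖v‖).of_norm_le fun q => by rw [norm_smul, norm_mul, norm_norm, mul_comm]
  exact ((hsmul _ weightedO_fst.re).add (hsmul _ weightedO_fst.im)).add
    (hsmul _ ((weightedO_paramShift p).mono one_le_two))

theorem quadTerm_eq (p : ℂ × ℝ) (ζ : ℂ) : M.quadTerm p ζ =
    M.hess p (ζ.re • M.crX p + ζ.im • M.crY p) (ζ.re • M.crX p + ζ.im • M.crY p) / 2 := by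
  simp only [quadTerm, harmCoeff, leviCoeff, map_add, map_smul, add_apply, smul_apply, smul_eq_mul]
  simp [pow_two]
  ring

theorem weightedO_hess_paramStep_sub (p : ℂ × ℝ) :
    WeightedO 3 fun q => M.hess p (M.paramStep p q) (M.paramStep p q) / 2 - M.quadTerm p q.1 := by
  have hx : WeightedO 3 fun q => M.paramShift p q * q.1.re :=
    (weightedO_paramShift p).mul weightedO_fst.re
  have hy : WeightedO 3 fun q => M.paramShift p q * q.1.im :=
    (weightedO_paramShift p).mul weightedO_fst.im
  have hs : WeightedO 3 fun q => M.paramShift p q * M.paramShift p q :=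
    ((weightedO_paramShift p).mul (weightedO_paramShift p)).mono (by norm_num)
  refine (((hx.const_mul ((M.hess p (M.crX p) (0, 1) + M.hess p (0, 1) (M.crX p)) / 2)).add
    (hy.const_mul ((M.hess p (M.crY p) (0, 1) + M.hess p (0, 1) (M.crY p)) / 2))).add
    (hs.const_mul (M.hess p (0, 1) (0, 1) / 2))).congr fun q => ?_
  simp only [quadTerm_eq, paramStep, map_add, map_smul, add_apply, smul_apply, smul_eq_mul]
  ring

theorem weightedO_paramRemainder {p : ℂ × ℝ} (hp : p ∈ M.Ω) : WeightedO 3 (M.paramRemainder p) := by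
  have hstep := weightedO_paramStep (M := M) p
  have hlim : Tendsto (M.paramStep p) (𝓝 0) (𝓝 0) :=
    IsBigO.trans_tendsto hstep (by simpa using tendsto_weightedNorm)
  have htaylor : WeightedO 3 fun q => M.F (p + M.paramStep p q) - M.F p -
      fderiv ℝ M.F p (M.paramStep p q) -
      (1 / 2 : ℝ) • M.hess p (M.paramStep p q) (M.paramStep p q) :=
    ((isBigO_sub_taylor_two (M.analytic p hp)).comp_tendsto hlim).trans
      (WeightedO.pow (IsBigO.norm_left hstep) 3)
  refine (htaylor.add (weightedO_hess_paramStep_sub (M := M) p)).congr fun q => ?_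
  simp only [paramRemainder, param, smul_eq_mul]
  ring

theorem point_param_snd_sub (p q : ℂ × ℝ) :
    (M.point (M.param p q)).2 - (M.point p).2 = (M.paramStep p q).2 +
      ((M.paramRemainder p q + (q.1.re * M.Fx p + q.1.im * M.Fy p + (M.paramStep p q).2 * M.Fu p) +
        M.quadTerm p q.1 : ℝ) : ℂ) * Complex.I := by
  rw [← paramStep_fst (M := M) p q, ← fderiv_F_apply, paramStep_fst]
  simp only [point, paramRemainder, param, Prod.snd_add]
  push_cast
  ring

theorem quadMap_point_param_snd_sub (hM : M.LeviNondegenerate) {p : ℂ × ℝ} (hp : p ∈ M.Ω)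
    (q : ℂ × ℝ) : (M.quadMap p (M.point (M.param p q))).2 - (quadricPoint q).2 =
      (M.Fu p + Complex.I) / M.leviCoeff p * (M.paramRemainder p q : ℂ) := by
  have hlevi : (M.leviCoeff p : ℂ) ≠ 0 := Complex.ofReal_ne_zero.2 (leviCoeff_ne_zero hM hp)
  have hz : (M.point (M.param p q)).1 - p.1 = q.1 := param_fst_sub p q
  have hu := one_add_Fu_sq_mul_paramStep_snd (M := M) p q
  simp only [quadMap]
  rw [hz, point_param_snd_sub, div_sub' hlevi, div_mul_eq_mul_div]
  congr 1
  apply Complex.ext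
  · simp [quadricPoint, Fz, pow_two, quadTerm] at hu ⊢
    linear_combination hu
  · simp [quadricPoint, Fz, pow_two, quadTerm]
    ring

theorem isNearQuadric_quadMap (hM : M.LeviNondegenerate) {p : ℂ × ℝ} (hp : p ∈ M.Ω) :
    IsNearQuadric 3 fun q => M.quadMap p (M.point (M.param p q)) := by
  have hfst (q : ℂ × ℝ) : (M.quadMap p (M.point (M.param p q))).1 = q.1 := param_fst_sub p q
  have hsnd : WeightedO 3 fun q =>
      (M.quadMap p (M.point (M.param p q))).2 - (quadricPoint q).2 :=
    ((weightedO_paramRemainder hp).ofReal.const_mul _).congr fun q =>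
      (quadMap_point_param_snd_sub hM hp q).symm
  refine ⟨WeightedO.zero.congr fun q => ?_, hsnd, hsnd.im.congr fun q => ?_⟩
  · rw [hfst, sub_self]
  · rw [hfst]
    simp [quadricPoint, Complex.sq_norm, Complex.normSq_apply]

theorem differentiable_quadMap (p : ℂ × ℝ) : Differentiable ℂ (M.quadMap p) := by
  unfold quadMap
  fun_prop

theorem exists_analytic_normalizing (hM : M.LeviNondegenerate) {p₀ : ℂ × ℝ} (hp : p₀ ∈ M.Ω) :
    ∃ Φ : ℂ × ℝ → ℂ × ℂ → ℂ × ℂ,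
      AnalyticAt ℝ (fun x : (ℂ × ℝ) × (ℂ × ℝ) => Φ x.1 (M.point x.2)) (p₀, p₀) ∧
      ∀ᶠ p in 𝓝 p₀, ∃ e : OpenPartialHomeomorph (ℂ × ℂ) (ℂ × ℂ),
        (e : ℂ × ℂ → ℂ × ℂ) = Φ p ∧ M.IsNormalizing p e := by
  have hpoint : AnalyticAt ℝ M.point (M.param p₀ 0) := by
    rw [param_zero]
    exact M.analyticAt_point hp
  have hquad {f : (ℂ × ℝ) × (ℂ × ℝ) → ℂ × ℂ} {q : ℂ × ℝ} (hf : AnalyticAt ℝ f (p₀, q)) :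
      AnalyticAt ℝ (fun x : (ℂ × ℝ) × (ℂ × ℝ) => M.quadMap x.1 (f x)) (p₀, q) :=
    AnalyticAt.fun_comp (g := fun x : (ℂ × ℝ) × (ℂ × ℂ) => M.quadMap x.1 x.2)
      (f := fun x => (x.1, f x)) (analyticAt_quadMap hp hM _) (analyticAt_fst.prod hf)
  have hΩ : ∀ᶠ p in 𝓝 p₀, p ∈ M.Ω := M.isOpen.mem_nhds hp
  obtain ⟨S, hSdiff, hSan, hSnear⟩ := exists_normalizing_family
    (X := fun p q => M.quadMap p (M.point (M.param p q)))
    (hquad (AnalyticAt.fun_comp (g := M.point) hpoint (analyticAt_param hp 0)))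
    (hΩ.mono fun p hp => isNearQuadric_quadMap hM hp) (l := 6) (by norm_num) le_rfl
  refine ⟨fun p P => S p (M.quadMap p P), ?_, ?_⟩
  · exact AnalyticAt.fun_comp (g := fun x : (ℂ × ℝ) × (ℂ × ℂ) => S x.1 x.2)
      (f := fun x : (ℂ × ℝ) × (ℂ × ℝ) => (x.1, M.quadMap x.1 (M.point x.2))) (hSan _)
      (analyticAt_fst.prod
        (hquad (AnalyticAt.fun_comp (g := M.point) (M.analyticAt_point hp) analyticAt_snd)))
  · filter_upwards [hΩ, hSnear] with p hp_mem hnear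
    have hparam : AnalyticAt ℝ (M.param p) 0 :=
      AnalyticAt.fun_comp (g := fun x : (ℂ × ℝ) × (ℂ × ℝ) => M.param x.1 x.2)
        (f := fun q : ℂ × ℝ => (p, q)) (analyticAt_param hp_mem 0)
        (analyticAt_const.prod analyticAt_id)
    have hholo : Differentiable ℂ fun P => S p (M.quadMap p P) :=
      (hSdiff p).comp (differentiable_quadMap p)
    have hnormalizing := M.exists_isNormalizing_of_isNearQuadric (par := M.param p)
      (by rwa [param_zero]) hparam
      (analyticAt_prod_of_differentiableOn isOpen_univ hholo.differentiableOn (mem_univ _)) hnear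
    rwa [param_zero] at hnormalizing

end AnalyticGraph

/-! ### Coefficients of a map preserving the hyperquadric to weight five -/

section Coefficients

open scoped ComplexConjugate

theorem eq_zero_of_re_linear {a : ℂ} (h : ∀ z : ℂ, (a * z).re = 0) : a = 0 :=
  Complex.ext (by simpa using h 1) (by simpa using h Complex.I)

theorem eq_zero_of_re_quadratic {a : ℂ} {c : ℝ}
    (h : ∀ z : ℂ, (a * z ^ 2).re + c * Complex.normSq z = 0) : a = 0 ∧ c = 0 := by
  have h₁ := h 1
  have h₂ := h Complex.I
  have h₃ := h (1 + Complex.I)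
  simp only [pow_two, Complex.normSq_apply, Complex.mul_re, Complex.mul_im, Complex.add_re,
    Complex.add_im, Complex.one_re, Complex.one_im, Complex.I_re, Complex.I_im] at h₁ h₂ h₃
  exact ⟨Complex.ext (by simp only [Complex.zero_re]; linarith)
    (by simp only [Complex.zero_im]; linarith), by linarith⟩

theorem eq_zero_of_re_cubic {a b : ℂ}
    (h : ∀ z : ℂ, (a * z ^ 3 + b * (z ^ 2 * conj z)).re = 0) : a = 0 ∧ b = 0 := by
  have h₁ := h 1
  have h₂ := h Complex.I
  have h₃ := h (1 + Complex.I)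
  have h₄ := h (1 - Complex.I)
  simp only [pow_succ, pow_zero, one_mul, Complex.mul_re, Complex.mul_im, Complex.add_re,
    Complex.add_im, Complex.sub_re, Complex.sub_im, Complex.conj_re, Complex.conj_im,
    Complex.one_re, Complex.one_im, Complex.I_re, Complex.I_im] at h₁ h₂ h₃ h₄
  refine ⟨Complex.ext ?_ ?_, Complex.ext ?_ ?_⟩ <;>
    simp only [Complex.zero_re, Complex.zero_im] <;> linarith

theorem eq_zero_of_re_quartic {a b : ℂ} {c : ℝ}
    (h : ∀ z : ℂ, (a * z ^ 4 + b * (z ^ 3 * conj z)).re + c * Complex.normSq z ^ 2 = 0) :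
    b = 0 ∧ c = 0 := by
  have h₁ := h 1
  have h₂ := h Complex.I
  have h₃ := h (1 + Complex.I)
  have h₄ := h (1 - Complex.I)
  simp only [pow_succ, pow_zero, one_mul, Complex.normSq_apply, Complex.mul_re, Complex.mul_im,
    Complex.add_re, Complex.add_im, Complex.sub_re, Complex.sub_im, Complex.conj_re,
    Complex.conj_im, Complex.one_re, Complex.one_im, Complex.I_re, Complex.I_im] at h₁ h₂ h₃ h₄
  exact ⟨Complex.ext (by simp only [Complex.zero_re]; linarith)
    (by simp only [Complex.zero_im]; linarith), by linarith⟩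

theorem eq_zero_of_re_quintic {a b c : ℂ}
    (h : ∀ z : ℂ, (a * z ^ 5 + b * (z ^ 4 * conj z) + c * (z ^ 3 * conj z ^ 2)).re = 0) :
    c = 0 := by
  have h₁ := h 1
  have h₂ := h Complex.I
  have h₃ := h (1 + Complex.I)
  have h₄ := h (1 - Complex.I)
  have h₅ := h (2 + Complex.I)
  have h₆ := h (1 + 2 * Complex.I)
  simp only [pow_succ, pow_zero, one_mul, Complex.mul_re, Complex.mul_im, Complex.add_re,
    Complex.add_im, Complex.sub_re, Complex.sub_im, Complex.conj_re, Complex.conj_im,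
    Complex.one_re, Complex.one_im, Complex.I_re, Complex.I_im, Complex.re_ofNat,
    Complex.im_ofNat] at h₁ h₂ h₃ h₄ h₅ h₆
  refine Complex.ext ?_ ?_ <;> simp only [Complex.zero_re, Complex.zero_im] <;> linarith

theorem complexPoly_zero (a : ℕ × ℕ → ℂ) (P : ℂ × ℂ) : complexPoly 0 a P = a (0, 0) := by
  have hfilter : (Finset.range 1 ×ˢ Finset.range 1).filter (fun i => i.1 + 2 * i.2 = 0) =
      {(0, 0)} := by decide
  rw [complexPoly, hfilter]
  simp

theorem complexPoly_one (a : ℕ × ℕ → ℂ) (P : ℂ × ℂ) : complexPoly 1 a P = a (1, 0) * P.1 := by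
  have hfilter : (Finset.range 2 ×ˢ Finset.range 2).filter (fun i => i.1 + 2 * i.2 = 1) =
      {(1, 0)} := by decide
  rw [complexPoly, hfilter]
  simp

/-- The part of weight `m` of the equation `Im g = f f̄` on the hyperquadric, for the formal map
`(f, g)` with the given coefficients. -/
def PreservesQuadricInWeight (m : ℕ) (f g : ℕ × ℕ → ℂ) : Prop :=
  ∀ q : ℂ × ℝ, (complexPoly m g (quadricPoint q)).im = ∑ i ∈ Finset.HasAntidiagonal.antidiagonal m,
    (complexPoly i.1 f (quadricPoint q) * conj (complexPoly i.2 f (quadricPoint q))).re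

/-- The relations between the low order coefficients of a map `(f, g)` preserving the hyperquadric
to weight five; each is named after the coefficient which it determines. -/
structure JetRelations (f g : ℕ × ℕ → ℂ) : Prop where
  g01_im : (g (0, 1)).im = 0
  g01_re : (g (0, 1)).re = Complex.normSq (f (1, 0))
  g20 : g (2, 0) = 0
  g11 : -Complex.I * g (1, 1) - 2 * f (1, 0) * conj (f (0, 1)) = 0
  f20 : g (1, 1) - 2 * conj (f (1, 0)) * f (2, 0) + 2 * Complex.I * f (1, 0) * conj (f (0, 1)) = 0
  g02_im : (g (0, 2)).im = Complex.normSq (f (0, 1))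
  g21 : -Complex.I * g (2, 1) - 2 * f (2, 0) * conj (f (0, 1)) = 0
  f11_re : 2 * (g (0, 2)).re - 2 * (f (1, 0) * conj (f (1, 1))).re = 0
  f30 : g (2, 1) + 2 * Complex.I * f (2, 0) * conj (f (0, 1)) - 2 * conj (f (1, 0)) * f (3, 0) = 0
  f11_im : -(g (0, 2)).im - Complex.normSq (f (2, 0)) - Complex.normSq (f (0, 1)) -
    2 * (f (1, 0) * conj (f (1, 1))).im = 0
  g12 : -Complex.I * g (1, 2) - 2 * f (1, 0) * conj (f (0, 2)) - 2 * conj (f (0, 1)) * f (1, 1) = 0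
  f21 : 2 * g (1, 2) - 2 * conj (f (1, 0)) * f (2, 1) + 4 * Complex.I * f (1, 0) * conj (f (0, 2)) -
    2 * f (2, 0) * conj (f (1, 1)) = 0
  f02 : Complex.I * g (1, 2) - 2 * Complex.I * conj (f (1, 0)) * f (2, 1) +
    2 * f (1, 0) * conj (f (0, 2)) + 2 * Complex.I * f (2, 0) * conj (f (1, 1)) -
    2 * conj (f (2, 0)) * f (3, 0) - 2 * conj (f (0, 1)) * f (1, 1) = 0

namespace PreservesQuadricInWeight

variable {f g : ℕ × ℕ → ℂ}

theorem one (h : PreservesQuadricInWeight 1 f g) (hf : f (0, 0) = 0) : g (1, 0) = 0 := by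
  have hre : -Complex.I * g (1, 0) = 0 := eq_zero_of_re_linear fun z => by
    simpa [Finset.Nat.sum_antidiagonal_eq_sum_range_succ_mk, Finset.sum_range_succ,
      complexPoly_zero, complexPoly_one, hf, quadricPoint] using h (z, 0)
  simpa using hre

theorem two (h : PreservesQuadricInWeight 2 f g) (hf : f (0, 0) = 0) :
    (g (0, 1)).im = 0 ∧ (g (0, 1)).re = Complex.normSq (f (1, 0)) ∧ g (2, 0) = 0 := by
  simp only [PreservesQuadricInWeight, Finset.Nat.sum_antidiagonal_eq_sum_range_succ_mk,
    Finset.sum_range_succ, Finset.sum_range_zero, complexPoly_zero, complexPoly_one,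
    complexPoly_two, hf, quadricPoint, Nat.reduceSub] at h
  obtain ⟨hg20, hg01⟩ := eq_zero_of_re_quadratic (a := -Complex.I * g (2, 0))
    (c := (g (0, 1)).re - Complex.normSq (f (1, 0))) fun z => by
      have h₀ := h (z, 0)
      simp [pow_succ, Complex.normSq_apply] at h₀ ⊢
      linear_combination h₀
  exact ⟨by simpa using h (0, 1), sub_eq_zero.1 hg01, by simpa using hg20⟩

theorem three (h : PreservesQuadricInWeight 3 f g) (hf : f (0, 0) = 0) :
    -Complex.I * g (1, 1) - 2 * f (1, 0) * conj (f (0, 1)) = 0 ∧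
      g (1, 1) - 2 * conj (f (1, 0)) * f (2, 0) +
        2 * Complex.I * f (1, 0) * conj (f (0, 1)) = 0 := by
  simp only [PreservesQuadricInWeight, Finset.Nat.sum_antidiagonal_eq_sum_range_succ_mk,
    Finset.sum_range_succ, Finset.sum_range_zero, complexPoly_zero, complexPoly_one,
    complexPoly_two, complexPoly_three, hf, quadricPoint, Nat.reduceSub] at h
  refine ⟨eq_zero_of_re_linear fun z => ?_,
    (eq_zero_of_re_cubic (a := -Complex.I * g (3, 0)) fun z => ?_).2⟩
  · have h₀ := h (z, 0)
    have h₁ := h (z, 1)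
    simp [pow_succ] at h₀ h₁ ⊢
    linear_combination h₁ - h₀
  · have h₀ := h (z, 0)
    simp [pow_succ] at h₀ ⊢
    linear_combination h₀

theorem four (h : PreservesQuadricInWeight 4 f g) (hf : f (0, 0) = 0) :
    (g (0, 2)).im = Complex.normSq (f (0, 1)) ∧
      -Complex.I * g (2, 1) - 2 * f (2, 0) * conj (f (0, 1)) = 0 ∧
      2 * (g (0, 2)).re - 2 * (f (1, 0) * conj (f (1, 1))).re = 0 ∧
      g (2, 1) + 2 * Complex.I * f (2, 0) * conj (f (0, 1)) -
        2 * conj (f (1, 0)) * f (3, 0) = 0 ∧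
      -(g (0, 2)).im - Complex.normSq (f (2, 0)) - Complex.normSq (f (0, 1)) -
        2 * (f (1, 0) * conj (f (1, 1))).im = 0 := by
  simp only [PreservesQuadricInWeight, Finset.Nat.sum_antidiagonal_eq_sum_range_succ_mk,
    Finset.sum_range_succ, Finset.sum_range_zero, complexPoly_zero, complexPoly_one,
    complexPoly_two, complexPoly_three, complexPoly_four, hf, quadricPoint, Nat.reduceSub] at h
  obtain ⟨hz₂, hu⟩ := eq_zero_of_re_quadratic
    (a := -Complex.I * g (2, 1) - 2 * f (2, 0) * conj (f (0, 1)))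
    (c := 2 * (g (0, 2)).re - 2 * (f (1, 0) * conj (f (1, 1))).re) fun z => by
      have h₁ := h (z, 1)
      have h₂ := h (z, -1)
      simp [pow_succ, Complex.normSq_apply] at h₁ h₂ ⊢
      linear_combination (h₁ - h₂) / 2
  obtain ⟨hz₃, hzz⟩ := eq_zero_of_re_quartic (a := -Complex.I * g (4, 0))
    (b := g (2, 1) + 2 * Complex.I * f (2, 0) * conj (f (0, 1)) - 2 * conj (f (1, 0)) * f (3, 0))
    (c := -(g (0, 2)).im - Complex.normSq (f (2, 0)) - Complex.normSq (f (0, 1)) -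
      2 * (f (1, 0) * conj (f (1, 1))).im) fun z => by
      have h₀ := h (z, 0)
      simp [pow_succ, Complex.normSq_apply] at h₀ ⊢
      linear_combination h₀
  have h₁ := h (0, 1)
  exact ⟨by simpa [Complex.normSq_apply] using h₁, hz₂, hu, hz₃, hzz⟩

theorem five (h : PreservesQuadricInWeight 5 f g) (hf : f (0, 0) = 0) :
    -Complex.I * g (1, 2) - 2 * f (1, 0) * conj (f (0, 2)) -
        2 * conj (f (0, 1)) * f (1, 1) = 0 ∧
      2 * g (1, 2) - 2 * conj (f (1, 0)) * f (2, 1) +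
        4 * Complex.I * f (1, 0) * conj (f (0, 2)) - 2 * f (2, 0) * conj (f (1, 1)) = 0 ∧
      Complex.I * g (1, 2) - 2 * Complex.I * conj (f (1, 0)) * f (2, 1) +
        2 * f (1, 0) * conj (f (0, 2)) + 2 * Complex.I * f (2, 0) * conj (f (1, 1)) -
        2 * conj (f (2, 0)) * f (3, 0) - 2 * conj (f (0, 1)) * f (1, 1) = 0 := by
  simp only [PreservesQuadricInWeight, Finset.Nat.sum_antidiagonal_eq_sum_range_succ_mk,
    Finset.sum_range_succ, Finset.sum_range_zero, complexPoly_zero, complexPoly_one,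
    complexPoly_two, complexPoly_three, complexPoly_four, complexPoly_five, hf, quadricPoint,
    Nat.reduceSub] at h
  refine ⟨eq_zero_of_re_linear fun z => ?_,
    (eq_zero_of_re_cubic (a := -Complex.I * g (3, 1) - 2 * conj (f (0, 1)) * f (3, 0))
      fun z => ?_).2,
    eq_zero_of_re_quintic (a := -Complex.I * g (5, 0))
      (b := g (3, 1) - 2 * conj (f (1, 0)) * f (4, 0) +
        2 * Complex.I * f (3, 0) * conj (f (0, 1))) fun z => ?_⟩
  · have h₀ := h (z, 0)
    have h₁ := h (z, 1)
    have h₂ := h (z, -1)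
    simp [pow_succ] at h₀ h₁ h₂ ⊢
    linear_combination (h₁ + h₂) / 2 - h₀
  · have h₁ := h (z, 1)
    have h₂ := h (z, -1)
    simp [pow_succ] at h₁ h₂ ⊢
    linear_combination (h₁ - h₂) / 2
  · have h₀ := h (z, 0)
    simp [pow_succ] at h₀ ⊢
    linear_combination h₀

end PreservesQuadricInWeight

namespace JetRelations

variable {f g : ℕ × ℕ → ℂ}

theorem of_preservesQuadricInWeight (hf : f (0, 0) = 0)
    (h : ∀ m < 6, PreservesQuadricInWeight m f g) : JetRelations f g := by
  obtain ⟨g01_im, g01_re, g20⟩ := (h 2 (by norm_num)).two hf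
  obtain ⟨g11, f20⟩ := (h 3 (by norm_num)).three hf
  obtain ⟨g02_im, g21, f11_re, f30, f11_im⟩ := (h 4 (by norm_num)).four hf
  obtain ⟨g12, f21, f02⟩ := (h 5 (by norm_num)).five hf
  exact { g01_im, g01_re, g20, g11, f20, g02_im, g21, f11_re, f30, f11_im, g12, f21, f02 }

/-! The solution is, up to the order considered, the automorphism
`(z, w) ↦ (λ (z + a w), |λ|² w) / (1 - 2 i ā z - (r + i |a|²) w)` of the hyperquadric. -/

variable {a : ℂ} {r : ℝ}

theorem g11_eq (h : JetRelations f g) (ha : f (0, 1) = f (1, 0) * a) :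
    g (1, 1) = 2 * Complex.I * (f (1, 0) * conj (f (1, 0))) * conj a := by
  have hg := h.g11
  rw [ha, map_mul] at hg
  linear_combination Complex.I * hg + g (1, 1) * Complex.I_sq

theorem f20_eq (h : JetRelations f g) (hf : f (1, 0) ≠ 0) (ha : f (0, 1) = f (1, 0) * a) :
    f (2, 0) = 2 * Complex.I * f (1, 0) * conj a := by
  have hf20 := h.f20
  rw [ha, map_mul, h.g11_eq ha] at hf20
  exact mul_left_cancel₀ ((map_ne_zero conj).2 hf) (by linear_combination -hf20 / 2)

theorem f30_eq (h : JetRelations f g) (hf : f (1, 0) ≠ 0) (ha : f (0, 1) = f (1, 0) * a) :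
    f (3, 0) = -4 * f (1, 0) * conj a ^ 2 := by
  have hg21 : g (2, 1) = 2 * Complex.I * f (2, 0) * conj (f (0, 1)) := by
    linear_combination Complex.I * h.g21 + g (2, 1) * Complex.I_sq
  have hf30 := h.f30
  rw [hg21, ha, map_mul, h.f20_eq hf ha] at hf30
  refine mul_left_cancel₀ ((map_ne_zero conj).2 hf) ?_
  linear_combination -hf30 / 2 + 4 * f (1, 0) * conj (f (1, 0)) * conj a ^ 2 * Complex.I_sq

theorem f11_eq (h : JetRelations f g) (hf : f (1, 0) ≠ 0) (ha : f (0, 1) = f (1, 0) * a)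
    (hr : (g (0, 2)).re = Complex.normSq (f (1, 0)) * r) :
    f (1, 1) = f (1, 0) * (r + 3 * Complex.I * (a * conj a)) := by
  have hre := h.f11_re
  have him := h.f11_im
  rw [hr] at hre
  rw [h.g02_im, ha, h.f20_eq hf ha, Complex.normSq_mul, Complex.normSq_mul, Complex.normSq_mul,
    Complex.normSq_mul, Complex.normSq_I, Complex.normSq_conj, Complex.normSq_ofNat] at him
  have hconj : f (1, 0) * conj (f (1, 1)) =
      f (1, 0) * conj (f (1, 0)) * (r - 3 * Complex.I * (a * conj a)) := by
    rw [Complex.mul_conj (f (1, 0)), Complex.mul_conj a]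
    apply Complex.ext
    · simp only [Complex.sub_re, Complex.ofReal_re, Complex.ofReal_im,
        Complex.mul_re, Complex.mul_im, Complex.I_re, Complex.I_im, Complex.re_ofNat,
        Complex.im_ofNat] at hre ⊢
      linarith
    · simp only [Complex.sub_im, Complex.ofReal_re, Complex.ofReal_im,
        Complex.mul_re, Complex.mul_im, Complex.I_re, Complex.I_im, Complex.re_ofNat,
        Complex.im_ofNat] at him ⊢
      linarith
  have hconj' := congrArg conj (mul_left_cancel₀ hf (hconj.trans (mul_assoc _ _ _)))
  simp only [map_mul, map_sub, Complex.conj_conj, Complex.conj_ofReal, Complex.conj_I,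
    Complex.conj_ofNat] at hconj'
  linear_combination hconj'

theorem f02_eq (h : JetRelations f g) (hf : f (1, 0) ≠ 0) (ha : f (0, 1) = f (1, 0) * a)
    (hr : (g (0, 2)).re = Complex.normSq (f (1, 0)) * r) :
    f (0, 2) = f (1, 0) * a * (r + Complex.I * (a * conj a)) := by
  have helim : 8 * f (1, 0) * conj (f (0, 2)) + 4 * Complex.I * f (2, 0) * conj (f (1, 1)) -
      2 * conj (f (2, 0)) * f (3, 0) = 0 := by
    linear_combination h.f02 - Complex.I * h.f21 - h.g12 +
      4 * f (1, 0) * conj (f (0, 2)) * Complex.I_sq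
  have hconj := congrArg conj helim
  rw [h.f20_eq hf ha, h.f30_eq hf ha, h.f11_eq hf ha hr] at hconj
  simp only [map_mul, map_sub, map_add, Complex.conj_conj, Complex.conj_ofReal, Complex.conj_I,
    Complex.conj_ofNat, map_pow, map_neg, map_zero] at hconj
  refine mul_left_cancel₀ ((map_ne_zero conj).2 hf) ?_
  linear_combination hconj / 8 - conj (f (1, 0)) * f (1, 0) * a *
    (r + 3 * Complex.I * (a * conj a)) * Complex.I_sq

theorem two_mul_re_eq (h : JetRelations f g) (ha : f (0, 1) = f (1, 0) * a)
    (hr : (g (0, 2)).re = Complex.normSq (f (1, 0)) * r) (z : ℂ) :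
    ((2 * (g (1, 1) * z + g (0, 2)).re : ℝ) : ℂ) = 2 * (f (1, 0) * conj (f (1, 0))) *
      (Complex.I * conj a * z - Complex.I * a * conj z + r) := by
  have hre : (2 : ℂ) * ((g (1, 1) * z).re : ℂ) = g (1, 1) * z + conj (g (1, 1) * z) := by
    rw [Complex.add_conj, Complex.ofReal_mul, Complex.ofReal_ofNat]
  rw [Complex.add_re, hr, mul_add, Complex.ofReal_add, Complex.ofReal_mul, Complex.ofReal_mul,
    Complex.ofReal_mul, Complex.ofReal_ofNat, hre, h.g11_eq ha, ← Complex.mul_conj]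
  simp only [map_mul, Complex.conj_conj, Complex.conj_I, Complex.conj_ofNat]
  ring

/-- The image of a 2-jet `z₂ = 2 i z z̄ z` of `Σ₀` under a map with the given coefficients satisfies
the same equation, here multiplied by `|λ|²` to clear denominators. -/
theorem jet_identity (h : JetRelations f g) (hf : f (1, 0) ≠ 0) (z : ℂ) :
    f (1, 0) * conj (f (1, 0)) * (f (1, 0) * (2 * Complex.I * (z * conj z) * z) +
      2 * (Complex.I * f (0, 1) * (z * conj z) + f (2, 0) * z ^ 2 + f (1, 1) * z + f (0, 2))) -
      ((2 * (g (1, 1) * z + g (0, 2)).re : ℝ) : ℂ) * (f (1, 0) * z + f (0, 1)) =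
    2 * Complex.I * ((f (1, 0) * z + f (0, 1)) * conj (f (1, 0) * z + f (0, 1))) *
      (f (1, 0) * z + f (0, 1)) := by
  obtain ⟨a, ha⟩ : ∃ a, f (0, 1) = f (1, 0) * a := ⟨f (0, 1) / f (1, 0), by field_simp⟩
  obtain ⟨r, hr⟩ : ∃ r : ℝ, (g (0, 2)).re = Complex.normSq (f (1, 0)) * r :=
    ⟨_, (mul_div_cancel₀ _ (Complex.normSq_pos.2 hf).ne').symm⟩
  rw [h.two_mul_re_eq ha hr, h.f20_eq hf ha, h.f11_eq hf ha hr, h.f02_eq hf ha hr, ha]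
  simp only [map_mul, map_add]
  ring

end JetRelations

end Coefficients

/-! ### Expansion of a holomorphic function along a normalized hypersurface -/

section Expansion

open scoped ComplexConjugate

theorem normSq_sum_mul_pow (F : ℕ → ℂ) (n : ℕ) (t : ℝ) :
    Complex.normSq (∑ m ∈ Finset.range n, F m * (t : ℂ) ^ m) =
      ∑ i ∈ Finset.range n ×ˢ Finset.range n,
        (F i.1 * conj (F i.2)).re * t ^ (i.1 + i.2) := by
  rw [← Complex.ofReal_re (Complex.normSq _), ← Complex.mul_conj, map_sum, Finset.sum_mul_sum,
    ← Finset.sum_product', Complex.re_sum]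
  refine Finset.sum_congr rfl fun i _ => ?_
  rw [← Complex.re_mul_ofReal, Complex.ofReal_pow, map_mul, map_pow, Complex.conj_ofReal, pow_add,
    mul_mul_mul_comm]

theorem im_sum_mul_pow (G : ℕ → ℂ) (n : ℕ) (t : ℝ) :
    (∑ m ∈ Finset.range n, G m * (t : ℂ) ^ m).im = ∑ m ∈ Finset.range n, (G m).im * t ^ m := by
  simp only [← Complex.ofReal_pow, Complex.im_sum, Complex.im_mul_ofReal]

theorem im_eq_sum_antidiagonal_of_isBigO {n : ℕ} {F G : ℕ → ℂ}
    (h : (fun t : ℝ => (∑ m ∈ Finset.range n, G m * (t : ℂ) ^ m).im -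
      Complex.normSq (∑ m ∈ Finset.range n, F m * (t : ℂ) ^ m)) =O[𝓝[>] 0] fun t : ℝ => t ^ n)
    {m : ℕ} (hm : m < n) :
    (G m).im = ∑ i ∈ Finset.HasAntidiagonal.antidiagonal m, (F i.1 * conj (F i.2)).re := by
  let pairs (m : ℕ) : Finset (ℕ × ℕ) :=
    (Finset.range n ×ˢ Finset.range n).filter fun i => i.1 + i.2 = m
  let c (m : ℕ) : ℝ :=
    (if m < n then (G m).im else 0) - ∑ i ∈ pairs m, (F i.1 * conj (F i.2)).re
  have hc : ∀ t : ℝ, (∑ m ∈ Finset.range n, G m * (t : ℂ) ^ m).im -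
      Complex.normSq (∑ m ∈ Finset.range n, F m * (t : ℂ) ^ m) =
        ∑ m ∈ Finset.range (2 * n), c m * t ^ m := by
    intro t
    simp only [c, sub_mul, Finset.sum_sub_distrib]
    rw [im_sum_mul_pow, normSq_sum_mul_pow]
    congr 1
    · simp only [ite_mul, zero_mul]
      rw [← Finset.sum_filter]
      refine Finset.sum_congr (Finset.ext fun m => ?_) fun _ _ => rfl
      simp only [Finset.mem_filter, Finset.mem_range]
      omega
    · rw [← Finset.sum_fiberwise_of_maps_to (t := Finset.range (2 * n))
        (g := fun i : ℕ × ℕ => i.1 + i.2) fun i hi => by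
          simp only [Finset.mem_product, Finset.mem_range] at hi ⊢
          omega]
      refine Finset.sum_congr rfl fun m _ => ?_
      rw [Finset.sum_mul]
      exact Finset.sum_congr rfl fun i hi => by rw [(Finset.mem_filter.1 hi).2]
  have hpairs : pairs m = Finset.HasAntidiagonal.antidiagonal m := by
    ext i
    simp only [pairs, Finset.mem_filter, Finset.mem_product, Finset.mem_range,
      Finset.HasAntidiagonal.mem_antidiagonal]
    omega
  have hzero := coeff_eq_zero_of_isBigO (h.congr_left hc) m hm (by omega)
  simp only [c, if_pos hm, hpairs] at hzero
  exact sub_eq_zero.1 hzero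

theorem complexPoly_dilation (m : ℕ) (a : ℕ × ℕ → ℂ) (q : ℂ × ℝ) (t : ℝ) :
    complexPoly m a (quadricPoint ((t : ℂ) * q.1, t ^ 2 * q.2)) =
      complexPoly m a (quadricPoint q) * (t : ℂ) ^ m := by
  have hfst : (quadricPoint ((t : ℂ) * q.1, t ^ 2 * q.2)).1 = t * (quadricPoint q).1 := rfl
  have hsnd : (quadricPoint ((t : ℂ) * q.1, t ^ 2 * q.2)).2 = t ^ 2 * (quadricPoint q).2 := by
    simp only [quadricPoint, map_mul, Complex.conj_ofReal, Complex.ofReal_mul, Complex.ofReal_pow]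
    ring
  rw [complexPoly, complexPoly, Finset.sum_mul, hfst, hsnd]
  refine Finset.sum_congr rfl fun i hi => ?_
  rw [← (Finset.mem_filter.1 hi).2]
  ring

theorem exists_partialSum_eq (s : FormalMultilinearSeries ℂ (ℂ × ℂ) ℂ) (n : ℕ) :
    ∃ a : ℕ × ℕ → ℂ, ∀ P, s.partialSum n P =
      ∑ i ∈ Finset.range n ×ˢ Finset.range n, a i * (P.1 ^ i.1 * P.2 ^ i.2) := by
  let e : Fin 2 → ℂ × ℂ := ![(1, 0), (0, 1)]
  have he (P : ℂ × ℂ) : ∑ j, ![P.1, P.2] j • e j = P := by simp [e, Fin.sum_univ_two]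
  refine ⟨fun i => ∑ m ∈ Finset.range n, ∑ r : Fin m → Fin 2,
    if (occurrences r 0, occurrences r 1) = i then s m fun l => e (r l) else 0, fun P => ?_⟩
  simp only [Finset.sum_mul]
  rw [Finset.sum_comm]
  refine Finset.sum_congr rfl fun m hm => ?_
  have hmem (r : Fin m → Fin 2) :
      (occurrences r 0, occurrences r 1) ∈ Finset.range n ×ˢ Finset.range n := by
    simp only [Finset.mem_product, Finset.mem_range]
    exact ⟨occurrences_lt (Finset.mem_range.1 hm) r 0, occurrences_lt (Finset.mem_range.1 hm) r 1⟩
  conv_lhs => rw [← he P, (s m).map_sum fun _ j => ![P.1, P.2] j • e j]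
  rw [Finset.sum_comm]
  refine Finset.sum_congr rfl fun r _ => ?_
  simp only [ite_mul, zero_mul]
  rw [(s m).map_smul_univ, prod_comp_eq_prod_pow_occurrences, Finset.sum_ite_eq, if_pos (hmem r),
    Fin.prod_univ_two, smul_eq_mul, mul_comm]
  rfl

theorem sum_complexPoly (n : ℕ) (a : ℕ × ℕ → ℂ) (P : ℂ × ℂ) :
    ∑ m ∈ Finset.range n, complexPoly m a P =
      ∑ i ∈ (Finset.range n ×ˢ Finset.range n).filter (fun i => i.1 + 2 * i.2 < n),
        a i * (P.1 ^ i.1 * P.2 ^ i.2) := by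
  rw [← Finset.sum_fiberwise_of_maps_to (t := Finset.range n) (g := fun i : ℕ × ℕ => i.1 + 2 * i.2)
    (fun i hi => Finset.mem_range.2 (Finset.mem_filter.1 hi).2)]
  refine Finset.sum_congr rfl fun m hm => Finset.sum_congr (Finset.ext fun i => ?_) fun _ _ => rfl
  simp only [Finset.mem_filter, Finset.mem_product, Finset.mem_range] at hm ⊢
  omega

/-- `φ` agrees to order `n` with the restriction to the hyperquadric of the polynomial in `(z, w)`
whose coefficients are given by `a`. -/
def HasQuadricExpansion (n : ℕ) (φ : ℂ × ℝ → ℂ) (a : ℕ × ℕ → ℂ) : Prop :=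
  WeightedO n fun q => φ q - ∑ m ∈ Finset.range n, complexPoly m a (quadricPoint q)

namespace HasQuadricExpansion

variable {k n : ℕ} {φ ψ : ℂ × ℝ → ℂ} {a f g : ℕ × ℕ → ℂ}

theorem mono (hkn : k ≤ n) (h : HasQuadricExpansion n φ a) : HasQuadricExpansion k φ a := by
  have hhigh : WeightedO k fun q => ∑ m ∈ Finset.Ico k n, complexPoly m a (quadricPoint q) :=
    WeightedO.sum fun m hm =>
      (weightedO_complexPoly_quadricPoint m a).mono (Finset.mem_Ico.1 hm).1
  refine ((WeightedO.mono hkn h).add hhigh).congr fun q => ?_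
  rw [← Finset.sum_range_add_sum_Ico _ hkn]
  ring

theorem weightedO (hkn : k ≤ n) (h : HasQuadricExpansion n φ a)
    (hlow : ∀ m < k, ∀ P, complexPoly m a P = 0) : WeightedO k φ :=
  WeightedO.congr (h.mono hkn) fun q => by
    rw [Finset.sum_eq_zero fun m hm => hlow m (Finset.mem_range.1 hm) _, sub_zero]

theorem coeff_zero (hn : n ≠ 0) (h : HasQuadricExpansion n φ a) (hφ : φ 0 = 0) : a (0, 0) = 0 := by
  have hzero := WeightedO.apply_zero one_ne_zero (h.mono (Nat.one_le_iff_ne_zero.2 hn))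
  simpa [hφ, complexPoly_zero] using hzero

theorem weightedO_one (hn : n ≠ 0) (h : HasQuadricExpansion n φ a) (hφ : φ 0 = 0) :
    WeightedO 1 φ :=
  h.weightedO (Nat.one_le_iff_ne_zero.2 hn) fun m hm P => by
    rw [Nat.lt_one_iff.1 hm, complexPoly_zero, h.coeff_zero hn hφ]

theorem preservesQuadricInWeight (hφ : HasQuadricExpansion n φ f) (hψ : HasQuadricExpansion n ψ g)
    (h : WeightedO n fun q => (ψ q).im - Complex.normSq (φ q)) {m : ℕ} (hm : m < n) :
    PreservesQuadricInWeight m f g := by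
  intro q
  refine im_eq_sum_antidiagonal_of_isBigO (F := fun m => complexPoly m f (quadricPoint q))
    (G := fun m => complexPoly m g (quadricPoint q)) ?_ hm
  have hφ₀ : WeightedO 0 φ := hφ.weightedO n.zero_le fun m hm => absurd hm m.not_lt_zero
  have hsum : WeightedO 0 fun q => ∑ m ∈ Finset.range n, complexPoly m f (quadricPoint q) :=
    WeightedO.sum fun m _ => (weightedO_complexPoly_quadricPoint m f).mono m.zero_le
  have hnormSq : WeightedO n fun q => Complex.normSq (φ q) -
      Complex.normSq (∑ m ∈ Finset.range n, complexPoly m f (quadricPoint q)) := by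
    have hmul := (WeightedO.mul hφ hφ₀.conj).add
      ((hsum.mul (WeightedO.conj hφ)).mono (zero_add n).ge)
    refine hmul.re.congr fun q => ?_
    simp only [map_sub, Complex.normSq_apply, Complex.add_re, Complex.mul_re, Complex.sub_re,
      Complex.sub_im, Complex.conj_re, Complex.conj_im]
    ring
  have hpoly : WeightedO n fun q =>
      (∑ m ∈ Finset.range n, complexPoly m g (quadricPoint q)).im -
        Complex.normSq (∑ m ∈ Finset.range n, complexPoly m f (quadricPoint q)) :=
    ((h.add hnormSq).sub (WeightedO.im hψ)).congr fun q => by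
      rw [Complex.sub_im]
      ring
  simpa only [complexPoly_dilation] using hpoly.comp_dilation q

end HasQuadricExpansion

theorem tendsto_quadricPoint : Tendsto quadricPoint (𝓝 0) (𝓝 0) := by
  have hcont : Continuous quadricPoint := by
    unfold quadricPoint
    fun_prop
  exact hcont.tendsto' 0 0 (by simp [quadricPoint])

theorem exists_hasQuadricExpansion_comp_quadricPoint {f : ℂ × ℂ → ℂ} (hf : AnalyticAt ℂ f 0)
    (n : ℕ) : ∃ a, HasQuadricExpansion n (fun q => f (quadricPoint q)) a := by
  obtain ⟨s, R, hs⟩ := hf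
  obtain ⟨a, ha⟩ := exists_partialSum_eq s n
  have horder : WeightedO 1 quadricPoint :=
    IsBigO.prod_left weightedO_fst (weightedO_quadricPoint_snd.mono one_le_two)
  have htaylor : WeightedO n fun q => f (quadricPoint q) - s.partialSum n (quadricPoint q) := by
    have hbigO := hs.hasFPowerSeriesAt.isBigO_sub_partialSum_pow n
    simp only [zero_add] at hbigO
    refine (hbigO.comp_tendsto tendsto_quadricPoint).trans ?_
    simpa only [pow_one, Function.comp_def] using IsBigO.pow (IsBigO.norm_left horder) n
  have hhigh : WeightedO n fun q => ∑ i ∈ (Finset.range n ×ˢ Finset.range n).filter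
      (fun i => ¬ i.1 + 2 * i.2 < n),
      a i * ((quadricPoint q).1 ^ i.1 * (quadricPoint q).2 ^ i.2) := by
    refine WeightedO.sum fun i hi => WeightedO.const_mul _ ?_
    have hmonomial := (weightedO_fst.pow i.1).mul (weightedO_quadricPoint_snd.pow i.2)
    rw [one_mul] at hmonomial
    exact hmonomial.mono (not_lt.1 (Finset.mem_filter.1 hi).2)
  refine ⟨a, (htaylor.add hhigh).congr fun q => ?_⟩
  rw [sum_complexPoly, ha, ← Finset.sum_filter_add_sum_filter_not
    (Finset.range n ×ˢ Finset.range n) (fun i => i.1 + 2 * i.2 < n)]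
  ring

namespace AnalyticGraph

namespace IsNormalized

variable {N : AnalyticGraph}

theorem weightedO_point_sub (hN : N.IsNormalized) :
    WeightedO 6 fun q => N.point q - quadricPoint q := by
  have hz : WeightedO 6 fun q : ℂ × ℝ => ‖q.1‖ ^ 6 := by
    simpa only [WeightedO, norm_pow] using IsBigO.norm_left (weightedO_fst.pow 6)
  have hu : WeightedO 6 fun q : ℂ × ℝ => |q.2| ^ 3 := by
    simpa only [WeightedO, norm_pow, Real.norm_eq_abs] using IsBigO.norm_left (weightedO_snd.pow 3)
  have hF : WeightedO 6 fun q => N.F q - ‖q.1‖ ^ 2 := IsBigO.trans hN (hz.add hu)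
  refine hF.of_norm_le fun q => ?_
  have hsub : N.point q - quadricPoint q = (0, ((N.F q - ‖q.1‖ ^ 2 : ℝ) : ℂ) * Complex.I) := by
    ext1
    · simp [point, quadricPoint]
    · simp only [point, quadricPoint, Complex.mul_conj, Complex.normSq_eq_norm_sq, Prod.snd_sub]
      push_cast
      ring
  rw [hsub, Prod.norm_mk, norm_zero, norm_mul, Complex.norm_real, Complex.norm_I, mul_one]
  exact max_le (norm_nonneg _) le_rfl

theorem exists_hasQuadricExpansion (hN : N.IsNormalized) (h0 : (0 : ℂ × ℝ) ∈ N.Ω)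
    {f : ℂ × ℂ → ℂ} (hf : AnalyticAt ℂ f 0) :
    ∃ a, HasQuadricExpansion 6 (fun q => f (N.point q)) a := by
  obtain ⟨a, ha⟩ := exists_hasQuadricExpansion_comp_quadricPoint hf 6
  have hpoint : Tendsto N.point (𝓝 0) (𝓝 0) := by
    simpa only [hN.point_zero] using (N.analyticAt_point h0).continuousAt.tendsto
  have hlip : WeightedO 6 fun q => f (N.point q) - f (quadricPoint q) :=
    (hf.hasStrictFDerivAt.isBigO_sub.comp_tendsto
      (hpoint.prodMk_nhds tendsto_quadricPoint)).trans hN.weightedO_point_sub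
  exact ⟨a, (hlip.add ha).congr fun q => sub_add_sub_cancel _ _ _⟩

end IsNormalized

namespace IsLocalBiholomorphism

variable {e : OpenPartialHomeomorph (ℂ × ℂ) (ℂ × ℂ)} {N N' : AnalyticGraph}

theorem weightedO_im_sub_normSq (h : IsLocalBiholomorphism e N 0 N' 0) (hN' : N'.IsNormalized)
    {k : ℕ} (hfst : WeightedO 1 fun q => (e (N.point q)).1)
    (hsnd : WeightedO k fun q => (e (N.point q)).2) :
    WeightedO (min 6 (k * 3)) fun q =>
      (e (N.point q)).2.im - Complex.normSq (e (N.point q)).1 := by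
  have hbase : Tendsto (fun q => base (e (N.point q))) (𝓝 0) (𝓝 0) := by
    have hcont := base.continuous.continuousAt.comp h.analyticAt_comp_point.continuousAt
    simpa only [ContinuousAt, Function.comp_def, h.map_point, base_point] using hcont
  have hz : WeightedO (min 6 (k * 3)) fun q => ‖(e (N.point q)).1‖ ^ 6 := by
    simpa only [WeightedO, norm_pow] using
      IsBigO.norm_left ((hfst.pow 6).mono (min_le_left 6 (k * 3)))
  have hu : WeightedO (min 6 (k * 3)) fun q => |(e (N.point q)).2.re| ^ 3 := by
    simpa only [WeightedO, norm_pow, Real.norm_eq_abs] using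
      IsBigO.norm_left ((hsnd.re.pow 3).mono (min_le_right 6 (k * 3)))
  refine IsBigO.congr' ((IsBigO.comp_tendsto hN' hbase).trans (hz.add hu)) ?_ EventuallyEq.rfl
  filter_upwards [h.eventually_mem] with q hq
  rw [Function.comp_apply, base_apply, Complex.normSq_eq_norm_sq, hq.2]

theorem exists_jetRelations (h : IsLocalBiholomorphism e N 0 N' 0) (hN : N.IsNormalized)
    (hN' : N'.IsNormalized) : ∃ f g : ℕ × ℕ → ℂ, JetRelations f g ∧ g (1, 0) = 0 ∧
      HasQuadricExpansion 6 (fun q => (e (N.point q)).1) f ∧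
      HasQuadricExpansion 6 (fun q => (e (N.point q)).2) g := by
  have he : AnalyticAt ℂ e 0 := hN.point_zero ▸ h.analyticAt
  have he₀ : e (N.point 0) = 0 := by rw [h.map_point, hN'.point_zero]
  obtain ⟨f, hf⟩ := hN.exists_hasQuadricExpansion h.mem (f := fun P => (e P).1)
    (((ContinuousLinearMap.fst ℂ ℂ ℂ).analyticAt _).fun_comp he)
  obtain ⟨g, hg⟩ := hN.exists_hasQuadricExpansion h.mem (f := fun P => (e P).2)
    (((ContinuousLinearMap.snd ℂ ℂ ℂ).analyticAt _).fun_comp he)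
  have hf₀ : f (0, 0) = 0 := hf.coeff_zero (by norm_num) (by simp [he₀])
  have hg₀ : g (0, 0) = 0 := hg.coeff_zero (by norm_num) (by simp [he₀])
  have hfst := hf.weightedO_one (by norm_num) (by simp [he₀])
  have hsnd := hg.weightedO_one (by norm_num) (by simp [he₀])
  -- Knowing only `g = O(1)`, the equation of `N'` holds to weight two; this gives `g = O(2)`, with
  -- which it holds to weight five.
  have hg₁ : g (1, 0) = 0 := ((hf.mono (by norm_num)).preservesQuadricInWeight
    (hg.mono (by norm_num)) (h.weightedO_im_sub_normSq hN' hfst hsnd) (by norm_num)).one hf₀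
  have hsnd₂ : WeightedO 2 fun q => (e (N.point q)).2 := hg.weightedO (by norm_num) fun m hm P => by
    interval_cases m
    · rw [complexPoly_zero, hg₀]
    · rw [complexPoly_one, hg₁, zero_mul]
  exact ⟨f, g, .of_preservesQuadricInWeight hf₀ fun m hm =>
    hf.preservesQuadricInWeight hg (h.weightedO_im_sub_normSq hN' hfst hsnd₂) hm, hg₁, hf, hg⟩

end IsLocalBiholomorphism

end AnalyticGraph

end Expansion

/-! ### The action on 2-jets along normalized hypersurfaces -/

section Jets

open scoped ComplexConjugate

/-- The coefficient of `t²` in the expansion of the polynomial in `(z, w)` with coefficients `a`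
along a curve in the hyperquadric with 2-jet `j` at the origin. -/
noncomputable def quadraticCoeff (a : ℕ × ℕ → ℂ) (j : ℂ × ℂ) : ℂ :=
  a (1, 0) * j.2 / 2 + Complex.I * a (0, 1) * (j.1 * conj j.1) + a (2, 0) * j.1 ^ 2 +
    a (1, 1) * j.1 + a (0, 2)

theorem isBigO_pow_smul {E : Type*} [NormedAddCommGroup E] [NormedSpace ℝ E] {r : ℝ → E}
    (hr : Continuous r) (n : ℕ) :
    (fun t => t ^ n • r t) =O[𝓝[>] 0] fun t : ℝ => t ^ n := by
  have hone : r =O[𝓝[>] 0] fun _ => (1 : ℝ) :=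
    ((hr.tendsto 0).mono_left nhdsWithin_le_nhds).isBigO_one ℝ
  simpa only [smul_eq_mul, mul_one] using (isBigO_refl (fun t : ℝ => t ^ n) (𝓝[>] 0)).smul hone

namespace AnalyticGraph

theorem isBigO_sum_complexPoly_baseCurve (a : ℕ × ℕ → ℂ) (j : ℂ × ℂ) :
    (fun t : ℝ => ∑ m ∈ Finset.range 6, complexPoly m a (quadricPoint (baseCurve 0 j t)) -
      (a (0, 0) + (a (1, 0) * j.1 + a (0, 1)) * t + quadraticCoeff a j * t ^ 2))
      =O[𝓝[>] 0] fun t : ℝ => t ^ 3 := by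
  let s : ℝ → ℂ := fun t => j.1 + j.2 * t / 2
  let S : ℝ → ℂ := fun t => s t * conj (s t)
  let v : ℝ → ℂ := fun t => 1 + Complex.I * t * S t
  have hs : Continuous s := by fun_prop
  have hS : Continuous S := hs.mul (Complex.continuous_conj.comp hs)
  have hv : Continuous v := by fun_prop
  let r : ℝ → ℂ := fun t =>
    a (3, 0) * s t ^ 3 + a (4, 0) * t * s t ^ 4 + a (5, 0) * t ^ 2 * s t ^ 5 +
    a (2, 1) * s t ^ 2 * v t + a (3, 1) * t * s t ^ 3 * v t + a (1, 2) * s t * v t ^ 2 +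
    a (2, 0) * (j.1 * j.2 + t * j.2 ^ 2 / 4) +
    a (0, 1) * Complex.I * ((j.1 * conj j.2 + conj j.1 * j.2) / 2 + t * (j.2 * conj j.2) / 4) +
    a (1, 1) * (j.2 / 2 + Complex.I * s t * S t) +
    a (0, 2) * (2 * Complex.I * S t + Complex.I ^ 2 * t * S t ^ 2)
  have hr : Continuous r := by fun_prop
  refine (isBigO_pow_smul hr 3).congr_left fun t => ?_
  simp only [Finset.sum_range_succ, Finset.sum_range_zero, complexPoly_zero, complexPoly_one,
    complexPoly_two, complexPoly_three, complexPoly_four, complexPoly_five, quadricPoint, baseCurve,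
    quadraticCoeff, Complex.real_smul, Complex.ofReal_pow, Prod.fst_zero, Prod.snd_zero, sub_zero,
    r, v, S, s, map_add, map_mul, map_div₀, map_pow, map_zero, Complex.conj_ofReal,
    Complex.conj_ofNat]
  ring

theorem baseCurve_zero_eq (j : ℂ × ℂ) (t : ℝ) :
    baseCurve 0 j t = t • (j.1, (1 : ℝ)) + (t ^ 2 / 2) • (j.2, (0 : ℝ)) := by
  ext1
  · simp [baseCurve]
    ring
  · simp [baseCurve]

theorem tendsto_baseCurve_zero (j : ℂ × ℂ) : Tendsto (baseCurve 0 j) (𝓝[>] 0) (𝓝 0) :=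
  (tendsto_baseCurve 0 j).mono_left nhdsWithin_le_nhds

theorem weightedNorm_baseCurve_le (j : ℂ × ℂ) {t : ℝ} (h₀ : 0 ≤ t) (h₁ : t ≤ 1) :
    weightedNorm (baseCurve 0 j t) ≤ (‖j.1‖ + ‖j.2‖ + 1) * √t := by
  have hsqrt : t ≤ √t := Real.le_sqrt_of_sq_le (by nlinarith)
  have hfst : ‖(baseCurve 0 j t).1‖ ≤ t * ‖j.1‖ + t ^ 2 / 2 * ‖j.2‖ := by
    rw [baseCurve_zero_eq]
    refine (norm_add_le _ _).trans_eq ?_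
    rw [Prod.smul_fst, Prod.smul_fst, norm_smul_of_nonneg h₀, norm_smul_of_nonneg (by positivity)]
  have hsnd : |(baseCurve 0 j t).2| = t := abs_of_nonneg (by simpa [baseCurve] using h₀)
  have hsq : t ^ 2 / 2 ≤ √t := by nlinarith
  rw [weightedNorm, hsnd]
  nlinarith [mul_le_mul_of_nonneg_right hsqrt (norm_nonneg j.1),
    mul_le_mul_of_nonneg_right hsq (norm_nonneg j.2)]

theorem _root_.WeightedO.isBigO_comp_baseCurve {E : Type*} [SeminormedAddCommGroup E]
    {f : ℂ × ℝ → E} (hf : WeightedO 6 f) (j : ℂ × ℂ) :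
    (fun t => f (baseCurve 0 j t)) =O[𝓝[>] 0] fun t : ℝ => t ^ 3 := by
  refine (IsBigO.comp_tendsto hf (tendsto_baseCurve_zero j)).trans
    (IsBigO.of_bound ((‖j.1‖ + ‖j.2‖ + 1) ^ 6) ?_)
  filter_upwards [Ioc_mem_nhdsGT one_pos] with t ht
  have hnonneg := weightedNorm_nonneg (baseCurve 0 j t)
  rw [Function.comp_apply, Real.norm_of_nonneg (by positivity),
    Real.norm_of_nonneg (pow_nonneg ht.1.le 3)]
  calc weightedNorm (baseCurve 0 j t) ^ 6 ≤ ((‖j.1‖ + ‖j.2‖ + 1) * √t) ^ 6 := by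
        gcongr
        exact weightedNorm_baseCurve_le j ht.1.le ht.2
    _ = (‖j.1‖ + ‖j.2‖ + 1) ^ 6 * (√t ^ 2) ^ 3 := by ring
    _ = (‖j.1‖ + ‖j.2‖ + 1) ^ 6 * t ^ 3 := by rw [Real.sq_sqrt ht.1.le]

theorem isBigO_sub_firstOrder_secondOrder {Ψ : ℂ × ℝ → ℂ × ℂ} (hΨ : AnalyticAt ℝ Ψ 0)
    (h0 : Ψ 0 = 0) (j : ℂ × ℂ) :
    (fun t => Ψ (baseCurve 0 j t) - t • firstOrder Ψ 0 j.1 - (t ^ 2 / 2) • secondOrder Ψ 0 j)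
      =O[𝓝[>] 0] fun t : ℝ => t ^ 3 := by
  have hcurve : baseCurve 0 j =O[𝓝[>] 0] fun t : ℝ => t := by
    have hsub := (hasSecondDerivAt_baseCurve 0 j).hasDerivAt.isBigO_sub
    have h0 : baseCurve 0 j 0 = 0 := baseCurve_self 0 j
    simp only [h0, Prod.snd_zero, sub_zero] at hsub
    exact hsub.mono nhdsWithin_le_nhds
  have htaylor := ((isBigO_sub_taylor_two hΨ).comp_tendsto (tendsto_baseCurve_zero j)).trans
    (hcurve.norm_left.pow 3)
  let r : ℝ → ℂ × ℂ := fun t => (1 / 4 : ℝ) • (fderiv ℝ (fderiv ℝ Ψ) 0 (j.1, 1) (j.2, 0) +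
    fderiv ℝ (fderiv ℝ Ψ) 0 (j.2, 0) (j.1, 1)) +
      (t / 8) • fderiv ℝ (fderiv ℝ Ψ) 0 (j.2, 0) (j.2, 0)
  have hr : Continuous r := by fun_prop
  refine (htaylor.add (isBigO_pow_smul hr 3)).congr_left fun t => ?_
  simp only [Function.comp_apply, zero_add, h0, baseCurve_zero_eq j t, map_add, map_smul,
    add_apply, smul_apply, firstOrder, secondOrder, r]
  module

theorem eq_of_isBigO_quadratic {c : ℝ → ℂ} {X Y X' Y' : ℂ}
    (h : (fun t : ℝ => c t - X * t - Y / 2 * t ^ 2) =O[𝓝[>] 0] fun t : ℝ => t ^ 3)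
    (h' : (fun t : ℝ => c t - X' * t - Y' * t ^ 2) =O[𝓝[>] 0] fun t : ℝ => t ^ 3) :
    X = X' ∧ Y = 2 * Y' := by
  have hdiff : (fun t : ℝ => t • (X' - X) + t ^ 2 • (Y' - Y / 2))
      =O[𝓝[>] 0] fun t : ℝ => t ^ 3 :=
    (h.sub h').congr_left fun t => by
      simp only [Complex.real_smul, Complex.ofReal_pow]
      ring
  have hcoeff (L : ℂ →L[ℝ] ℝ) : L (X' - X) = 0 ∧ L (Y' - Y / 2) = 0 := by
    let b : ℕ → ℝ := fun m => if m = 1 then L (X' - X) else if m = 2 then L (Y' - Y / 2) else 0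
    have hb : (fun t : ℝ => ∑ m ∈ Finset.range 3, b m * t ^ m) =O[𝓝[>] 0] fun t : ℝ => t ^ 3 :=
      ((L.isBigO_comp _ (𝓝[>] 0)).trans hdiff).congr_left fun t => by
        simp only [b, Finset.sum_range_succ, map_add, map_smul, smul_eq_mul]
        simp [mul_comm]
    exact ⟨coeff_eq_zero_of_isBigO hb 1 (by norm_num) (by norm_num),
      coeff_eq_zero_of_isBigO hb 2 (by norm_num) (by norm_num)⟩
  have hX : X' - X = 0 := Complex.ext (hcoeff Complex.reCLM).1 (hcoeff Complex.imCLM).1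
  have hY : Y' - Y / 2 = 0 := Complex.ext (hcoeff Complex.reCLM).2 (hcoeff Complex.imCLM).2
  exact ⟨(sub_eq_zero.1 hX).symm, by linear_combination -2 * hY⟩

theorem _root_.HasQuadricExpansion.isBigO_comp_baseCurve {φ : ℂ × ℝ → ℂ} {a : ℕ × ℕ → ℂ}
    (h : HasQuadricExpansion 6 φ a) (hφ : φ 0 = 0) (j : ℂ × ℂ) :
    (fun t : ℝ => φ (baseCurve 0 j t) - (a (1, 0) * j.1 + a (0, 1)) * t -
      quadraticCoeff a j * t ^ 2) =O[𝓝[>] 0] fun t : ℝ => t ^ 3 :=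
  ((WeightedO.isBigO_comp_baseCurve h j).add
    (isBigO_sum_complexPoly_baseCurve a j)).congr_left fun t => by
      rw [h.coeff_zero (by norm_num) hφ]
      ring

theorem firstOrder_secondOrder_of_hasQuadricExpansion {Ψ : ℂ × ℝ → ℂ × ℂ} (hΨ : AnalyticAt ℝ Ψ 0)
    (h0 : Ψ 0 = 0) (L : ℂ × ℂ →L[ℝ] ℂ) {a : ℕ × ℕ → ℂ}
    (ha : HasQuadricExpansion 6 (fun q => L (Ψ q)) a) (j : ℂ × ℂ) :
    L (firstOrder Ψ 0 j.1) = a (1, 0) * j.1 + a (0, 1) ∧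
      L (secondOrder Ψ 0 j) = 2 * quadraticCoeff a j := by
  have htaylor := (L.isBigO_comp _ (𝓝[>] 0)).trans (isBigO_sub_firstOrder_secondOrder hΨ h0 j)
  refine eq_of_isBigO_quadratic (htaylor.congr_left fun t => ?_)
    (ha.isBigO_comp_baseCurve (by rw [h0, map_zero]) j)
  simp only [map_sub, map_smul, Complex.real_smul]
  push_cast
  ring

theorem mem_sigmaZero_iff (j : ℂ × ℂ) :
    j ∈ sigmaZero ↔ j.2 = 2 * Complex.I * (j.1 * conj j.1) * j.1 := by
  have hre : (2 * Complex.I * (j.1 * conj j.1) * j.1).re =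
      -2 * j.1.re ^ 2 * j.1.im - 2 * j.1.im ^ 3 := by
    simp
    ring
  have him : (2 * Complex.I * (j.1 * conj j.1) * j.1).im =
      2 * j.1.re * j.1.im ^ 2 + 2 * j.1.re ^ 3 := by
    simp
    ring
  rw [Complex.ext_iff, hre, him, sigmaZero, mem_ofPred_eq]

theorem IsLocalBiholomorphism.prolong_mem_sigmaZero {e : OpenPartialHomeomorph (ℂ × ℂ) (ℂ × ℂ)}
    {N N' : AnalyticGraph} (h : IsLocalBiholomorphism e N 0 N' 0) (hN : N.IsNormalized)
    (hN' : N'.IsNormalized) {j : ℂ × ℂ} (hj : N.CRTransversal 0 j.1) (hjs : j ∈ sigmaZero) :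
    N.prolong e 0 j ∈ sigmaZero := by
  obtain ⟨f, g, hfg, hg₁, hf, hg⟩ := h.exists_jetRelations hN hN'
  have hX := h.firstOrder_snd_re_ne_zero (h.imageParamByU hN' hj)
  have he₀ : e (N.point 0) = 0 := by rw [h.map_point, hN'.point_zero]
  obtain ⟨hX₁, hY₁⟩ := firstOrder_secondOrder_of_hasQuadricExpansion h.analyticAt_comp_point he₀
    (ContinuousLinearMap.fst ℝ ℂ ℂ) hf j
  obtain ⟨hX₂, hY₂⟩ := firstOrder_secondOrder_of_hasQuadricExpansion h.analyticAt_comp_point he₀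
    (ContinuousLinearMap.snd ℝ ℂ ℂ) hg j
  rw [h.prolong_eq_jetOf j (h.imageParamByU hN' hj), mem_sigmaZero_iff]
  set X := firstOrder (e ∘ N.point) 0 j.1
  set Y := secondOrder (e ∘ N.point) 0 j
  change X.1 = _ at hX₁
  change Y.1 = _ at hY₁
  change X.2 = _ at hX₂
  change Y.2 = _ at hY₂
  have hXre : X.2.re = Complex.normSq (f (1, 0)) := by
    rw [hX₂, hg₁, zero_mul, zero_add, hfg.g01_re]
  have hYre : Y.2.re = 2 * (g (1, 1) * j.1 + g (0, 2)).re := by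
    rw [hY₂, quadraticCoeff, hg₁, hfg.g20, Complex.mul_conj]
    simp [hfg.g01_im]
  have hf₁ : f (1, 0) ≠ 0 := fun hf₁ => hX (by rw [hXre, hf₁, map_zero])
  have hX' : (X.2.re : ℂ) ≠ 0 := mod_cast hX
  have hkey := hfg.jet_identity hf₁ j.1
  rw [← (mem_sigmaZero_iff j).1 hjs, ← hYre, ← hX₁, Complex.mul_conj, ← hXre] at hkey
  simp only [jetOf, map_div₀, Complex.conj_ofReal]
  field_simp
  rw [quadraticCoeff] at hY₁
  linear_combination hkey + X.2.re * hY₁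

end AnalyticGraph

end Jets

namespace AnalyticGraph

theorem sigma_subset {M : AnalyticGraph} {p : ℂ × ℝ}
    {φ φ' : OpenPartialHomeomorph (ℂ × ℂ) (ℂ × ℂ)} (h : M.IsNormalizing p φ)
    (h' : M.IsNormalizing p φ') : M.sigma p φ ⊆ M.sigma p φ' := by
  obtain ⟨N, hN, hφ⟩ := h
  obtain ⟨N', hN', hφ'⟩ := h'
  rintro j ⟨hj, hjs⟩
  refine ⟨hj, ?_⟩
  have htransition := hφ.symm.trans hφ'
  have heq : φ.trans (φ.symm.trans φ') =ᶠ[𝓝 (M.point p)] φ' := by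
    filter_upwards [φ.open_source.mem_nhds hφ.mem_source] with x hx
    simp only [OpenPartialHomeomorph.coe_trans, Function.comp_apply, φ.left_inv hx]
  have hu := hφ.imageParamByU hN hj
  have hj' := hφ.crTransversal_map hj hu
  rw [← prolong_congr hφ.mem heq, hφ.prolong_trans htransition j hu
    (htransition.imageParamByU hN' hj')]
  exact htransition.prolong_mem_sigmaZero hN hN' hj' hjs

theorem sigma_eq {M : AnalyticGraph} {p : ℂ × ℝ}
    {φ φ' : OpenPartialHomeomorph (ℂ × ℂ) (ℂ × ℂ)} (h : M.IsNormalizing p φ)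
    (h' : M.IsNormalizing p φ') : M.sigma p φ = M.sigma p φ' :=
  (sigma_subset h h').antisymm (sigma_subset h' h)

end AnalyticGraph

/-! ### The surface `Σ_p` as a graph -/

section Graph

open scoped ComplexConjugate

theorem eq_inverse_apply_iff {E : Type*} [NormedAddCommGroup E] [NormedSpace ℝ E] {L : E →L[ℝ] E}
    (hL : IsUnit L) {z w : E} : z = Ring.inverse L w ↔ L z = w := by
  constructor
  · rintro rfl
    exact DFunLike.congr_fun (Ring.mul_inverse_cancel L hL) w
  · rintro rfl
    exact (DFunLike.congr_fun (Ring.inverse_mul_cancel L hL) z).symm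

/-- The numerator of the second component of `jetOf X Y`, as a bilinear map. -/
noncomputable def jetNumerator : ℂ × ℂ →L[ℝ] ℂ × ℂ →L[ℝ] ℂ :=
  let B := (ContinuousLinearMap.mul ℝ ℂ).bilinearComp
    (Complex.ofRealCLM ∘L Complex.reCLM ∘L ContinuousLinearMap.snd ℝ ℂ ℂ)
    (ContinuousLinearMap.fst ℝ ℂ ℂ)
  B - B.flip

theorem jetNumerator_apply (X Y : ℂ × ℂ) :
    jetNumerator X Y = (X.2.re : ℂ) * Y.1 - (Y.2.re : ℂ) * X.1 :=
  rfl

namespace AnalyticGraph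

theorem jetOf_mem_sigmaZero_iff {X Y : ℂ × ℂ} (hX : X.2.re ≠ 0) :
    jetOf X Y ∈ sigmaZero ↔ jetNumerator X Y = 2 * Complex.I * (X.1 * conj X.1) * X.1 := by
  have hX' : (X.2.re : ℂ) ≠ 0 := mod_cast hX
  rw [mem_sigmaZero_iff]
  simp only [jetOf, map_div₀, Complex.conj_ofReal, ← jetNumerator_apply]
  field_simp

theorem base_eq_smul_of_jetNumerator_eq_zero {X V : ℂ × ℂ} (hX : X.2.re ≠ 0)
    (h : jetNumerator X V = 0) : base V = (V.2.re / X.2.re) • base X := by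
  have hX' : (X.2.re : ℂ) ≠ 0 := mod_cast hX
  rw [jetNumerator_apply, sub_eq_zero] at h
  ext1
  · simp only [base_apply, Prod.smul_fst, Complex.real_smul, Complex.ofReal_div]
    rw [div_mul_eq_mul_div, eq_div_iff hX', mul_comm, h]
  · simp only [base_apply, Prod.smul_snd, smul_eq_mul, div_mul_cancel₀ _ hX]

/-- The linear part of the equation `prolong Ψ p (z₁, z₂) ∈ Σ₀` in the unknown `z₂`. -/
noncomputable def jetOperator (Ψ : ℂ × ℝ → ℂ × ℂ) (p : ℂ × ℝ) (z₁ : ℂ) : ℂ →L[ℝ] ℂ :=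
  jetNumerator (firstOrder Ψ p z₁) ∘L fderiv ℝ Ψ p ∘L ContinuousLinearMap.inl ℝ ℂ ℝ

/-- The solution `z₂` of `jetOf (firstOrder Ψ p z₁) (secondOrder Ψ p (z₁, z₂)) ∈ Σ₀`, for an
invertible `jetOperator Ψ p z₁`. -/
noncomputable def solveJet (Ψ : ℂ × ℝ → ℂ × ℂ) (p : ℂ × ℝ) (z₁ : ℂ) : ℂ :=
  Ring.inverse (jetOperator Ψ p z₁)
    (2 * Complex.I * ((firstOrder Ψ p z₁).1 * conj (firstOrder Ψ p z₁).1) * (firstOrder Ψ p z₁).1 -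
      jetNumerator (firstOrder Ψ p z₁) (secondOrder Ψ p (z₁, 0)))

theorem eq_solveJet_iff {Ψ : ℂ × ℝ → ℂ × ℂ} {p : ℂ × ℝ} {z₁ : ℂ}
    (hX : (firstOrder Ψ p z₁).2.re ≠ 0) (hunit : IsUnit (jetOperator Ψ p z₁)) (z₂ : ℂ) :
    z₂ = solveJet Ψ p z₁ ↔
      jetOf (firstOrder Ψ p z₁) (secondOrder Ψ p (z₁, z₂)) ∈ sigmaZero := by
  have hsecond : secondOrder Ψ p (z₁, z₂) = secondOrder Ψ p (z₁, 0) + fderiv ℝ Ψ p (z₂, 0) := by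
    simp only [secondOrder, ← Prod.zero_eq_mk, map_zero, add_zero]
  rw [solveJet, eq_inverse_apply_iff hunit, jetOf_mem_sigmaZero_iff hX, hsecond, map_add,
    eq_sub_iff_add_eq']
  rfl

namespace IsLocalBiholomorphism

variable {e : OpenPartialHomeomorph (ℂ × ℂ) (ℂ × ℂ)} {M M' : AnalyticGraph} {p p' : ℂ × ℝ}

theorem tangentLift_base_fderiv (h : IsLocalBiholomorphism e M p M' p') (v : ℂ × ℝ) :
    M'.tangentLift p' (base (fderiv ℝ (e ∘ M.point) p v)) = fderiv ℝ (e ∘ M.point) p v := by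
  rw [← M'.fderiv_rho_eq_zero_iff h.mem', h.hasFDerivAt_comp_point.fderiv,
    ContinuousLinearMap.comp_apply, M.fderiv_point h.mem]
  exact h.fderiv_rho_map (M.fderiv_rho_tangentLift h.mem v)

theorem fderiv_comp_point_injective (h : IsLocalBiholomorphism e M p M' p') :
    Function.Injective (fderiv ℝ (e ∘ M.point) p) := by
  refine Function.LeftInverse.injective (g := fun V =>
    base (fderiv ℝ e.symm (M'.point p') V)) fun v => ?_
  rw [h.hasFDerivAt_comp_point.fderiv, ContinuousLinearMap.comp_apply, M.fderiv_point h.mem]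
  change base (fderiv ℝ e.symm _ (fderiv ℝ e _ _)) = v
  rw [h.fderiv_symm_fderiv, base_tangentLift]

theorem isUnit_jetOperator (h : IsLocalBiholomorphism e M p M' p') {z₁ : ℂ}
    (hz : M.ImageParamByU e p z₁) : IsUnit (jetOperator (e ∘ M.point) p z₁) := by
  suffices hinj : Function.Injective (jetOperator (e ∘ M.point) p z₁) from
    ContinuousLinearMap.isUnit_iff_bijective.2 ⟨hinj, LinearMap.surjective_of_injective
      (f := (jetOperator (e ∘ M.point) p z₁).toLinearMap) hinj⟩
  refine (injective_iff_map_eq_zero _).2 fun z₂ hz₂ => ?_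
  set L := fderiv ℝ (e ∘ M.point) p
  obtain ⟨c, hc⟩ : ∃ c : ℝ, base (L (z₂, 0)) = c • base (L (z₁, 1)) :=
    ⟨_, base_eq_smul_of_jetNumerator_eq_zero (h.firstOrder_snd_re_ne_zero hz) hz₂⟩
  have hL : L (z₂, 0) = L (c • (z₁, 1)) := by
    rw [map_smul, ← h.tangentLift_base_fderiv, ← h.tangentLift_base_fderiv (z₁, 1), hc,
      tangentLift_smul]
  have hv : ((z₂, 0) : ℂ × ℝ) = c • (z₁, (1 : ℝ)) := h.fderiv_comp_point_injective hL
  have hc₀ : c = 0 := by simpa using (congrArg Prod.snd hv).symm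
  simpa [hc₀] using congrArg Prod.fst hv

end IsLocalBiholomorphism

theorem mem_sigma_iff_eq_solveJet {M : AnalyticGraph} {p : ℂ × ℝ}
    {φ : OpenPartialHomeomorph (ℂ × ℂ) (ℂ × ℂ)} (h : M.IsNormalizing p φ) {z₁ : ℂ}
    (hz : M.CRTransversal p z₁) (z₂ : ℂ) :
    (z₁, z₂) ∈ M.sigma p φ ↔ z₂ = solveJet (φ ∘ M.point) p z₁ := by
  obtain ⟨N, hN, hφ⟩ := h
  have hu := hφ.imageParamByU hN hz
  rw [eq_solveJet_iff (hφ.firstOrder_snd_re_ne_zero hu) (hφ.isUnit_jetOperator hu),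
    ← hφ.prolong_eq_jetOf (z₁, z₂) hu]
  exact and_iff_right hz

/-- The second order part `z₂ = A + i B` of the 2-jet of `Σ_p` above the 1-jet `z₁`. -/
noncomputable def chainJet (M : AnalyticGraph) (q : (ℂ × ℝ) × ℂ) : ℂ :=
  Classical.epsilon fun z₂ => ∃ φ : OpenPartialHomeomorph (ℂ × ℂ) (ℂ × ℂ),
    M.IsNormalizing q.1 φ ∧ (q.2, z₂) ∈ M.sigma q.1 φ

theorem chainJet_eq_solveJet {M : AnalyticGraph} {p : ℂ × ℝ}
    {φ : OpenPartialHomeomorph (ℂ × ℂ) (ℂ × ℂ)} (h : M.IsNormalizing p φ) {z₁ : ℂ}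
    (hz : M.CRTransversal p z₁) : M.chainJet (p, z₁) = solveJet (φ ∘ M.point) p z₁ := by
  have hexists : ∃ z₂, ∃ φ : OpenPartialHomeomorph (ℂ × ℂ) (ℂ × ℂ), M.IsNormalizing p φ ∧
      (z₁, z₂) ∈ M.sigma p φ := ⟨_, φ, h, (mem_sigma_iff_eq_solveJet h hz _).2 rfl⟩
  obtain ⟨φ', h', hs⟩ := Classical.epsilon_spec hexists
  rw [sigma_eq h' h] at hs
  exact (mem_sigma_iff_eq_solveJet h hz _).1 hs

theorem mem_sigma_iff_eq_chainJet {M : AnalyticGraph} {p : ℂ × ℝ}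
    {φ : OpenPartialHomeomorph (ℂ × ℂ) (ℂ × ℂ)} (h : M.IsNormalizing p φ) {z₁ : ℂ}
    (hz : M.CRTransversal p z₁) (z₂ : ℂ) : (z₁, z₂) ∈ M.sigma p φ ↔ z₂ = M.chainJet (p, z₁) := by
  rw [mem_sigma_iff_eq_solveJet h hz, chainJet_eq_solveJet h hz]

end AnalyticGraph

end Graph

section PartialDerivatives

variable {E F P : Type*} [NormedAddCommGroup E] [NormedSpace ℝ E] [NormedAddCommGroup F]
  [NormedSpace ℝ F] [NormedAddCommGroup P] [NormedSpace ℝ P]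

theorem analyticAt_fderiv_snd [CompleteSpace F] {Ψ : P → E → F} {x : P × E}
    (hΨ : AnalyticAt ℝ (fun y : P × E => Ψ y.1 y.2) x) :
    AnalyticAt ℝ (fun y : P × E => fderiv ℝ (Ψ y.1) y.2) x := by
  have hpartial := ((ContinuousLinearMap.compL ℝ E (P × E) F).flip
    (ContinuousLinearMap.inr ℝ P E)).analyticAt _ |>.fun_comp hΨ.fderiv
  refine hpartial.congr ?_
  filter_upwards [hΨ.eventually_analyticAt] with y hy
  exact (HasFDerivAt.comp (f := Prod.mk y.1) y.2 hy.differentiableAt.hasFDerivAt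
    (hasFDerivAt_prodMk_right y.1 y.2)).fderiv.symm

end PartialDerivatives

theorem analyticAt_inverse_apply {E P : Type*} [NormedAddCommGroup E] [NormedSpace ℝ E]
    [CompleteSpace E] [NormedAddCommGroup P] [NormedSpace ℝ P] {L : P → E →L[ℝ] E} {w : P → E}
    {x : P} (hL : AnalyticAt ℝ L x) (hw : AnalyticAt ℝ w x) (hunit : IsUnit (L x)) :
    AnalyticAt ℝ (fun y => Ring.inverse (L y) (w y)) x := by
  obtain ⟨U, hU⟩ := hunit
  have hinv : AnalyticAt ℝ Ring.inverse (L x) := hU ▸ analyticAt_inverse U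
  exact analyticAt_clm_apply (hinv.fun_comp hL) hw

namespace AnalyticGraph

open scoped ContDiff

section JointAnalyticity

variable {Ψ : ℂ × ℝ → ℂ × ℝ → ℂ × ℂ} {p : ℂ × ℝ}

theorem analyticAt_fderiv_diag {F : Type*} [NormedAddCommGroup F] [NormedSpace ℝ F]
    [CompleteSpace F] {Ψ : ℂ × ℝ → ℂ × ℝ → F} {p : ℂ × ℝ}
    (hΨ : AnalyticAt ℝ (fun x : (ℂ × ℝ) × (ℂ × ℝ) => Ψ x.1 x.2) (p, p)) (z₁ : ℂ) :
    AnalyticAt ℝ (fun q : (ℂ × ℝ) × ℂ => fderiv ℝ (Ψ q.1) q.1) (p, z₁) :=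
  AnalyticAt.fun_comp (g := fun x : (ℂ × ℝ) × (ℂ × ℝ) => fderiv ℝ (Ψ x.1) x.2)
    (f := fun q : (ℂ × ℝ) × ℂ => (q.1, q.1)) (analyticAt_fderiv_snd hΨ)
    (analyticAt_fst.prod analyticAt_fst)

theorem analyticAt_fderiv_fderiv_diag
    (hΨ : AnalyticAt ℝ (fun x : (ℂ × ℝ) × (ℂ × ℝ) => Ψ x.1 x.2) (p, p)) (z₁ : ℂ) :
    AnalyticAt ℝ (fun q : (ℂ × ℝ) × ℂ => fderiv ℝ (fderiv ℝ (Ψ q.1)) q.1) (p, z₁) :=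
  analyticAt_fderiv_diag (Ψ := fun p => fderiv ℝ (Ψ p)) (analyticAt_fderiv_snd hΨ) z₁

theorem analyticAt_firstOrder (hΨ : AnalyticAt ℝ (fun x : (ℂ × ℝ) × (ℂ × ℝ) => Ψ x.1 x.2) (p, p))
    (z₁ : ℂ) : AnalyticAt ℝ (fun q : (ℂ × ℝ) × ℂ => firstOrder (Ψ q.1) q.1 q.2) (p, z₁) :=
  analyticAt_clm_apply (analyticAt_fderiv_diag hΨ z₁) (analyticAt_snd.prod analyticAt_const)

theorem analyticAt_secondOrder (hΨ : AnalyticAt ℝ (fun x : (ℂ × ℝ) × (ℂ × ℝ) => Ψ x.1 x.2) (p, p))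
    (z₁ z₂ : ℂ) :
    AnalyticAt ℝ (fun q : (ℂ × ℝ) × ℂ => secondOrder (Ψ q.1) q.1 (q.2, z₂)) (p, z₁) := by
  have hv : AnalyticAt ℝ (fun q : (ℂ × ℝ) × ℂ => (q.2, (1 : ℝ))) (p, z₁) :=
    analyticAt_snd.prod analyticAt_const
  exact (analyticAt_clm_apply
    (analyticAt_clm_apply (analyticAt_fderiv_fderiv_diag hΨ z₁) hv) hv).add
    (analyticAt_clm_apply (analyticAt_fderiv_diag hΨ z₁) (analyticAt_const (v := (z₂, 0))))

theorem analyticAt_jetOperator (hΨ : AnalyticAt ℝ (fun x : (ℂ × ℝ) × (ℂ × ℝ) => Ψ x.1 x.2) (p, p))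
    (z₁ : ℂ) : AnalyticAt ℝ (fun q : (ℂ × ℝ) × ℂ => jetOperator (Ψ q.1) q.1 q.2) (p, z₁) := by
  have hnum := (jetNumerator.analyticAt _).fun_comp (analyticAt_firstOrder hΨ z₁)
  exact ((hnum.contDiffAt.clm_comp (n := ω)
    ((analyticAt_fderiv_diag hΨ z₁).contDiffAt.clm_comp contDiffAt_const))).analyticAt

theorem analyticAt_solveJet (hΨ : AnalyticAt ℝ (fun x : (ℂ × ℝ) × (ℂ × ℝ) => Ψ x.1 x.2) (p, p))
    {z₁ : ℂ} (hunit : IsUnit (jetOperator (Ψ p) p z₁)) :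
    AnalyticAt ℝ (fun q : (ℂ × ℝ) × ℂ => solveJet (Ψ q.1) q.1 q.2) (p, z₁) := by
  have hX := analyticAt_firstOrder hΨ z₁
  have hX₁ := ((ContinuousLinearMap.fst ℝ ℂ ℂ).analyticAt _).fun_comp hX
  have hnum := (jetNumerator.analyticAt _).fun_comp hX
  exact analyticAt_inverse_apply (analyticAt_jetOperator hΨ z₁)
    (((analyticAt_const.mul (hX₁.mul (analyticAt_conj_comp hX₁))).mul hX₁).sub
      (analyticAt_clm_apply hnum (analyticAt_secondOrder hΨ z₁ 0))) hunit

end JointAnalyticity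

theorem analyticAt_chainJet {M : AnalyticGraph} (hM : M.LeviNondegenerate) {q : (ℂ × ℝ) × ℂ}
    (hq : q ∈ M.transversalJets) : AnalyticAt ℝ M.chainJet q := by
  obtain ⟨Φ, hΦ, hnormal⟩ := M.exists_analytic_normalizing hM hq.1
  have hunit : IsUnit (jetOperator (Φ q.1 ∘ M.point) q.1 q.2) := by
    obtain ⟨e, he, N, hN, hloc⟩ := hnormal.self_of_nhds
    exact he ▸ hloc.isUnit_jetOperator (hloc.imageParamByU hN hq.2)
  refine (analyticAt_solveJet (Ψ := fun p => Φ p ∘ M.point) hΦ hunit).congr ?_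
  filter_upwards [continuousAt_fst.eventually hnormal, M.isOpen_transversalJets.mem_nhds hq]
    with q' ⟨e, he, hne⟩ hq'
  rw [← he]
  exact (chainJet_eq_solveJet hne hq'.2).symm

end AnalyticGraph

section IntegralCurves

variable {E : Type*} [NormedAddCommGroup E] [NormedSpace ℝ E] {v : E → E} {f g : ℝ → E}

theorem eventuallyEq_of_hasDerivAt {t : ℝ} (hv : ContDiffAt ℝ 1 v (f t))
    (hf : ∀ᶠ s in 𝓝 t, HasDerivAt f (v (f s)) s) (hg : ∀ᶠ s in 𝓝 t, HasDerivAt g (v (g s)) s)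
    (heq : f t = g t) : f =ᶠ[𝓝 t] g := by
  obtain ⟨K, s, hs, hK⟩ := hv.exists_lipschitzOnWith
  have hfs : ∀ᶠ x in 𝓝 t, f x ∈ s := hf.self_of_nhds.continuousAt.eventually hs
  have hgs : ∀ᶠ x in 𝓝 t, g x ∈ s := hg.self_of_nhds.continuousAt.eventually (heq ▸ hs)
  exact ODE_solution_unique_of_eventually (v := fun _ => v) (s := fun _ => s)
    (Eventually.of_forall fun _ => hK) (hf.and hfs) (hg.and hgs) heq

theorem eqOn_of_hasDerivAt {I : Set ℝ} (hI : IsOpen I) (hI' : IsPreconnected I) {t₀ : ℝ}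
    (ht₀ : t₀ ∈ I) (hv : ∀ t ∈ I, ContDiffAt ℝ 1 v (f t))
    (hf : ∀ t ∈ I, HasDerivAt f (v (f t)) t) (hg : ∀ t ∈ I, HasDerivAt g (v (g t)) t)
    (heq : f t₀ = g t₀) : EqOn f g I := by
  have hlocal : ∀ t ∈ I, f t = g t → f =ᶠ[𝓝 t] g := fun t ht =>
    eventuallyEq_of_hasDerivAt (hv t ht) (eventually_of_mem (hI.mem_nhds ht) hf)
      (eventually_of_mem (hI.mem_nhds ht) hg)
  have hsubset : I ⊆ {t | f =ᶠ[𝓝 t] g} := by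
    refine hI'.subset_of_closure_inter_subset isOpen_setOfPred_eventually_nhds
      ⟨t₀, ht₀, hlocal t₀ ht₀ heq⟩ ?_
    rintro t ⟨hclosure, ht⟩
    refine hlocal t ht ?_
    by_contra hne
    have hne' := ((hf t ht).continuousAt.ne_iff_eventually_ne (hg t ht).continuousAt).1 hne
    obtain ⟨x, hx, hx'⟩ := ((mem_closure_iff_frequently.1 hclosure).and_eventually hne').exists
    exact hx' hx.eq_of_nhds
  exact fun t ht => (hsubset ht).eq_of_nhds

end IntegralCurves

namespace AnalyticGraph

theorem LeviNondegenerate.exists_isNormalizing {M : AnalyticGraph} (hM : M.LeviNondegenerate)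
    {p : ℂ × ℝ} (hp : p ∈ M.Ω) :
    ∃ φ : OpenPartialHomeomorph (ℂ × ℂ) (ℂ × ℂ), M.IsNormalizing p φ := by
  obtain ⟨_, _, hnormal⟩ := M.exists_analytic_normalizing hM hp
  obtain ⟨e, -, he⟩ := hnormal.self_of_nhds
  exact ⟨e, he⟩

theorem sigma_eq_graph {M : AnalyticGraph} {p : ℂ × ℝ}
    {φ : OpenPartialHomeomorph (ℂ × ℂ) (ℂ × ℂ)} (h : M.IsNormalizing p φ) :
    M.sigma p φ = {j | M.CRTransversal p j.1 ∧ j.2.re = (M.chainJet (p, j.1)).re ∧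
      j.2.im = (M.chainJet (p, j.1)).im} := by
  ext ⟨z₁, z₂⟩
  simp only [mem_ofPred_eq, ← Complex.ext_iff]
  rw [← and_congr_right fun hz => mem_sigma_iff_eq_chainJet h hz z₂]
  exact (and_iff_right_of_imp And.left).symm

theorem IsLocalBiholomorphism.prolong_chainJet {h : OpenPartialHomeomorph (ℂ × ℂ) (ℂ × ℂ)}
    {M M' : AnalyticGraph} {p p' : ℂ × ℝ} (hh : IsLocalBiholomorphism h M p M' p')
    (hM' : M'.LeviNondegenerate) {z₁ : ℂ} (hz : M.CRTransversal p z₁)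
    (hu : M.ImageParamByU h p z₁) : ∃ z₁', M'.CRTransversal p' z₁' ∧
      M.prolong h p (z₁, M.chainJet (p, z₁)) = (z₁', M'.chainJet (p', z₁')) := by
  obtain ⟨φ, hφ⟩ := hM'.exists_isNormalizing hh.mem'
  obtain ⟨N, hN, hloc⟩ := id hφ
  have hcomp := hh.trans hloc
  have hz' := hh.crTransversal_map (j := (z₁, M.chainJet (p, z₁))) hz hu
  have hmem := ((mem_sigma_iff_eq_chainJet ⟨N, hN, hcomp⟩ hz _).2 rfl).2
  rw [hh.prolong_trans hloc _ hu (hloc.imageParamByU hN hz')] at hmem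
  exact ⟨_, hz', Prod.ext rfl ((mem_sigma_iff_eq_chainJet hφ hz' _).1 ⟨hz', hmem⟩)⟩

/-! ### Moser chains -/

/-- The vector field on the space of 1-jets whose integral curves are the lifts of chains. -/
noncomputable def chainField (M : AnalyticGraph) (q : (ℂ × ℝ) × ℂ) : (ℂ × ℝ) × ℂ :=
  ((q.2, 1), M.chainJet q)

/-- The lift of the curve `u ↦ ζ(u)` to the space of 1-jets. -/
noncomputable def jetLift (ζ : ℝ → ℂ) (t : ℝ) : (ℂ × ℝ) × ℂ :=
  ((ζ t, t), deriv ζ t)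

theorem contDiffAt_chainField {M : AnalyticGraph} (hM : M.LeviNondegenerate) {q : (ℂ × ℝ) × ℂ}
    (hq : q ∈ M.transversalJets) : ContDiffAt ℝ 1 M.chainField q :=
  ((analyticAt_snd.prod analyticAt_const).prod (analyticAt_chainJet hM hq)).contDiffAt

theorem solvesODE_chainJet_iff {M : AnalyticGraph} {I : Set ℝ} {ζ : ℝ → ℂ} :
    M.SolvesODE (fun q => (M.chainJet q).re) (fun q => (M.chainJet q).im) I ζ ↔
      ∀ t ∈ I, jetLift ζ t ∈ M.transversalJets ∧
        HasDerivAt (jetLift ζ) (M.chainField (jetLift ζ t)) t := by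
  refine forall₂_congr fun t _ => and_congr_right fun _ => ⟨?_, fun h => ?_⟩
  · rintro ⟨hζ, hre, him⟩
    have hderiv := hre.ofReal_comp.add (him.ofReal_comp.mul_const Complex.I)
    simp only [Pi.add_def, Complex.re_add_im] at hderiv
    exact (hζ.hasDerivAt.prodMk (hasDerivAt_id t)).prodMk hderiv
  · have hζ : HasDerivAt ζ (deriv ζ t) t := h.fst.fst
    have hderiv : HasDerivAt (deriv ζ) (M.chainJet (jetLift ζ t)) t := h.snd
    exact ⟨hζ.differentiableAt, Complex.reCLM.hasFDerivAt.comp_hasDerivAt t hderiv,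
      Complex.imCLM.hasFDerivAt.comp_hasDerivAt t hderiv⟩

theorem jetLift_eq_of_hasDerivAt {M : AnalyticGraph} {α : ℝ → (ℂ × ℝ) × ℂ} {a b t₀ : ℝ}
    (hα : ∀ t ∈ Ioo a b, HasDerivAt α (M.chainField (α t)) t) (ht₀ : t₀ ∈ Ioo a b)
    (h₀ : (α t₀).1.2 = t₀) : EqOn (jetLift fun s => (α s).1.1) α (Ioo a b) := by
  have hu : EqOn (fun s => (α s).1.2) id (Ioo a b) :=
    eqOn_of_hasDerivAt (v := fun _ => 1) isOpen_Ioo isPreconnected_Ioo ht₀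
      (fun _ _ => contDiffAt_const) (fun t ht => (hα t ht).fst.snd) (fun t _ => hasDerivAt_id t) h₀
  intro t ht
  have hζ : HasDerivAt (fun s => (α s).1.1) (α t).2 t := (hα t ht).fst.fst
  exact Prod.ext (Prod.ext rfl (hu ht).symm) hζ.deriv

theorem exists_solvesODE {M : AnalyticGraph} (hM : M.LeviNondegenerate) {p : ℂ × ℝ}
    (hp : p ∈ M.Ω) {z₁ : ℂ} (hz : M.CRTransversal p z₁) :
    ∃ ε > 0, ∃ ζ : ℝ → ℂ, M.SolvesODE (fun q => (M.chainJet q).re) (fun q => (M.chainJet q).im)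
      (Ioo (p.2 - ε) (p.2 + ε)) ζ ∧ ζ p.2 = p.1 ∧ deriv ζ p.2 = z₁ := by
  have hq : (p, z₁) ∈ M.transversalJets := ⟨hp, hz⟩
  obtain ⟨α, h₀, ε, hε, hα⟩ :=
    (contDiffAt_chainField hM hq).exists_forall_mem_closedBall_exists_eq_forall_mem_Ioo_hasDerivAt₀
      p.2
  have hmem : p.2 ∈ Ioo (p.2 - ε) (p.2 + ε) := ⟨by linarith, by linarith⟩
  have hlift := jetLift_eq_of_hasDerivAt hα hmem (by rw [h₀])
  have htransversal : ∀ᶠ t in 𝓝 p.2, α t ∈ M.transversalJets :=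
    (hα p.2 hmem).continuousAt.eventually (h₀ ▸ M.isOpen_transversalJets.mem_nhds hq)
  obtain ⟨δ, hδ, hball⟩ :=
    Metric.eventually_nhds_iff_ball.1 (htransversal.and (isOpen_Ioo.mem_nhds hmem))
  rw [Real.ball_eq_Ioo] at hball
  refine ⟨δ, hδ, fun s => (α s).1.1, solvesODE_chainJet_iff.2 fun t ht => ?_, by simp [h₀], ?_⟩
  · obtain ⟨hjet, ht'⟩ := hball t ht
    rw [hlift ht']
    exact ⟨hjet, (hα t ht').congr_of_eventuallyEq
      (eventually_of_mem (isOpen_Ioo.mem_nhds ht') hlift)⟩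
  · exact congrArg Prod.snd ((hlift hmem).trans h₀)

theorem SolvesODE.eqOn {M : AnalyticGraph} (hM : M.LeviNondegenerate) {a b t₀ : ℝ} {ζ ζ' : ℝ → ℂ}
    (ht₀ : t₀ ∈ Ioo a b)
    (h : M.SolvesODE (fun q => (M.chainJet q).re) (fun q => (M.chainJet q).im) (Ioo a b) ζ)
    (h' : M.SolvesODE (fun q => (M.chainJet q).re) (fun q => (M.chainJet q).im) (Ioo a b) ζ')
    (heq : ζ t₀ = ζ' t₀) (hderiv : deriv ζ t₀ = deriv ζ' t₀) : EqOn ζ ζ' (Ioo a b) := by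
  rw [solvesODE_chainJet_iff] at h h'
  have hlift : EqOn (jetLift ζ) (jetLift ζ') (Ioo a b) :=
    eqOn_of_hasDerivAt isOpen_Ioo isPreconnected_Ioo ht₀
      (fun t ht => contDiffAt_chainField hM (h t ht).1) (fun t ht => (h t ht).2)
      (fun t ht => (h' t ht).2) (by simp only [jetLift, heq, hderiv])
  exact fun t ht => congrArg (fun q => q.1.1) (hlift ht)

end AnalyticGraph

/-- The functions `A M` and `B M` of `(u, x, y, x₁, y₁)` are written as functions of
`((x + i y, u), x₁ + i y₁)`, and 2-jets as pairs `(x₁ + i y₁, x₂ + i y₂)`. -/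
theorem proposition8p2 :
    -- normalizing maps exist at every point
    (∀ M : AnalyticGraph, M.LeviNondegenerate → ∀ p ∈ M.Ω,
      ∃ φ : OpenPartialHomeomorph (ℂ × ℂ) (ℂ × ℂ), M.IsNormalizing p φ) ∧
    -- the surface `Σ_p` does not depend on the normalizing map
    (∀ M : AnalyticGraph, M.LeviNondegenerate → ∀ p ∈ M.Ω,
      ∀ φ φ' : OpenPartialHomeomorph (ℂ × ℂ) (ℂ × ℂ),
        M.IsNormalizing p φ → M.IsNormalizing p φ' → M.sigma p φ = M.sigma p φ') ∧
    ∃ A B : AnalyticGraph → (ℂ × ℝ) × ℂ → ℝ,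
      -- `A` and `B` are real-analytic on the space of CR-transversal 1-jets
      (∀ M : AnalyticGraph, M.LeviNondegenerate →
        IsOpen M.transversalJets ∧
        AnalyticOnNhd ℝ (A M) M.transversalJets ∧ AnalyticOnNhd ℝ (B M) M.transversalJets) ∧
      -- `Σ_p` is the graph `x₂ = A`, `y₂ = B` over the CR-transversal 1-jets at `p`
      (∀ M : AnalyticGraph, M.LeviNondegenerate → ∀ p ∈ M.Ω,
        ∀ φ : OpenPartialHomeomorph (ℂ × ℂ) (ℂ × ℂ), M.IsNormalizing p φ →
          M.sigma p φ =
            {j | M.CRTransversal p j.1 ∧ j.2.re = A M (p, j.1) ∧ j.2.im = B M (p, j.1)}) ∧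
      -- the assignment of a 2-jet to a 1-jet is biholomorphically invariant
      (∀ M M' : AnalyticGraph, M.LeviNondegenerate → M'.LeviNondegenerate →
        ∀ (p p' : ℂ × ℝ) (h : OpenPartialHomeomorph (ℂ × ℂ) (ℂ × ℂ)),
          AnalyticGraph.IsLocalBiholomorphism h M p M' p' →
          ∀ z₁ : ℂ, M.CRTransversal p z₁ → M.ImageParamByU h p z₁ →
            ∃ z₁' : ℂ, M'.CRTransversal p' z₁' ∧
              M.prolong h p (z₁, ⟨A M (p, z₁), B M (p, z₁)⟩) =
                (z₁', ⟨A M' (p', z₁'), B M' (p', z₁')⟩)) ∧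
      -- Moser chains: existence and uniqueness for `ẍ = A`, `ÿ = B` with a given initial 1-jet
      (∀ M : AnalyticGraph, M.LeviNondegenerate → ∀ p ∈ M.Ω, ∀ z₁ : ℂ, M.CRTransversal p z₁ →
        (∃ ε > 0, ∃ ζ : ℝ → ℂ, M.SolvesODE (A M) (B M) (Set.Ioo (p.2 - ε) (p.2 + ε)) ζ ∧
          ζ p.2 = p.1 ∧ deriv ζ p.2 = z₁) ∧
        (∀ (a b : ℝ) (ζ ζ' : ℝ → ℂ), p.2 ∈ Set.Ioo a b →
          M.SolvesODE (A M) (B M) (Set.Ioo a b) ζ → M.SolvesODE (A M) (B M) (Set.Ioo a b) ζ' →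
          ζ p.2 = p.1 → deriv ζ p.2 = z₁ → ζ' p.2 = p.1 → deriv ζ' p.2 = z₁ →
          Set.EqOn ζ ζ' (Set.Ioo a b))) := by
  refine ⟨fun M hM p hp => hM.exists_isNormalizing hp,
    fun M _ p _ φ φ' h h' => AnalyticGraph.sigma_eq h h',
    fun M q => (M.chainJet q).re, fun M q => (M.chainJet q).im, fun M hM => ?_,
    fun M _ p _ φ h => AnalyticGraph.sigma_eq_graph h,
    fun M M' _ hM' p p' h hh z₁ hz hu => hh.prolong_chainJet hM' hz hu,
    fun M hM p hp z₁ hz => ⟨AnalyticGraph.exists_solvesODE hM hp hz, ?_⟩⟩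
  · exact ⟨M.isOpen_transversalJets,
      fun q hq => analyticAt_re_comp (AnalyticGraph.analyticAt_chainJet hM hq),
      fun q hq => analyticAt_im_comp (AnalyticGraph.analyticAt_chainJet hM hq)⟩
  · intro a b ζ ζ' hab h h' h₀ h₁ h₀' h₁'
    exact h.eqOn hM hab h' (h₀.trans h₀'.symm) (h₁.trans h₁'.symm)
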